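/- A lattice $\mathcal L\subseteq\mathbb Z^d$ is called $d$-dimensional if it has rank $d$; its dual is $\mathcal L^*=\{x\in\mathbb R^d : \langle x,y\rangle\in\mathbb Z \text{ for all } y\in\mathcal L\}\supseteq\mathbb Z^d$. Norms are Euclidean, and $\mathrm{dist}_{\mathbb R^d/\mathbb Z^d}$ is the induced distance on the torus $\mathbb R^d/\mathbb Z^d$. For all constants $A,B$ there are a constant $C>0$ and a deterministic classical algorithm with the following two properties. (1) Given any $d,m$ and any list of $m$ vectors in $\mathbb Q^d$, the algorithm halts in time polynomial in the bit length of this input. (2) Let $d,m$ be integers with $d+4\le m\le A d$ (so $m=O(d)$), let $T\le \exp(B d)$ and $0<\delta\le\exp(-C d)$ be real numbers (so $T=\exp(O(d))$, and $\delta=\exp(-O(d))$ is allowed as soon as it is sufficiently small), and let $\mathcal L\subseteq\mathbb Z^d$ be a $d$-dimensional lattice with $\det\mathcal L<2^{d^2}$. Let $v_1,\dots,v_m$ be independent and uniformly distributed in the finite group $\mathcal L^*/\mathbb Z^d$. Then, with probability at least $1/4$ over the choice of $v_1,\dots,v_m$, the following holds for all vectors $w_1,\dots,w_m\in[0,1)^d$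 with rational coordinates such that $\mathrm{dist}_{\mathbb R^d/\mathbb Z^d}(w_i,v_i)<\delta$ for all $i\in\{1,\dots,m\}$: on input $d,m,w_1,\dots,w_m$, the algorithm outputs a basis of a sublattice $\Lambda\subseteq\mathcal L$ (possibly of rank less than $d$) that contains all vectors of $\mathcal L$ of norm at most $T$. -/

import Mathlib

/-! ### A machine model with logarithmic (bit) cost

A random-access machine over the integers, programmed by structured while-programs. Its memory
consists of integer registers and of integer arrays with two indices. Every elementary operation
is charged at least the bit lengths of all numbers and addresses it touches, so that polynomial
time for this machine is polynomial time in the usual sense of Turing machines. -/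

namespace RAM

/-- The number of binary digits of `|z|`. -/
def bitLen (z : ℤ) : ℕ := z.natAbs.size

/-- A memory: register `x` holds `s.var x`, cell `(i, j)` of array `a` holds `s.arr a i j`. -/
structure State where
  var : ℕ → ℤ
  arr : ℕ → ℤ → ℤ → ℤ

/-- Write `v` to register `x`. -/
def State.setVar (s : State) (x : ℕ) (v : ℤ) : State :=
  { s with var := fun y => if y = x then v else s.var y }

/-- Write `v` to cell `(i, j)` of array `a`. -/
def State.setArr (s : State) (a : ℕ) (i j v : ℤ) : State :=
  { s with arr := fun b k l => if b = a ∧ k = i ∧ l = j then v else s.arr b k l }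

/-- The binary operations of the machine. -/
inductive Op
  | add
  | sub
  | mul
  | div
  | eq
  | lt

/-- The value of an operation: division is integer division (with `x / 0 = 0`), and comparisons
return `1` for true and `0` for false. -/
def Op.eval : Op → ℤ → ℤ → ℤ
  | .add, x, y => x + y
  | .sub, x, y => x - y
  | .mul, x, y => x * y
  | .div, x, y => x / y
  | .eq, x, y => if x = y then 1 else 0
  | .lt, x, y => if x < y then 1 else 0

/-- Expressions: constants, registers, array cells, and binary operations. -/
inductive Expr
  | const (n : ℤ)
  | var (x : ℕ)
  | cell (a : ℕ) (i j : Expr)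
  | bin (o : Op) (e f : Expr)

/-- The value of an expression. -/
def Expr.eval (s : State) : Expr → ℤ
  | .const n => n
  | .var x => s.var x
  | .cell a i j => s.arr a (i.eval s) (j.eval s)
  | .bin o e f => o.eval (e.eval s) (f.eval s)

/-- The cost of evaluating an expression. Reading a number costs one more than its bit length, and
an operation on numbers of `k` and `l` bits costs `(k + 1) * (l + 1)`. -/
def Expr.cost (s : State) : Expr → ℕ
  | .const n => bitLen n + 1
  | .var x => bitLen (s.var x) + 1
  | .cell a i j => i.cost s + j.cost s + (bitLen (s.arr a (i.eval s) (j.eval s)) + 1)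
  | .bin _ e f => e.cost s + f.cost s + (bitLen (e.eval s) + 1) * (bitLen (f.eval s) + 1)

/-- Programs. A guard is true when its value is nonzero. -/
inductive Prog
  | skip
  | assign (x : ℕ) (e : Expr)
  | store (a : ℕ) (i j e : Expr)
  | seq (c c' : Prog)
  | branch (e : Expr) (c c' : Prog)
  | loop (e : Expr) (c : Prog)

/-- `Exec c s s' t`: started in memory `s`, the program `c` halts in memory `s'` after `t` units
of time. -/
inductive Exec : Prog → State → State → ℕ → Prop
  | skip (s : State) : Exec .skip s s 1
  | assign (s : State) (x : ℕ) (e : Expr) :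
      Exec (.assign x e) s (s.setVar x (e.eval s)) (e.cost s + 1)
  | store (s : State) (a : ℕ) (i j e : Expr) :
      Exec (.store a i j e) s (s.setArr a (i.eval s) (j.eval s) (e.eval s))
        (i.cost s + j.cost s + e.cost s + 1)
  | seq {c c' : Prog} {s s' s'' : State} {t t' : ℕ} :
      Exec c s s' t → Exec c' s' s'' t' → Exec (.seq c c') s s'' (t + t' + 1)
  | branchTrue {e : Expr} {c c' : Prog} {s s' : State} {t : ℕ} :
      e.eval s ≠ 0 → Exec c s s' t → Exec (.branch e c c') s s' (e.cost s + t + 1)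
  | branchFalse {e : Expr} {c c' : Prog} {s s' : State} {t : ℕ} :
      e.eval s = 0 → Exec c' s s' t → Exec (.branch e c c') s s' (e.cost s + t + 1)
  | loopTrue {e : Expr} {c : Prog} {s s' s'' : State} {t t' : ℕ} :
      e.eval s ≠ 0 → Exec c s s' t → Exec (.loop e c) s' s'' t' →
        Exec (.loop e c) s s'' (e.cost s + t + t' + 1)
  | loopFalse {e : Expr} {c : Prog} {s : State} :
      e.eval s = 0 → Exec (.loop e c) s s (e.cost s + 1)

/-- The machine is deterministic: a program has at most one halting run from a given memory. -/
theorem Exec.deterministic {c : Prog} {s s₁ s₂ : State} {t₁ t₂ : ℕ}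
    (h₁ : Exec c s s₁ t₁) (h₂ : Exec c s s₂ t₂) : s₁ = s₂ ∧ t₁ = t₂ := by
  induction h₁ generalizing s₂ t₂ with
  | skip => cases h₂; exact ⟨rfl, rfl⟩
  | assign => cases h₂; exact ⟨rfl, rfl⟩
  | store => cases h₂; exact ⟨rfl, rfl⟩
  | seq _ _ ih ih' =>
    cases h₂ with
    | seq h h' =>
      obtain ⟨rfl, rfl⟩ := ih h
      obtain ⟨rfl, rfl⟩ := ih' h'
      exact ⟨rfl, rfl⟩
  | branchTrue he _ ih =>
    cases h₂ with
    | branchTrue _ h => obtain ⟨rfl, rfl⟩ := ih h; exact ⟨rfl, rfl⟩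
    | branchFalse he' _ => exact absurd he' he
  | branchFalse he _ ih =>
    cases h₂ with
    | branchTrue he' _ => exact absurd he he'
    | branchFalse _ h => obtain ⟨rfl, rfl⟩ := ih h; exact ⟨rfl, rfl⟩
  | loopTrue he _ _ ih ih' =>
    cases h₂ with
    | loopTrue _ h h' =>
      obtain ⟨rfl, rfl⟩ := ih h
      obtain ⟨rfl, rfl⟩ := ih' h'
      exact ⟨rfl, rfl⟩
    | loopFalse he' => exact absurd he' he
  | loopFalse he =>
    cases h₂ with
    | loopTrue he' _ _ => exact absurd he he'
    | loopFalse _ => exact ⟨rfl, rfl⟩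

/-- The matrix `w` as an array: rows and columns are numbered from `0`, and all cells outside the
matrix hold `0`. -/
def matrixCells {m d : ℕ} (w : Fin m → Fin d → ℤ) (i j : ℤ) : ℤ :=
  if h : (0 ≤ i ∧ i.toNat < m) ∧ (0 ≤ j ∧ j.toNat < d) then
    w ⟨i.toNat, h.1.2⟩ ⟨j.toNat, h.2.2⟩
  else 0

/-- The initial memory on input `(d, m, w)`, where `w` is a list of `m` rational vectors of length
`d`: registers `0` and `1` hold `d` and `m`, arrays `0` and `1` hold the numerators and the
denominators of the entries in lowest terms, and everything else is `0`. -/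
def inputState {m d : ℕ} (w : Fin m → Fin d → ℚ) : State where
  var x := if x = 0 then (d : ℤ) else if x = 1 then (m : ℤ) else 0
  arr a := if a = 0 then matrixCells fun i j => (w i j).num
    else if a = 1 then matrixCells fun i j => ((w i j).den : ℤ)
    else fun _ _ => 0

/-- The bit length of the input `(d, m, w)`. -/
def inputSize {m d : ℕ} (w : Fin m → Fin d → ℚ) : ℕ :=
  bitLen d + bitLen m + ∑ i, ∑ j, (bitLen (w i j).num + bitLen (w i j).den)

/-- On every list `w` of rational vectors of the same length, the program halts in time polynomial
in the bit length of the input. -/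
def Prog.IsPolyTime (P : Prog) : Prop :=
  ∃ p : Polynomial ℕ, ∀ (d m : ℕ) (w : Fin m → Fin d → ℚ),
    ∃ (s : State) (t : ℕ), Exec P (inputState w) s t ∧ t ≤ p.eval (inputSize w)

/-- On input `w`, the program outputs the list `b` of `k` integer vectors: it halts with `k` in
register `0` and with the vectors `b` as rows `0, …, k - 1` of array `0`. -/
def Prog.Outputs (P : Prog) {m d k : ℕ} (w : Fin m → Fin d → ℚ) (b : Fin k → Fin d → ℤ) : Prop :=
  ∃ (s : State) (t : ℕ), Exec P (inputState w) s t ∧ s.var 0 = k ∧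
    ∀ (i : Fin k) (j : Fin d), s.arr 0 (i : ℕ) (j : ℕ) = b i j

end RAM

/-! ### Lattices and their duals -/

noncomputable section

/-- The lattice `ℤᵈ` in `ℝᵈ`. -/
def integerLattice (d : ℕ) : Submodule ℤ (EuclideanSpace ℝ (Fin d)) :=
  Submodule.span ℤ (Set.range (EuclideanSpace.basisFun (Fin d) ℝ))

/-- The torus `ℝᵈ / ℤᵈ`. Its distance is the one that Mathlib puts on a quotient of a normed group:
`dist x y` is the least Euclidean distance between representatives of `x` and `y`. -/
abbrev Torus (d : ℕ) : Type := EuclideanSpace ℝ (Fin d) ⧸ integerLattice d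

/-- The dual lattice `L* = {x ∈ ℝᵈ | ⟨x, y⟩ ∈ ℤ for all y ∈ L}`. -/
def dualLattice {d : ℕ} (L : Submodule ℤ (EuclideanSpace ℝ (Fin d))) :
    Submodule ℤ (EuclideanSpace ℝ (Fin d)) :=
  LinearMap.BilinForm.dualSubmodule (innerₗ (EuclideanSpace ℝ (Fin d))) L

/-- The group `L* / ℤᵈ` for a lattice `L ⊆ ℤᵈ`, as the subgroup of the torus `ℝᵈ / ℤᵈ` that
consists of the cosets of the elements of `L*`. -/
def dualCosets {d : ℕ} (L : Submodule ℤ (EuclideanSpace ℝ (Fin d))) : Submodule ℤ (Torus d) :=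
  (dualLattice L).map (integerLattice d).mkQ

/-- The point of `ℝᵈ` with the given rational coordinates. -/
def ratPoint {d : ℕ} (x : Fin d → ℚ) : EuclideanSpace ℝ (Fin d) := WithLp.toLp 2 fun j => (x j : ℝ)

/-- The point of `ℝᵈ` with the given integer coordinates. -/
def intPoint {d : ℕ} (x : Fin d → ℤ) : EuclideanSpace ℝ (Fin d) := WithLp.toLp 2 fun j => (x j : ℝ)

/-- `b` is a basis of the lattice `Λ`, which may have a rank smaller than `d`. -/
def IsLatticeBasis {d k : ℕ} (b : Fin k → EuclideanSpace ℝ (Fin d))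
    (Λ : Submodule ℤ (EuclideanSpace ℝ (Fin d))) : Prop :=
  LinearIndependent ℝ b ∧ Submodule.span ℤ (Set.range b) = Λ

/-- The probability of the event `p` under the uniform distribution on the finite set `α`. -/
def uniformProb (α : Type*) (p : α → Prop) : ℝ := (Nat.card {a // p a} : ℝ) / (Nat.card α : ℝ)

end

/-! ### A program logic with automatic time bounds -/

namespace RAM

/-! Lift `v_i` to `y_i ∈ L*` with `‖w_i - y_i‖ < δ`, put `N = 2 ^ (K * d)`, round `N w_i` to an
integer vector `W_i`, and let `M ⊆ ℤ^(d+m)` be the lattice of all `(u, ⟨W_i, u⟩ + N z_i)` with `u ∈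
ℤ^d`, `z ∈ ℤ^m`. If `u ∈ L`, then all `⟨y_i, u⟩` are integers, so `M` contains `Φ u = (u, ⟨W_i - N
y_i, u⟩)`; since `‖W_i - N y_i‖ ≤ d + 1`, this vector is longer than `u` by a polynomial factor at
most (`graphMap_mem_lat_entry`, `norm_graphMap_sq_le`). Conversely, a vector of `M` of norm
`exp(O(d))` has a first part `u` for which every `⟨u, y_i⟩` is within `ε = 1 / (3 * 2 ^ (d + 2))` of
an integer, if `K` is large. For typical `v` this forces `u ∈ L`; the nearby integers are then
attained exactly and the vector is `Φ u` (`eq_graphMap_of_norm_le`).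

Typical means probability at least 1/2 (`half_le_uniformProb_dualCosets`). A nonzero class of `ℤ^d /
L` gives a character of `L* / ℤ^d` with image of some order `r ≥ 2`, which is at most `ε` in norm on
a proportion at most `max (1/r) (3ε)` of the group. At most `r ^ d` classes belong to `r`
(`card_torsion_le`), and there are fewer than `2 ^ (d ^ 2)` classes in all. As `m ≥ d + 4`, the
union bound gives at most `∑ r ^ (-4) + 2 ^ (d ^ 2) * (3ε) ^ m ≤ 1/4 + 1/4`.

The algorithm reduces the obvious basis of `M` by LLL. Let `k` be minimal such that all Gram–Schmidt
vectors from index `k` on have squared norm above `2 ^ (K' * d)`. Vectors of `M` below that bound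
lie in the span of the first `k` basis vectors (`mem_lat_of_norm_sq_le`), and these `k` vectors are
themselves short enough to lie in `Φ L` (`Siegel.norm_sq_le`). Their first `d` coordinates are
therefore a basis of a sublattice of `L` that contains all short vectors (`exists_latticeBasis`).

For polynomial time, orthogonalization is fraction-free: the numbers `gd b k * ⟪pr b k (b i), b j⟫`
are integers by Cramer's rule and have polynomially many bits. Each swap shrinks a potential, which
is at least 1 on integral bases, by a factor 3/4, so a fixed polynomial number of rounds suffices.
The program logic `Tr` carries correctness, bit bounds and loop bounds at once and turns them into a
time bound. -/

theorem bitLen_le {z : ℤ} {k : ℕ} : bitLen z ≤ k ↔ |z| < 2 ^ k := by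
  rw [bitLen, Nat.size_le, ← Int.natCast_natAbs]
  exact_mod_cast Iff.rfl

/-- All numbers in the memory have at most `b` bits. -/
def State.Bdd (s : State) (b : ℕ) : Prop :=
  (∀ x, |s.var x| < 2 ^ b) ∧ ∀ a i j, |s.arr a i j| < 2 ^ b

/-- A measure of the size of an expression. -/
def Expr.weight : Expr → ℕ
  | .const n => bitLen n + 1
  | .var _ => 1
  | .cell _ i j => i.weight + j.weight + 1
  | .bin _ e f => e.weight + f.weight + 1

theorem bitLen_add_le (x y : ℤ) : bitLen (x + y) ≤ bitLen x + bitLen y + 1 := by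
  rw [bitLen_le]
  have hx := bitLen_le.1 (le_refl (bitLen x))
  have hy := bitLen_le.1 (le_refl (bitLen y))
  have h1 : (2 : ℤ) ^ bitLen x ≤ 2 ^ (bitLen x + bitLen y) :=
    pow_le_pow_right₀ (by norm_num) (by omega)
  have h2 : (2 : ℤ) ^ bitLen y ≤ 2 ^ (bitLen x + bitLen y) :=
    pow_le_pow_right₀ (by norm_num) (by omega)
  calc |x + y| ≤ |x| + |y| := abs_add_le x y
    _ < 2 ^ (bitLen x + bitLen y + 1) := by rw [pow_succ]; linarith

theorem bitLen_neg (x : ℤ) : bitLen (-x) = bitLen x := by simp [bitLen]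

theorem bitLen_mul_le (x y : ℤ) : bitLen (x * y) ≤ bitLen x + bitLen y := by
  rw [bitLen_le, abs_mul, pow_add]
  exact mul_lt_mul'' (bitLen_le.1 le_rfl) (bitLen_le.1 le_rfl) (abs_nonneg _) (abs_nonneg _)

theorem bitLen_div_le (x y : ℤ) : bitLen (x / y) ≤ bitLen x :=
  Nat.size_le_size (Int.natAbs_ediv_le_natAbs x y)

theorem Op.bitLen_eval_le (o : Op) (x y : ℤ) :
    bitLen (o.eval x y) ≤ bitLen x + bitLen y + 1 := by
  cases o with
  | add => exact bitLen_add_le x y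
  | sub =>
    have := bitLen_add_le x (-y)
    rwa [bitLen_neg, ← sub_eq_add_neg] at this
  | mul => exact (bitLen_mul_le x y).trans (by omega)
  | div => exact (bitLen_div_le x y).trans (by omega)
  | eq => by_cases h : x = y <;> simp [Op.eval, h, bitLen]
  | lt => by_cases h : x < y <;> simp [Op.eval, h, bitLen]

/-- Intermediate values of an expression may exceed `b` bits, but only by a factor that depends on
the expression. Hence bounds need to be checked only for values that are written to memory. -/
theorem Expr.bitLen_eval_lt {s : State} {b : ℕ} (hs : s.Bdd b) (e : Expr) :
    bitLen (e.eval s) + 1 ≤ e.weight * (b + 1) := by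
  induction e with
  | const n => simp only [Expr.eval, Expr.weight]; nlinarith
  | var x =>
    have := bitLen_le.2 (hs.1 x)
    simp only [Expr.eval, Expr.weight]; omega
  | cell a i j hi hj =>
    have := bitLen_le.2 (hs.2 a (i.eval s) (j.eval s))
    simp only [Expr.eval, Expr.weight]; nlinarith
  | bin o e f he hf =>
    have := o.bitLen_eval_le (e.eval s) (f.eval s)
    simp only [Expr.eval, Expr.weight]; nlinarith

/-- The cost of one operation is a product of two bit lengths, hence the square of `b + 1`; the
third power of the weight leaves room to absorb the mixed term `e.weight * f.weight` in the
induction. -/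
theorem Expr.cost_le {s : State} {b : ℕ} (hs : s.Bdd b) (e : Expr) :
    e.cost s ≤ e.weight ^ 3 * (b + 1) ^ 2 := by
  have hb : 1 ≤ (b + 1) ^ 2 := Nat.one_le_pow _ _ (by omega)
  have hb' : b + 1 ≤ (b + 1) ^ 2 := Nat.le_self_pow (by norm_num) _
  induction e with
  | const n =>
    simp only [Expr.cost, Expr.weight]
    calc bitLen n + 1 ≤ (bitLen n + 1) ^ 3 := Nat.le_self_pow (by norm_num) _
      _ ≤ _ := Nat.le_mul_of_pos_right _ (by omega)
  | var x =>
    have := bitLen_le.2 (hs.1 x)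
    simp only [Expr.cost, Expr.weight]; omega
  | cell a i j hi hj =>
    have := bitLen_le.2 (hs.2 a (i.eval s) (j.eval s))
    have h1 : i.weight ^ 3 + j.weight ^ 3 + 1 ≤ (i.weight + j.weight + 1) ^ 3 := by
      ring_nf; omega
    simp only [Expr.cost, Expr.weight]
    calc _ ≤ (i.weight ^ 3 + j.weight ^ 3 + 1) * (b + 1) ^ 2 := by nlinarith
      _ ≤ _ := Nat.mul_le_mul_right _ h1
  | bin o e f he hf =>
    have h1 : e.weight ^ 3 + f.weight ^ 3 + e.weight * f.weight ≤ (e.weight + f.weight + 1) ^ 3 := by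
      ring_nf; nlinarith
    have h2 : (bitLen (e.eval s) + 1) * (bitLen (f.eval s) + 1) ≤
        (e.weight * (b + 1)) * (f.weight * (b + 1)) :=
      Nat.mul_le_mul (e.bitLen_eval_lt hs) (f.bitLen_eval_lt hs)
    simp only [Expr.cost, Expr.weight]
    calc _ ≤ (e.weight ^ 3 + f.weight ^ 3 + e.weight * f.weight) * (b + 1) ^ 2 := by nlinarith
      _ ≤ _ := Nat.mul_le_mul_right _ h1

/-- A bound, up to a factor that depends on bit lengths only, for the running time of a program
all of whose loops are repeated at most `l` times. -/
def Prog.time (l : ℕ) : Prog → ℕ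
  | .skip => 1
  | .assign _ e => e.weight ^ 3 + 1
  | .store _ i j e => i.weight ^ 3 + j.weight ^ 3 + e.weight ^ 3 + 1
  | .seq c c' => c.time l + c'.time l + 1
  | .branch e c c' => e.weight ^ 3 + c.time l + c'.time l + 1
  | .loop e c => (l + 1) * (e.weight ^ 3 + c.time l + 1)

theorem Prog.exists_time_eq (c : Prog) : ∃ p : Polynomial ℕ, ∀ l, c.time l = p.eval l := by
  induction c with
  | skip => exact ⟨1, fun l => by simp [Prog.time]⟩
  | assign x e => exact ⟨.C (e.weight ^ 3 + 1), fun l => by rw [Polynomial.eval_C, Prog.time]⟩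
  | store a i j e =>
    exact ⟨.C (i.weight ^ 3 + j.weight ^ 3 + e.weight ^ 3 + 1),
      fun l => by rw [Polynomial.eval_C, Prog.time]⟩
  | seq c c' h h' =>
    obtain ⟨p, hp⟩ := h
    obtain ⟨q, hq⟩ := h'
    exact ⟨p + q + 1, fun l => by simp [Prog.time, hp, hq]⟩
  | branch e c c' h h' =>
    obtain ⟨p, hp⟩ := h
    obtain ⟨q, hq⟩ := h'
    exact ⟨.C (e.weight ^ 3) + p + q + 1, fun l => by
      simp only [Prog.time, hp, hq, Polynomial.eval_add, Polynomial.eval_C, Polynomial.eval_one]⟩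
  | loop e c h =>
    obtain ⟨p, hp⟩ := h
    exact ⟨(.X + 1) * (.C (e.weight ^ 3) + p + 1), fun l => by
      simp only [Prog.time, hp, Polynomial.eval_add, Polynomial.eval_mul, Polynomial.eval_C,
        Polynomial.eval_X, Polynomial.eval_one]⟩

/-- Started in `s`, the program halts with the postcondition `Q`. All numbers have at most `b` bits
during the run, and no loop is repeated more than `l` times. -/
def Tr (b l : ℕ) (c : Prog) (s : State) (Q : State → Prop) : Prop :=
  s.Bdd b → ∃ s' t, Exec c s s' t ∧ t ≤ c.time l * (b + 1) ^ 2 ∧ s'.Bdd b ∧ Q s'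

variable {b l : ℕ} {c c' : Prog} {s : State} {Q Q' : State → Prop}

theorem Tr.mono (h : Tr b l c s Q) (hQ : ∀ s', Q s' → Q' s') : Tr b l c s Q' := fun hs => by
  obtain ⟨s', t, h1, h2, h3, h4⟩ := h hs
  exact ⟨s', t, h1, h2, h3, hQ _ h4⟩

/-- Makes the bit bound of the current memory available, as is needed where a value is merely
copied. -/
theorem Tr.of_bdd (h : s.Bdd b → Tr b l c s Q) : Tr b l c s Q := fun hs => h hs hs

theorem Tr.skip (h : Q s) : Tr b l .skip s Q := fun hs =>
  ⟨s, 1, .skip s, by simpa [Prog.time] using Nat.one_le_pow _ _ (by omega), hs, h⟩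

theorem State.Bdd.setVar (hs : s.Bdd b) (x : ℕ) {v : ℤ} (hv : |v| < 2 ^ b) :
    (s.setVar x v).Bdd b :=
  ⟨fun y => by by_cases h : y = x <;> simp [State.setVar, h, hv, hs.1], hs.2⟩

theorem State.Bdd.setArr (hs : s.Bdd b) (a : ℕ) (i j : ℤ) {v : ℤ} (hv : |v| < 2 ^ b) :
    (s.setArr a i j v).Bdd b :=
  ⟨hs.1, fun a' i' j' => by
    by_cases h : a' = a ∧ i' = i ∧ j' = j <;> simp [State.setArr, h, hv, hs.2]⟩

theorem one_le_sq_succ (b : ℕ) : 1 ≤ (b + 1) ^ 2 := Nat.one_le_pow _ _ (by omega)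

theorem Tr.assign {x : ℕ} {e : Expr} (hv : |e.eval s| < 2 ^ b) (h : Q (s.setVar x (e.eval s))) :
    Tr b l (.assign x e) s Q := fun hs =>
  ⟨_, _, .assign s x e, by
    have := e.cost_le hs
    have := one_le_sq_succ b
    simp only [Prog.time]; nlinarith, hs.setVar x hv, h⟩

theorem Tr.store {a : ℕ} {i j e : Expr} (hv : |e.eval s| < 2 ^ b)
    (h : Q (s.setArr a (i.eval s) (j.eval s) (e.eval s))) :
    Tr b l (.store a i j e) s Q := fun hs =>
  ⟨_, _, .store s a i j e, by
    have := e.cost_le hs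
    have := i.cost_le hs
    have := j.cost_le hs
    have := one_le_sq_succ b
    simp only [Prog.time]; nlinarith, hs.setArr _ _ _ hv, h⟩

theorem Tr.seq (h : Tr b l c s fun s' => Tr b l c' s' Q) : Tr b l (.seq c c') s Q := fun hs => by
  obtain ⟨s', t, h1, h2, h3, h4⟩ := h hs
  obtain ⟨s'', t', h1', h2', h3', h4'⟩ := h4 h3
  have := one_le_sq_succ b
  exact ⟨s'', _, .seq h1 h1', by simp only [Prog.time]; nlinarith, h3', h4'⟩

theorem Tr.branch {e : Expr} (h : e.eval s ≠ 0 → Tr b l c s Q) (h' : e.eval s = 0 → Tr b l c' s Q) :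
    Tr b l (.branch e c c') s Q := fun hs => by
  have := one_le_sq_succ b
  have := e.cost_le hs
  by_cases he : e.eval s = 0
  · obtain ⟨s', t, h1, h2, h3, h4⟩ := h' he hs
    exact ⟨s', _, .branchFalse he h1, by simp only [Prog.time]; nlinarith, h3, h4⟩
  · obtain ⟨s', t, h1, h2, h3, h4⟩ := h he hs
    exact ⟨s', _, .branchTrue he h1, by simp only [Prog.time]; nlinarith, h3, h4⟩

/-- Induction on the number `k` of remaining iterations; the guard is evaluated once more than the
body, whence the factor `k + 1`. -/
theorem exec_loop_of_invariant {e : Expr} (I : ℕ → State → Prop) (N : ℕ)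
    (hN : ∀ s', I N s' → e.eval s' = 0)
    (hstep : ∀ i < N, ∀ s', I i s' → e.eval s' ≠ 0 ∧ Tr b l c s' (I (i + 1)))
    (k : ℕ) (hk : k ≤ N) (s : State) (h : I (N - k) s) (hs : s.Bdd b) :
    ∃ s' t, Exec (.loop e c) s s' t ∧ t ≤ (k + 1) * (e.weight ^ 3 + c.time l + 1) * (b + 1) ^ 2 ∧
      s'.Bdd b ∧ I N s' := by
  have hb := one_le_sq_succ b
  induction k generalizing s with
  | zero =>
    have := e.cost_le hs
    exact ⟨s, _, .loopFalse (hN s h), by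
      calc e.cost s + 1 ≤ (e.weight ^ 3 + 1) * (b + 1) ^ 2 := by nlinarith
        _ ≤ _ := Nat.mul_le_mul_right _ (by omega), hs, h⟩
  | succ k ih =>
    have := e.cost_le hs
    obtain ⟨he, htr⟩ := hstep _ (by omega) s h
    obtain ⟨s', t, h1, h2, h3, h4⟩ := htr hs
    rw [show N - (k + 1) + 1 = N - k by omega] at h4
    obtain ⟨s'', t', h1', h2', h3', h4'⟩ := ih (by omega) s' h4 h3
    refine ⟨s'', _, .loopTrue he h1 h1', ?_, h3', h4'⟩
    nlinarith

/-- `for x = 0, …, e - 1 do c` -/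
def Prog.forLoop (x : ℕ) (e : Expr) (c : Prog) : Prog :=
  .seq (.assign x (.const 0)) (.loop (.bin .lt (.var x) e)
    (.seq c (.assign x (.bin .add (.var x) (.const 1)))))

/-- The bound `e` is evaluated again at each test, so the invariant has to preserve its value. The
body must leave the counter alone, and `I (i + 1)` is asserted after the increment. -/
theorem Tr.forLoop {x : ℕ} {e : Expr} (N : ℕ) (I : ℕ → State → Prop) (hl : N ≤ l)
    (hb : (N : ℤ) < 2 ^ b) (h0 : I 0 (s.setVar x 0))
    (hx : ∀ i ≤ N, ∀ s', I i s' → s'.var x = i ∧ e.eval s' = N)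
    (hstep : ∀ i < N, ∀ s', I i s' → Tr b l c s' fun s'' =>
      s''.var x = i ∧ I (i + 1) (s''.setVar x (i + 1)))
    (hQ : ∀ s', I N s' → Q s') : Tr b l (.forLoop x e c) s Q := by
  refine Tr.seq (Tr.assign (by simp [Expr.eval]) fun hs => ?_)
  obtain ⟨s', t, h1, h2, h3, h4⟩ := exec_loop_of_invariant (b := b) (l := l)
    (e := .bin .lt (.var x) e) (c := .seq c (.assign x (.bin .add (.var x) (.const 1)))) I N
    (fun s' h => by simp [Expr.eval, Op.eval, hx N le_rfl s' h])
    (fun i hi s' h => ⟨by simp [Expr.eval, Op.eval, hx i hi.le s' h, hi], by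
      refine Tr.seq ((hstep i hi s' h).mono fun s'' h'' => Tr.assign ?_ ?_)
      · simp only [Expr.eval, Op.eval, h''.1]
        rw [abs_of_nonneg (by omega)]; omega
      · simp only [Expr.eval, Op.eval, h''.1]
        exact h''.2⟩) N le_rfl (s.setVar x 0) (by simpa using h0) hs
  exact ⟨s', t, h1, h2.trans (Nat.mul_le_mul_right _ (by
    simp only [Prog.time]; exact Nat.mul_le_mul_right _ (by omega))), h3, hQ s' h4⟩

@[simp] theorem State.var_setVar (s : State) (x y : ℕ) (v : ℤ) :
    (s.setVar x v).var y = if y = x then v else s.var y := rfl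

@[simp] theorem State.arr_setVar (s : State) (x : ℕ) (v : ℤ) : (s.setVar x v).arr = s.arr := rfl

@[simp] theorem State.var_setArr (s : State) (a : ℕ) (i j v : ℤ) :
    (s.setArr a i j v).var = s.var := rfl

theorem State.arr_setArr (s : State) (a a' : ℕ) (i j v k k' : ℤ) :
    (s.setArr a i j v).arr a' k k' = if a' = a ∧ k = i ∧ k' = j then v else s.arr a' k k' := rfl

theorem State.arr_setArr_of_ne (s : State) {a a' : ℕ} (h : a' ≠ a) (i j v : ℤ) :
    (s.setArr a i j v).arr a' = s.arr a' := by
  funext k k'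
  simp [State.setArr, h]

end RAM

/-! ### Gram–Schmidt orthogonalization and lattice reduction -/

namespace LLL

open Submodule

variable {V : Type*} [NormedAddCommGroup V] [InnerProductSpace ℝ V]

local notation "⟪" x ", " y "⟫" => inner ℝ x y

/-- The span of the first `k` vectors. -/
def flag (b : ℕ → V) (k : ℕ) : Submodule ℝ V := span ℝ (b '' Set.Iio k)

variable {b : ℕ → V} {k : ℕ}

theorem mem_flag {i : ℕ} (h : i < k) : b i ∈ flag b k := subset_span ⟨i, h, rfl⟩

theorem flag_mono {j : ℕ} (h : j ≤ k) : flag b j ≤ flag b k :=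
  span_mono (Set.image_mono fun _ hx => lt_of_lt_of_le hx h)

variable [FiniteDimensional ℝ V]

/-- The projection orthogonal to the first `k` vectors. -/
noncomputable def pr (b : ℕ → V) (k : ℕ) : V →L[ℝ] V := (flag b k)ᗮ.starProjection

/-- The Gram–Schmidt vectors. -/
noncomputable def gs (b : ℕ → V) (k : ℕ) : V := pr b k (b k)

/-- The Gram determinant of the first `k` vectors. -/
noncomputable def gd (b : ℕ → V) (k : ℕ) : ℝ := ∏ l ∈ Finset.range k, ‖gs b l‖ ^ 2

theorem pr_mem (x : V) : pr b k x ∈ (flag b k)ᗮ := starProjection_apply_mem _ _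

theorem sub_pr_mem (x : V) : x - pr b k x ∈ flag b k := by
  have := sub_starProjection_mem_orthogonal (K := (flag b k)ᗮ) x
  rwa [orthogonal_orthogonal] at this

theorem pr_eq {x y : V} (hy : y ∈ (flag b k)ᗮ) (hxy : x - y ∈ flag b k) : pr b k x = y := by
  refine eq_starProjection_of_mem_orthogonal hy ?_
  rwa [orthogonal_orthogonal]

theorem pr_eq_zero {x : V} (hx : x ∈ flag b k) : pr b k x = 0 :=
  pr_eq (zero_mem _) (by simpa using hx)

theorem pr_zero (x : V) : pr b 0 x = x := pr_eq (by simp [flag]) (by simp)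

theorem inner_pr_eq_zero {x y : V} (hy : y ∈ flag b k) : ⟪pr b k x, y⟫ = 0 :=
  inner_left_of_mem_orthogonal hy (pr_mem x)

theorem inner_pr_pr (x y : V) : ⟪pr b k x, pr b k y⟫ = ⟪pr b k x, y⟫ := by
  have : ⟪pr b k x, y - pr b k y⟫ = 0 := inner_pr_eq_zero (sub_pr_mem y)
  rw [inner_sub_right] at this
  linarith

theorem inner_pr_left (x y : V) : ⟪pr b k x, y⟫ = ⟪x, pr b k y⟫ := by
  rw [← inner_pr_pr, real_inner_comm, inner_pr_pr, real_inner_comm]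

theorem norm_pr_le (x : V) : ‖pr b k x‖ ≤ ‖x‖ := norm_starProjection_apply_le _ _

theorem norm_gs_le : ‖gs b k‖ ≤ ‖b k‖ := norm_pr_le _

theorem gs_mem : gs b k ∈ flag b (k + 1) := by
  have h := sub_mem (mem_flag (b := b) (Nat.lt_succ_self k))
    (flag_mono (Nat.le_succ k) (sub_pr_mem (b := b) (k := k) (b k)))
  simpa [gs] using h

theorem flag_succ : flag b (k + 1) = flag b k ⊔ span ℝ {gs b k} := by
  apply le_antisymm
  · refine span_le.2 ?_
    rintro _ ⟨i, hi, rfl⟩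
    rcases Nat.lt_succ_iff_lt_or_eq.1 hi with h | rfl
    · exact mem_sup_left (mem_flag h)
    · rw [show b i = (b i - pr b i (b i)) + gs b i by simp [gs]]
      exact add_mem (mem_sup_left (sub_pr_mem _)) (mem_sup_right (mem_span_singleton_self _))
  · refine sup_le (flag_mono (Nat.le_succ k)) ?_
    rw [span_singleton_le_iff_mem]
    exact gs_mem

theorem inner_pr_gs (x : V) : ⟪pr b k x, gs b k⟫ = ⟪x, gs b k⟫ := by
  rw [inner_pr_left, gs, ← gs, gs, pr_eq (pr_mem (b k))]
  simp

theorem pr_succ (x : V) :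
    pr b (k + 1) x = pr b k x - (⟪x, gs b k⟫ / ‖gs b k‖ ^ 2) • gs b k := by
  apply pr_eq
  · rw [flag_succ, mem_orthogonal']
    intro w hw
    obtain ⟨y, hy, z, hz, rfl⟩ := mem_sup.1 hw
    obtain ⟨c, rfl⟩ := mem_span_singleton.1 hz
    have h1 : ⟪gs b k, y⟫ = 0 := inner_pr_eq_zero hy
    have h2 : ⟪pr b k x, y⟫ = 0 := inner_pr_eq_zero hy
    simp only [inner_add_right, inner_sub_left, inner_smul_left, inner_smul_right, h1, h2,
      inner_pr_gs, real_inner_self_eq_norm_sq]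
    by_cases h : gs b k = 0
    · simp [h]
    · have : ‖gs b k‖ ≠ 0 := by simpa using h
      simp only [conj_trivial]
      field_simp
      ring
  · rw [show ∀ u v w : V, u - (v - w) = u - v + w by intros; abel]
    exact add_mem (flag_mono (Nat.le_succ k) (sub_pr_mem x)) (smul_mem _ _ gs_mem)

/-- This rank-one update, multiplied by Gram determinants, is the recursion that `elimProg` carries
out in integers. -/
theorem inner_pr_succ (x y : V) : ⟪pr b (k + 1) x, y⟫ =
    ⟪pr b k x, y⟫ - ⟪x, gs b k⟫ * ⟪y, gs b k⟫ / ‖gs b k‖ ^ 2 := by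
  rw [pr_succ, inner_sub_left, inner_smul_left, real_inner_comm y (gs b k)]
  simp
  ring

theorem inner_eq_sum (x y : V) : ⟪x, y⟫ =
    ⟪pr b k x, y⟫ + ∑ l ∈ Finset.range k, ⟪x, gs b l⟫ * ⟪y, gs b l⟫ / ‖gs b l‖ ^ 2 := by
  induction k with
  | zero => simp [pr_zero]
  | succ k ih => rw [ih, inner_pr_succ, Finset.sum_range_succ]; ring

theorem gd_succ : gd b (k + 1) = gd b k * ‖gs b k‖ ^ 2 := Finset.prod_range_succ _ _

theorem gd_zero : gd b 0 = 1 := rfl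

/-- The first `n` vectors are linearly independent. -/
def Indep (b : ℕ → V) (n : ℕ) : Prop := ∀ i < n, gs b i ≠ 0

theorem Indep.gd_pos {n : ℕ} (h : Indep b n) (hk : k ≤ n) : 0 < gd b k :=
  Finset.prod_pos fun i hi => by
    have := h i (by simp at hi; omega)
    positivity

theorem indep_of_linearIndependent {n : ℕ} (h : LinearIndependent ℝ fun i : Fin n => b i) :
    Indep b n := fun i hi h0 => by
  have hmem : b i ∈ flag b i := by
    have := sub_pr_mem (b := b) (k := i) (b i)
    rwa [show pr b i (b i) = 0 from h0, sub_zero] at this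
  refine (linearIndependent_iff_notMem_span.1 h) ⟨i, hi⟩ (span_mono ?_ hmem)
  rintro _ ⟨j, hj, rfl⟩
  exact ⟨⟨j, lt_trans hj hi⟩, by simpa [Fin.ext_iff] using (ne_of_lt hj), rfl⟩

/-- The Gram determinant is the determinant of the Gram matrix. -/
theorem det_gram_eq (h : Indep b k) :
    (Matrix.of fun i j : Fin k => ⟪b i, b j⟫).det = gd b k := by
  let U : Matrix (Fin k) (Fin k) ℝ := Matrix.of fun i l => ⟪b i, gs b l⟫ / ‖gs b l‖ ^ 2
  let D : Matrix (Fin k) (Fin k) ℝ := Matrix.diagonal fun l => ‖gs b l‖ ^ 2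
  have hne (l : Fin k) : ‖gs b l‖ ^ 2 ≠ 0 := by simpa using h l l.2
  have hU : U.det = 1 := by
    rw [Matrix.det_of_isLowerTriangular U]
    · refine Finset.prod_eq_one fun i _ => ?_
      simp only [U, Matrix.of_apply]
      rw [← inner_pr_gs, ← gs, real_inner_self_eq_norm_sq, div_self (hne i)]
    · intro i j hij
      simp only [U, Matrix.of_apply]
      rw [real_inner_comm, gs, inner_pr_eq_zero (mem_flag (by simpa using hij)), zero_div]
  -- Gram–Schmidt factors the Gram matrix as `U D Uᵀ` with `U` unitriangular; the projection term of
  -- `inner_eq_sum` vanishes because `b j` lies in `flag b k`.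
  have hG : (Matrix.of fun i j : Fin k => ⟪b i, b j⟫) = U * D * U.transpose := by
    ext i j
    rw [Matrix.of_apply, inner_eq_sum (b := b) (k := k), inner_pr_eq_zero (mem_flag j.2), zero_add,
      Finset.sum_range, Matrix.mul_apply]
    refine Finset.sum_congr rfl fun l _ => ?_
    simp only [U, D, Matrix.mul_diagonal, Matrix.transpose_apply, Matrix.of_apply]
    have := hne l
    field_simp
  rw [hG, Matrix.det_mul, Matrix.det_mul, Matrix.det_transpose, hU, Matrix.det_diagonal, gd,
    Finset.prod_range]
  simp

/-- Integrality of the numbers that occur in fraction-free orthogonalization. -/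
theorem exists_int_gd_mul_inner {n : ℕ} (h : Indep b n) {g : ℕ → ℕ → ℤ}
    (hg : ∀ i < n, ∀ j < n, ⟪b i, b j⟫ = g i j) {i j : ℕ} (hk : k ≤ n) (hi : i < n) (hj : j < n) :
    ∃ z : ℤ, gd b k * ⟪pr b k (b i), b j⟫ = z := by
  let A : Matrix (Fin k) (Fin k) ℤ := Matrix.of fun a c => g a c
  let r : Fin k → ℤ := fun a => g a i
  have hlt (a : Fin k) : (a : ℕ) < n := by omega
  have hdet : (A.det : ℝ) = gd b k := by
    rw [← det_gram_eq (fun i hi => h i (by omega)), ← eq_intCast (Int.castRingHom ℝ), RingHom.map_det]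
    congr 1
    ext a c
    simp [A, hg a (hlt a) c (hlt c)]
  -- Cramer's rule solves the normal equations with integral coefficients: `y` is orthogonal to the
  -- flag and differs from `det A • b i` by a vector of the flag, so it is the projection scaled by
  -- the Gram determinant.
  let y : V := (A.det : ℝ) • b i - ∑ a, (A.cramer r a : ℝ) • b a
  have hy : pr b k ((A.det : ℝ) • b i) = y := by
    apply pr_eq
    · rw [flag, mem_orthogonal']
      intro z hz
      induction hz using span_induction with
      | zero => simp
      | add _ _ _ _ h1 h2 => rw [inner_add_right, h1, h2, add_zero]
      | smul c _ _ h1 => rw [inner_smul_right, h1, mul_zero]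
      | mem z hz =>
        obtain ⟨c, hc, rfl⟩ := hz
        have hc' : c < k := hc
        have h1 : ∑ a : Fin k, g c a * A.cramer r a = A.det * g c i :=
          congrFun (A.mulVec_cramer r) ⟨c, hc'⟩
        have h2 : ⟪b i, b c⟫ = g c i := by rw [real_inner_comm, hg c (by omega) i hi]
        have h3 (a : Fin k) : ⟪b a, b c⟫ = g c a := by
          rw [real_inner_comm, hg c (by omega) a (hlt a)]
        simp only [y, inner_sub_left, sum_inner, inner_smul_left, h2, h3]
        have h4 : ∑ a : Fin k, (g c a : ℝ) * (A.cramer r a : ℝ) = (A.det : ℝ) * g c i := by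
          rw [← Int.cast_mul, ← h1, Int.cast_sum]
          simp only [Int.cast_mul]
        simp only [conj_trivial]
        rw [sub_eq_zero, ← h4]
        exact Finset.sum_congr rfl fun a _ => mul_comm _ _
    · simp only [y, sub_sub_cancel]
      exact sum_mem fun a _ => smul_mem _ _ (mem_flag a.2)
  refine ⟨A.det * g i j - ∑ a, A.cramer r a * g a j, ?_⟩
  have h5 : (A.det : ℝ) * ⟪pr b k (b i), b j⟫ = ⟪y, b j⟫ := by
    rw [← hy, map_smul, real_inner_smul_left]
  rw [← hdet, h5]
  simp [y, inner_sub_left, sum_inner, inner_smul_left, hg i hi j hj, hg _ (hlt _) j hj]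

end LLL

/-! ### Row operations and swaps: their effect on Gram–Schmidt vectors, potential and lattice -/

namespace LLL

set_option linter.unusedSectionVars false

open Submodule

variable {V : Type*} [NormedAddCommGroup V] [InnerProductSpace ℝ V]

local notation "⟪" x ", " y "⟫" => inner ℝ x y

variable {b b' : ℕ → V} {k n p : ℕ}

theorem flag_update_le {i j : ℕ} (hij : j < i) (c : ℝ) :
    flag (Function.update b i (b i + c • b j)) k ≤ flag b k := by
  refine span_le.2 ?_
  rintro _ ⟨l, hl, rfl⟩
  have hl' : l < k := hl
  by_cases h : l = i
  · subst h
    rw [Function.update_self]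
    exact add_mem (mem_flag hl') (smul_mem _ _ (mem_flag (hij.trans hl')))
  · rw [Function.update_of_ne h]
    exact mem_flag hl'

theorem flag_update {i j : ℕ} (hij : j < i) (c : ℝ) :
    flag (Function.update b i (b i + c • b j)) k = flag b k := by
  refine le_antisymm (flag_update_le hij c) ?_
  have h := flag_update_le (b := Function.update b i (b i + c • b j)) (k := k) hij (-c)
  simpa [Function.update_of_ne hij.ne, Function.update_eq_self] using h

theorem image_swap {s : Set ℕ} (h : p ∈ s ↔ p + 1 ∈ s) :
    (b ∘ Equiv.swap p (p + 1)) '' s = b '' s := by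
  rw [Set.image_comp]
  congr 1
  ext x
  rw [Equiv.image_eq_preimage_symm, Set.mem_preimage, Equiv.symm_swap, Equiv.swap_apply_def]
  split_ifs with h1 h2
  · rw [h1, h]
  · rw [h2, h]
  · rfl

theorem flag_swap (hk : k ≠ p + 1) : flag (b ∘ Equiv.swap p (p + 1)) k = flag b k := by
  rw [flag, image_swap (by simp only [Set.mem_Iio]; omega), flag]

variable [FiniteDimensional ℝ V]

theorem pr_congr (h : flag b k = flag b' k) : pr b k = pr b' k :=
  congrArg (fun K : Submodule ℝ V => Kᗮ.starProjection) h

theorem gs_update {i j : ℕ} (hij : j < i) (c : ℝ) (l : ℕ) :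
    gs (Function.update b i (b i + c • b j)) l = gs b l := by
  rw [gs, pr_congr (flag_update hij c), gs]
  by_cases h : l = i
  · subst h
    rw [Function.update_self, map_add, map_smul, pr_eq_zero (mem_flag hij), smul_zero, add_zero]
  · rw [Function.update_of_ne h]

/-- Both sides are the Gram determinant of the projections of `b p` and `b (p + 1)`. The right side
is symmetric in the two vectors, which makes the left side invariant under their swap. -/
theorem norm_gs_succ_sq (b : ℕ → V) (p : ℕ) :
    ‖gs b p‖ ^ 2 * ‖gs b (p + 1)‖ ^ 2 =
      ‖pr b p (b p)‖ ^ 2 * ‖pr b p (b (p + 1))‖ ^ 2 - ⟪pr b p (b p), pr b p (b (p + 1))⟫ ^ 2 := by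
  have h1 : ‖gs b (p + 1)‖ ^ 2 = ‖pr b p (b (p + 1))‖ ^ 2 -
      ⟪pr b p (b (p + 1)), gs b p⟫ ^ 2 / ‖gs b p‖ ^ 2 := by
    rw [← real_inner_self_eq_norm_sq, gs, inner_pr_pr, inner_pr_succ, ← inner_pr_pr,
      real_inner_self_eq_norm_sq, inner_pr_gs, sq ⟪_, _⟫]
  rw [h1, ← gs, real_inner_comm]
  by_cases h : gs b p = 0
  · simp [h]
  · have : ‖gs b p‖ ≠ 0 := by simpa using h
    field_simp

theorem gs_swap_self (b : ℕ → V) (p : ℕ) :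
    gs (b ∘ Equiv.swap p (p + 1)) p = pr b p (b (p + 1)) := by
  rw [gs, pr_congr (flag_swap (by omega))]
  simp

theorem gs_swap_of_ne {l : ℕ} (h : l ≠ p) (h' : l ≠ p + 1) :
    gs (b ∘ Equiv.swap p (p + 1)) l = gs b l := by
  rw [gs, pr_congr (flag_swap h'), Function.comp, Equiv.swap_apply_of_ne_of_ne h h', gs]

theorem norm_gs_swap_mul (b : ℕ → V) (p : ℕ) :
    ‖gs (b ∘ Equiv.swap p (p + 1)) p‖ ^ 2 * ‖gs (b ∘ Equiv.swap p (p + 1)) (p + 1)‖ ^ 2 =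
      ‖gs b p‖ ^ 2 * ‖gs b (p + 1)‖ ^ 2 := by
  rw [norm_gs_succ_sq, norm_gs_succ_sq, pr_congr (flag_swap (by omega)), Function.comp_apply,
    Function.comp_apply, Equiv.swap_apply_left, Equiv.swap_apply_right, real_inner_comm,
    mul_comm (_ ^ 2)]

/-- After the swap the vector at `p + 1` is `b p`, which differs from `gs b p` by an element of
`flag b p`. So the new Gram–Schmidt vector is a projection of `gs b p`. -/
theorem norm_gs_swap_succ_le (b : ℕ → V) (p : ℕ) :
    ‖gs (b ∘ Equiv.swap p (p + 1)) (p + 1)‖ ≤ ‖gs b p‖ := by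
  have h1 : flag b p ≤ flag (b ∘ Equiv.swap p (p + 1)) (p + 1) := by
    rw [← flag_swap (b := b) (p := p) (k := p) (by omega)]
    exact flag_mono (Nat.le_succ p)
  have h2 : gs (b ∘ Equiv.swap p (p + 1)) (p + 1) =
      pr (b ∘ Equiv.swap p (p + 1)) (p + 1) (gs b p) := by
    have h3 := pr_eq_zero (h1 (sub_pr_mem (b p)))
    rw [map_sub, sub_eq_zero] at h3
    rw [gs, Function.comp, Equiv.swap_apply_right]
    exact h3
  rw [h2]
  exact norm_pr_le _

theorem norm_gs_succ_le (b : ℕ → V) (p : ℕ) : ‖gs b (p + 1)‖ ≤ ‖pr b p (b (p + 1))‖ := by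
  have := norm_gs_swap_succ_le (b ∘ Equiv.swap p (p + 1)) p
  rwa [gs_swap_self, Function.comp_assoc, ← Equiv.Perm.coe_mul, Equiv.swap_mul_self] at this

theorem Indep.swap (h : Indep b n) (hp : p + 1 < n) : Indep (b ∘ Equiv.swap p (p + 1)) n := by
  intro i hi
  have h1 : gs (b ∘ Equiv.swap p (p + 1)) p ≠ 0 := by
    rw [gs_swap_self, ← norm_pos_iff]
    exact (norm_pos_iff.2 (h _ hp)).trans_le (norm_gs_succ_le b p)
  by_cases hip : i = p
  · rwa [hip]
  by_cases hip' : i = p + 1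
  · subst hip'
    intro h0
    have h2 := norm_gs_swap_mul b p
    rw [h0] at h2
    have h3 := norm_pos_iff.2 (h p (by omega))
    have h4 := norm_pos_iff.2 (h _ hp)
    have : 0 < ‖gs b p‖ ^ 2 * ‖gs b (p + 1)‖ ^ 2 := by positivity
    simp at h2
    rcases h2 with h2 | h2 <;> simp_all
  · rw [gs_swap_of_ne hip hip']
    exact h i hi

theorem Indep.linearIndependent (h : Indep b n) (hk : k ≤ n) :
    LinearIndependent ℝ fun i : Fin k => b i := by
  induction k with
  | zero => exact linearIndependent_empty_type
  | succ k ih =>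
    rw [linearIndependent_finSucc']
    refine ⟨ih (by omega), fun hmem => h k (by omega) (pr_eq_zero (span_mono ?_ hmem))⟩
    rintro _ ⟨i, rfl⟩
    exact ⟨i, i.2, rfl⟩

theorem gd_congr {m : ℕ} (h : ∀ l < m, gs b l = gs b' l) : gd b m = gd b' m :=
  Finset.prod_congr rfl fun l hl => by rw [h l (by simpa using hl)]

theorem gd_swap_of_ne {m : ℕ} (hm : m ≠ p + 1) : gd (b ∘ Equiv.swap p (p + 1)) m = gd b m := by
  rcases lt_or_gt_of_ne hm with h | h
  · exact gd_congr fun l hl => gs_swap_of_ne (by omega) (by omega)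
  · obtain ⟨j, rfl⟩ : ∃ j, m = p + 2 + j := ⟨m - (p + 2), by omega⟩
    clear hm h
    induction j with
    | zero =>
      rw [add_zero, gd_succ, gd_succ, gd_succ, gd_succ, mul_assoc, mul_assoc, norm_gs_swap_mul,
        gd_congr fun l hl => gs_swap_of_ne (by omega) (by omega)]
    | succ j ih => rw [← add_assoc, gd_succ, gd_succ, ih, gs_swap_of_ne (by omega) (by omega)]

/-- The potential of lattice reduction. -/
noncomputable def pot (b : ℕ → V) (n : ℕ) : ℝ := ∏ k ∈ Finset.range n, gd b (k + 1)

/-- Only the Gram determinant of the first `p + 1` vectors changes, and there only the last factor,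
from `‖gs b p‖ ^ 2` to the squared norm of the projection of `b (p + 1)`. -/
theorem pot_swap_le (h : Indep b n) (hp : p + 1 < n)
    (hlt : ‖pr b p (b (p + 1))‖ ^ 2 ≤ 3 / 4 * ‖gs b p‖ ^ 2) :
    pot (b ∘ Equiv.swap p (p + 1)) n ≤ 3 / 4 * pot b n := by
  have hmem : p ∈ Finset.range n := by simp; omega
  rw [pot, pot, ← Finset.mul_prod_erase _ _ hmem, ← Finset.mul_prod_erase _ _ hmem, ← mul_assoc]
  have h1 : ∏ k ∈ (Finset.range n).erase p, gd (b ∘ Equiv.swap p (p + 1)) (k + 1) =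
      ∏ k ∈ (Finset.range n).erase p, gd b (k + 1) :=
    Finset.prod_congr rfl fun k hk => gd_swap_of_ne (by simp at hk; omega)
  rw [h1]
  refine mul_le_mul_of_nonneg_right ?_ (Finset.prod_nonneg fun k hk => (h.gd_pos ?_).le)
  · rw [gd_succ, gd_succ, gd_swap_of_ne (by omega), gs_swap_self]
    have := h.gd_pos (k := p) (by omega)
    nlinarith
  · simp at hk; omega

/-- The Gram matrix is integral. -/
def Integral (b : ℕ → V) (n : ℕ) : Prop := ∀ i < n, ∀ j < n, ∃ z : ℤ, ⟪b i, b j⟫ = z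

theorem Integral.exists_int (hz : Integral b n) (h : Indep b n) {i j : ℕ} (hk : k ≤ n) (hi : i < n)
    (hj : j < n) : ∃ z : ℤ, gd b k * ⟪pr b k (b i), b j⟫ = z := by
  choose! g hg using hz
  exact exists_int_gd_mul_inner h hg hk hi hj

theorem inner_pr_self (b : ℕ → V) (k : ℕ) : ⟪pr b k (b k), b k⟫ = ‖gs b k‖ ^ 2 := by
  rw [← inner_pr_pr, ← gs, real_inner_self_eq_norm_sq]

/-- A Gram determinant of independent vectors with integral inner products is a positive integer.
This bounds the potential below and keeps Gram–Schmidt vectors from being too short. -/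
theorem Integral.one_le_gd (hz : Integral b n) (h : Indep b n) (hk : k ≤ n) : 1 ≤ gd b k := by
  cases k with
  | zero => rw [gd_zero]
  | succ k =>
    obtain ⟨z, hz⟩ := hz.exists_int h (i := k) (j := k) (k := k) (by omega) (by omega) (by omega)
    have h1 := h.gd_pos hk
    rw [inner_pr_self, ← gd_succ] at hz
    rw [hz] at h1 ⊢
    exact_mod_cast h1

theorem Integral.one_le_pot (hz : Integral b n) (h : Indep b n) : 1 ≤ pot b n :=
  Finset.prod_induction _ (1 ≤ ·) (fun _ _ => one_le_mul_of_one_le_of_one_le) le_rfl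
    fun k hk => hz.one_le_gd h (by simp at hk; omega)

theorem gd_le {R : ℝ} (hR : ∀ i < n, ‖gs b i‖ ^ 2 ≤ R) (hk : k ≤ n) : gd b k ≤ R ^ k := by
  calc gd b k ≤ ∏ l ∈ Finset.range k, R :=
        Finset.prod_le_prod (fun _ _ => by positivity) fun l hl => hR l (by simp at hl; omega)
    _ = R ^ k := by simp

theorem pot_le {R : ℝ} (h1 : 1 ≤ R) (hR : ∀ i < n, ‖gs b i‖ ^ 2 ≤ R) :
    pot b n ≤ R ^ (n * n) := by
  calc pot b n ≤ ∏ k ∈ Finset.range n, R ^ n :=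
        Finset.prod_le_prod (fun k _ => Finset.prod_nonneg fun _ _ => by positivity) fun k hk => by
          simp at hk
          exact (gd_le hR (by omega)).trans (pow_le_pow_right₀ h1 (by omega))
    _ = R ^ (n * n) := by simp [pow_mul]

/-- The vector `b i` is size reduced with respect to the Gram–Schmidt vectors `j, …, i - 1`. -/
def SizeRed (b : ℕ → V) (i j : ℕ) : Prop :=
  ∀ l, j ≤ l → l < i → |⟪b i, gs b l⟫| ≤ 1 / 2 * ‖gs b l‖ ^ 2

/-- Each of the `i` earlier Gram–Schmidt directions contributes at most a quarter of `R` to the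
squared norm, and the last one at most `R`. -/
theorem SizeRed.norm_sq_le {i : ℕ} {R : ℝ} (h : SizeRed b i 0) (hR : ∀ l ≤ i, ‖gs b l‖ ^ 2 ≤ R) :
    ‖b i‖ ^ 2 ≤ (i + 1) * R := by
  rw [← real_inner_self_eq_norm_sq, inner_eq_sum (b := b) (k := i), inner_pr_self]
  have h1 : ∀ l ∈ Finset.range i, ⟪b i, gs b l⟫ * ⟪b i, gs b l⟫ / ‖gs b l‖ ^ 2 ≤ R := by
    intro l hl
    have hl' := Finset.mem_range.1 hl
    have h2 := h l (Nat.zero_le _) hl'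
    have h3 := hR l hl'.le
    have h4 : (0 : ℝ) ≤ ‖gs b l‖ ^ 2 := by positivity
    refine (div_le_of_le_mul₀ h4 (h4.trans h3) ?_)
    rw [← abs_mul_abs_self]
    nlinarith [abs_nonneg ⟪b i, gs b l⟫]
  have h5 := Finset.sum_le_sum h1
  simp only [Finset.sum_const, Finset.card_range, nsmul_eq_mul] at h5
  linarith [hR i le_rfl]

/-- Consecutive Gram–Schmidt vectors do not decrease by a factor of more than `√2`. -/
def Siegel (b : ℕ → V) (n : ℕ) : Prop := ∀ i, i + 1 < n → ‖gs b i‖ ^ 2 ≤ 2 * ‖gs b (i + 1)‖ ^ 2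

theorem Siegel.norm_gs_sq_le (h : Siegel b n) {i j : ℕ} (hj : i + j < n) :
    ‖gs b i‖ ^ 2 ≤ 2 ^ j * ‖gs b (i + j)‖ ^ 2 := by
  induction j with
  | zero => simp
  | succ j ih =>
    have h1 := ih (by omega)
    have h2 := h (i + j) (by omega)
    have h3 : (0 : ℝ) < 2 ^ j := by positivity
    rw [pow_succ (2 : ℝ) j, ← add_assoc]
    nlinarith

/-- By the Siegel condition a short Gram–Schmidt vector at `k` forces the earlier ones to be at most
`2 ^ n` times larger in square; size reduction costs a factor `i + 1`, which is at most another `2 ^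
n`. -/
theorem Siegel.norm_sq_le {T : ℝ} (h : Siegel b n) (hr : ∀ i < n, SizeRed b i 0) (hk : k < n)
    (hT : ‖gs b k‖ ^ 2 ≤ T) {i : ℕ} (hi : i ≤ k) : ‖b i‖ ^ 2 ≤ 4 ^ n * T := by
  have hT0 : 0 ≤ T := le_trans (by positivity) hT
  have h1 : ∀ l ≤ i, ‖gs b l‖ ^ 2 ≤ 2 ^ n * T := by
    intro l hl
    have h2 := h.norm_gs_sq_le (i := l) (j := k - l) (by omega)
    rw [show l + (k - l) = k by omega] at h2
    exact h2.trans (mul_le_mul (pow_le_pow_right₀ (by norm_num) (by omega)) hT (by positivity)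
      (by positivity))
  refine ((hr i (by omega)).norm_sq_le h1).trans ?_
  have h3 : ((i : ℝ) + 1) ≤ 2 ^ n := by
    have : i + 1 ≤ 2 ^ n := (Nat.lt_of_le_of_lt hi hk).trans_le Nat.lt_two_pow_self.le
    exact_mod_cast this
  calc ((i : ℝ) + 1) * (2 ^ n * T) ≤ 2 ^ n * (2 ^ n * T) := by gcongr
    _ = 4 ^ n * T := by rw [← mul_assoc, ← mul_pow]; norm_num

/-- The lattice generated by the first `n` vectors. -/
def lat (b : ℕ → V) (n : ℕ) : Submodule ℤ V := span ℤ (b '' Set.Iio n)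

theorem mem_lat {i : ℕ} (h : i < n) : b i ∈ lat b n := subset_span ⟨i, h, rfl⟩

/-- Short lattice vectors lie in the span of the first basis vectors. -/
theorem mem_lat_of_norm_sq_le {T : ℝ} (hT : ∀ j, k ≤ j → j < n → T < ‖gs b j‖ ^ 2) {x : V}
    (hx : x ∈ lat b n) (hxT : ‖x‖ ^ 2 ≤ T) : x ∈ lat b k := by
  rcases lt_or_ge n k with h | h
  · exact span_mono (Set.image_mono fun i hi => lt_trans hi h) hx
  obtain ⟨j, rfl⟩ := Nat.exists_eq_add_of_le h
  clear h
  induction j with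
  | zero => exact hx
  | succ j ih =>
    refine ih (fun i h1 h2 => hT i h1 (by omega)) ?_
    have h1 : Set.Iio (k + (j + 1)) = insert (k + j) (Set.Iio (k + j)) := by
      ext i; simp; omega
    -- Peel off the last basis vector: if its integer coefficient `c` were nonzero, the component of
    -- the vector along the last Gram–Schmidt vector would have length at least that of `gs b (k +
    -- j)`, which exceeds the bound.
    rw [lat, h1, Set.image_insert_eq, mem_span_insert] at hx
    obtain ⟨c, y, hy, rfl⟩ := hx
    by_cases hc : c = 0
    · rw [hc, zero_smul, zero_add]
      exact hy
    exfalso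
    have hy' : y ∈ flag b (k + j) := span_le_restrictScalars ℤ ℝ _ hy
    have h2 : ⟪c • b (k + j) + y, gs b (k + j)⟫ = c * ‖gs b (k + j)‖ ^ 2 := by
      rw [inner_add_left, real_inner_comm _ y, show ⟪gs b (k + j), y⟫ = 0 from inner_pr_eq_zero hy',
        ← Int.cast_smul_eq_zsmul ℝ, real_inner_smul_left, real_inner_comm, gs, inner_pr_self, gs,
        add_zero]
    have h3 := abs_real_inner_le_norm (c • b (k + j) + y) (gs b (k + j))
    have h4 := hT (k + j) (by omega) (by omega)
    have hc1 : (1 : ℝ) ≤ |(c : ℝ)| := by exact_mod_cast Int.one_le_abs hc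
    rw [h2, abs_mul, abs_of_nonneg (by positivity : 0 ≤ ‖gs b (k + j)‖ ^ 2)] at h3
    have h5 : ‖c • b (k + j) + y‖ < ‖gs b (k + j)‖ :=
      lt_of_pow_lt_pow_left₀ 2 (norm_nonneg _) (hxT.trans_lt h4)
    have h6 : 0 < ‖gs b (k + j)‖ := (norm_nonneg _).trans_lt h5
    nlinarith [sq_nonneg ‖gs b (k + j)‖]

theorem lat_update_le {i j : ℕ} (hij : j < i) (hi : i < n) (c : ℤ) :
    lat (Function.update b i (b i + c • b j)) n ≤ lat b n := by
  refine span_le.2 ?_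
  rintro _ ⟨l, hl, rfl⟩
  by_cases h : l = i
  · subst h
    rw [Function.update_self]
    exact add_mem (mem_lat hi) (smul_mem _ _ (mem_lat (hij.trans hi)))
  · rw [Function.update_of_ne h]
    exact mem_lat hl

theorem lat_update {i j : ℕ} (hij : j < i) (hi : i < n) (c : ℤ) :
    lat (Function.update b i (b i + c • b j)) n = lat b n := by
  refine le_antisymm (lat_update_le hij hi c) ?_
  have h := lat_update_le (b := Function.update b i (b i + c • b j)) (n := n) hij hi (-c)
  simpa [Function.update_of_ne hij.ne, Function.update_eq_self] using h

theorem lat_swap (hp : p + 1 < n) : lat (b ∘ Equiv.swap p (p + 1)) n = lat b n := by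
  rw [lat, image_swap (by simp only [Set.mem_Iio]; omega), lat]

end LLL

/-! ### Fraction-free orthogonalization as a program -/

namespace RAM

open LLL

local infixl:65 " +ₑ " => Expr.bin Op.add
local infixl:65 " -ₑ " => Expr.bin Op.sub
local infixl:70 " *ₑ " => Expr.bin Op.mul
local infixl:70 " /ₑ " => Expr.bin Op.div

/-- The row `i` of an array, as a vector in `ℝⁿ`. -/
noncomputable def vec (n : ℕ) (f : ℤ → ℤ → ℤ) (i : ℕ) : EuclideanSpace ℝ (Fin n) :=
  WithLp.toLp 2 fun c => (f i (c : ℕ) : ℝ)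

theorem inner_vec (n : ℕ) (f : ℤ → ℤ → ℤ) (i j : ℕ) :
    inner ℝ (vec n f i) (vec n f j) = ((∑ c ∈ Finset.range n, f i c * f j c : ℤ) : ℝ) := by
  rw [Finset.sum_range]
  simp [vec, PiLp.inner_apply, mul_comm]

theorem norm_vec_sq (n : ℕ) (f : ℤ → ℤ → ℤ) (i : ℕ) :
    ‖vec n f i‖ ^ 2 = ((∑ c ∈ Finset.range n, f i c * f i c : ℤ) : ℝ) := by
  rw [← real_inner_self_eq_norm_sq, inner_vec]

theorem integral_vec (n : ℕ) (f : ℤ → ℤ → ℤ) : Integral (vec n f) n :=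
  fun i _ j _ => ⟨_, inner_vec n f i j⟩

theorem sum_sq_le_norm_sq {n t : ℕ} (ht : t ≤ n) (f : ℤ → ℤ → ℤ) (i : ℕ) :
    ((∑ c ∈ Finset.range t, f i c * f i c : ℤ) : ℝ) ≤ ‖vec n f i‖ ^ 2 := by
  rw [norm_vec_sq]
  exact_mod_cast Finset.sum_le_sum_of_subset_of_nonneg (by simpa using ht)
    fun c _ _ => mul_self_nonneg _

/-- Bounds all partial sums of an inner product, since these are what the accumulator of `dotProg`
holds; it follows from `2 |x y| ≤ x ^ 2 + y ^ 2`. -/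
theorem abs_sum_mul_le {n t : ℕ} (ht : t ≤ n) (f : ℤ → ℤ → ℤ) (i j : ℕ) {X : ℝ}
    (hi : ‖vec n f i‖ ^ 2 ≤ X) (hj : ‖vec n f j‖ ^ 2 ≤ X) :
    ((|∑ c ∈ Finset.range t, f i c * f j c| : ℤ) : ℝ) ≤ X := by
  have h1 := (sum_sq_le_norm_sq ht f i).trans hi
  have h2 := (sum_sq_le_norm_sq ht f j).trans hj
  have h3 : |∑ c ∈ Finset.range t, f i c * f j c| * 2 ≤
      ∑ c ∈ Finset.range t, f i c * f i c + ∑ c ∈ Finset.range t, f j c * f j c := by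
    rw [← Finset.sum_add_distrib]
    refine (mul_le_mul_of_nonneg_right (Finset.abs_sum_le_sum_abs _ _) (by norm_num)).trans ?_
    rw [Finset.sum_mul]
    refine Finset.sum_le_sum fun c _ => ?_
    rw [abs_mul]
    nlinarith [sq_nonneg (|f i c| - |f j c|), abs_mul_abs_self (f i c), abs_mul_abs_self (f j c)]
  have h4 : ((|∑ c ∈ Finset.range t, f i c * f j c| : ℤ) : ℝ) * 2 ≤
      ((∑ c ∈ Finset.range t, f i c * f i c : ℤ) : ℝ) +
        ((∑ c ∈ Finset.range t, f j c * f j c : ℤ) : ℝ) := by exact_mod_cast h3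
  linarith

theorem abs_entry_le {n c : ℕ} (hc : c < n) (f : ℤ → ℤ → ℤ) (i : ℕ) {X : ℝ} (hX : 0 ≤ X)
    (hi : ‖vec n f i‖ ≤ X) : ((|f i c| : ℤ) : ℝ) ≤ X := by
  have h1 : ((f i c * f i c : ℤ) : ℝ) ≤ ‖vec n f i‖ ^ 2 := by
    rw [norm_vec_sq]
    exact_mod_cast Finset.single_le_sum (f := fun c : ℕ => f i c * f i c)
      (fun c _ => mul_self_nonneg _) (Finset.mem_range.2 hc)
  push_cast at h1 ⊢
  refine abs_le_of_sq_le_sq ?_ hX |>.trans_eq rfl |> fun h => h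
  rw [sq]
  nlinarith [norm_nonneg (vec n f i)]

/-- The array that orthogonalization computes: for `j ≤ i < n`, the cell `(i, j)` holds
`gd b j * ⟪pr b j (b i), b j⟫`, and the cell `(-1, -1)` holds `1`. -/
def IsGso {V : Type*} [NormedAddCommGroup V] [InnerProductSpace ℝ V] [FiniteDimensional ℝ V]
    (b : ℕ → V) (n : ℕ) (f : ℤ → ℤ → ℤ) : Prop :=
  f (-1) (-1) = 1 ∧ ∀ i < n, ∀ j ≤ i, (f i j : ℝ) = gd b j * inner ℝ (pr b j (b i)) (b j)

/-- The entries up to the entry `j` of row `i` are correct. -/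
def IsGsoUpTo {V : Type*} [NormedAddCommGroup V] [InnerProductSpace ℝ V] [FiniteDimensional ℝ V]
    (b : ℕ → V) (i j : ℕ) (f : ℤ → ℤ → ℤ) : Prop :=
  f (-1) (-1) = 1 ∧ ∀ i' j', j' ≤ i' → i' < i ∨ i' = i ∧ j' < j →
    (f i' j' : ℝ) = gd b j' * inner ℝ (pr b j' (b i')) (b j')

theorem IsGsoUpTo.diag {V : Type*} [NormedAddCommGroup V] [InnerProductSpace ℝ V]
    [FiniteDimensional ℝ V] {b : ℕ → V} {i j k : ℕ} {f : ℤ → ℤ → ℤ} (h : IsGsoUpTo b i j f)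
    (hk : k ≤ i) : (f ((k : ℤ) - 1) ((k : ℤ) - 1) : ℝ) = gd b k := by
  cases k with
  | zero => simp [h.1, gd_zero]
  | succ k =>
    rw [show ((k + 1 : ℕ) : ℤ) - 1 = k by push_cast; ring, h.2 k k le_rfl (Or.inl (by omega)),
      inner_pr_self, gd_succ]

theorem IsGso.diag {V : Type*} [NormedAddCommGroup V] [InnerProductSpace ℝ V]
    [FiniteDimensional ℝ V] {b : ℕ → V} {n k : ℕ} {f : ℤ → ℤ → ℤ} (h : IsGso b n f)
    (hk : k < n) : (f k k : ℝ) = gd b (k + 1) := by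
  rw [h.2 k hk k le_rfl, inner_pr_self, gd_succ]

theorem IsGso.diag_pred {V : Type*} [NormedAddCommGroup V] [InnerProductSpace ℝ V]
    [FiniteDimensional ℝ V] {b : ℕ → V} {n k : ℕ} {f : ℤ → ℤ → ℤ} (h : IsGso b n f)
    (hk : k ≤ n) : (f ((k : ℤ) - 1) ((k : ℤ) - 1) : ℝ) = gd b k := by
  cases k with
  | zero => simp [h.1, gd_zero]
  | succ k => rw [show ((k + 1 : ℕ) : ℤ) - 1 = k by push_cast; ring, h.diag (by omega)]

/-- Hadamard's bound for the Gram determinant, with Cauchy–Schwarz for the inner product. It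
controls every number written during orthogonalization, including those inside the elimination loop.
-/
theorem abs_gd_mul_inner_le {V : Type*} [NormedAddCommGroup V] [InnerProductSpace ℝ V]
    [FiniteDimensional ℝ V] {b : ℕ → V} {n i j k : ℕ} {X : ℝ} (h1 : 1 ≤ X)
    (hX : ∀ i < n, ‖b i‖ ^ 2 ≤ X) (hk : k ≤ n) (hi : i < n) (hj : j < n) :
    |gd b k * inner ℝ (pr b k (b i)) (b j)| ≤ X ^ (n + 1) := by
  have h2 : gd b k ≤ X ^ k := gd_le (n := n) (fun i hi => by
    refine le_trans ?_ (hX i hi)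
    have := norm_gs_le (b := b) (k := i)
    gcongr) hk
  have h3 : |inner ℝ (pr b k (b i)) (b j)| ≤ X := by
    refine (abs_real_inner_le_norm _ _).trans ?_
    have := norm_pr_le (b := b) (k := k) (b i)
    nlinarith [hX i hi, hX j hj, norm_nonneg (b j), norm_nonneg (b i),
      sq_nonneg (‖b i‖ - ‖b j‖)]
  have h0 : 0 ≤ gd b k := Finset.prod_nonneg fun _ _ => by positivity
  rw [abs_mul, abs_of_nonneg h0]
  calc _ ≤ X ^ k * X := mul_le_mul h2 h3 (abs_nonneg _) (by positivity)
    _ = X ^ (k + 1) := (pow_succ _ _).symm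
    _ ≤ X ^ (n + 1) := pow_le_pow_right₀ h1 (by omega)

theorem abs_lt_of_cast {z : ℤ} {b : ℕ} {X : ℝ} (h : |(z : ℝ)| ≤ X) (hX : X < 2 ^ b) :
    |z| < 2 ^ b := by
  have : |(z : ℝ)| < 2 ^ b := h.trans_lt hX
  exact_mod_cast this

/-- The inner product of the rows `10` and `11` of array `2`, in register `13`. -/
def dotProg : Prog :=
  .seq (.assign 13 (.const 0)) (.forLoop 12 (.var 2)
    (.assign 13 (.var 13 +ₑ .cell 2 (.var 10) (.var 12) *ₑ .cell 2 (.var 11) (.var 12))))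

/-- Elimination, in register `13`. -/
def elimProg : Prog :=
  .forLoop 12 (.var 11)
    (.assign 13 ((.cell 3 (.var 12) (.var 12) *ₑ .var 13 -ₑ
      .cell 3 (.var 10) (.var 12) *ₑ .cell 3 (.var 11) (.var 12)) /ₑ
        .cell 3 (.var 12 -ₑ .const 1) (.var 12 -ₑ .const 1)))

/-- Orthogonalization of the rows of array `2`. -/
def gsoProg : Prog :=
  .seq (.store 3 (.const (-1)) (.const (-1)) (.const 1))
    (.forLoop 10 (.var 2) (.forLoop 11 (.var 10 +ₑ .const 1)
      (.seq dotProg (.seq elimProg (.store 3 (.var 10) (.var 11) (.var 13))))))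

/-- The registers below `k` and all arrays are the same in both memories. -/
def Frame (k : ℕ) (s s' : State) : Prop := (∀ y < k, s'.var y = s.var y) ∧ s'.arr = s.arr

variable {b l n : ℕ} {s : State}

theorem tr_dotProg {i j : ℕ} {X : ℝ} (hl : n ≤ l) (hb : (n : ℤ) < 2 ^ b) (hn : s.var 2 = n)
    (hi : s.var 10 = i) (hj : s.var 11 = j) (hX : X < 2 ^ b)
    (hiX : ‖vec n (s.arr 2) i‖ ^ 2 ≤ X) (hjX : ‖vec n (s.arr 2) j‖ ^ 2 ≤ X) :
    Tr b l dotProg s fun s' => Frame 12 s s' ∧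
      (s'.var 13 : ℝ) = inner ℝ (vec n (s.arr 2) i) (vec n (s.arr 2) j) := by
  refine Tr.seq (Tr.assign (by simp [Expr.eval]) ?_)
  refine Tr.forLoop n (fun t s' => Frame 12 s s' ∧ s'.var 12 = t ∧
    s'.var 13 = ∑ c ∈ Finset.range t, s.arr 2 i c * s.arr 2 j c) hl hb ?_ ?_ ?_ ?_
  · refine ⟨⟨fun y hy => ?_, rfl⟩, ?_⟩
    · simp [show y ≠ 12 by omega, show y ≠ 13 by omega]
    · simp [Expr.eval]
  · rintro t ht s' ⟨⟨h1, h2⟩, h3, h4⟩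
    exact ⟨h3, by simp [Expr.eval, h1, hn]⟩
  · rintro t ht s' ⟨⟨h1, h2⟩, h3, h4⟩
    have h5 : ∑ c ∈ Finset.range (t + 1), s.arr 2 i c * s.arr 2 j c =
      Expr.eval s' (.var 13 +ₑ .cell 2 (.var 10) (.var 12) *ₑ .cell 2 (.var 11) (.var 12)) := by
      simp [Expr.eval, Op.eval, h1, h2, h3, h4, hi, hj, Finset.sum_range_succ]
    refine Tr.assign ?_ ⟨by simp [h3], ⟨fun y hy => ?_, by simp [h2]⟩, by simp, ?_⟩
    · rw [← h5]
      refine abs_lt_of_cast ?_ hX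
      have := abs_sum_mul_le (t := t + 1) (by omega) (s.arr 2) i j hiX hjX
      simpa using this
    · simp [show y ≠ 12 by omega, show y ≠ 13 by omega, h1 y hy]
    · simp [← h5]
  · rintro s' ⟨h1, h3, h4⟩
    exact ⟨h1, by rw [h4, inner_vec]⟩

theorem tr_elimProg {i j : ℕ} {X : ℝ} {v : ℕ → EuclideanSpace ℝ (Fin n)} (hz : Integral v n)
    (hind : Indep v n) (hl : n ≤ l) (hb : (n : ℤ) < 2 ^ b)
    (hi : s.var 10 = i) (hj : s.var 11 = j) (hij : j ≤ i) (hin : i < n) (h1X : 1 ≤ X)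
    (hX : X ^ (n + 1) < 2 ^ b) (hvX : ∀ i < n, ‖v i‖ ^ 2 ≤ X) (hg : IsGsoUpTo v i j (s.arr 3))
    (hu : (s.var 13 : ℝ) = inner ℝ (v i) (v j)) :
    Tr b l elimProg s fun s' => Frame 12 s s' ∧
      (s'.var 13 : ℝ) = gd v j * inner ℝ (pr v j (v i)) (v j) := by
  refine Tr.forLoop j (fun t s' => Frame 12 s s' ∧ s'.var 12 = t ∧
    (s'.var 13 : ℝ) = gd v t * inner ℝ (pr v t (v i)) (v j)) (by omega) (by omega) ?_ ?_ ?_ ?_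
  · refine ⟨⟨fun y hy => ?_, rfl⟩, ?_⟩
    · simp [show y ≠ 12 by omega]
    · simp [hu, gd_zero, pr_zero]
  · rintro t ht s' ⟨⟨h1, h2⟩, h3, h4⟩
    exact ⟨h3, by simp [Expr.eval, h1, hj]⟩
  · rintro t ht s' ⟨⟨h1, h2⟩, h3, h4⟩
    obtain ⟨z, hz'⟩ := hz.exists_int hind (k := t + 1) (i := i) (j := j) (by omega) hin (by omega)
    have h5 : Expr.eval s' ((.cell 3 (.var 12) (.var 12) *ₑ .var 13 -ₑ
      .cell 3 (.var 10) (.var 12) *ₑ .cell 3 (.var 11) (.var 12)) /ₑ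
        .cell 3 (.var 12 -ₑ .const 1) (.var 12 -ₑ .const 1)) = z := by
      simp only [Expr.eval, Op.eval, h1 10 (by omega), h1 11 (by omega), h2, h3, hi, hj]
      have hd := hg.diag (k := t) (by omega)
      have hgt := hind.gd_pos (k := t) (by omega)
      have hne : s.arr 3 ((t : ℤ) - 1) ((t : ℤ) - 1) ≠ 0 := by
        intro h0
        rw [h0] at hd
        simp at hd
        linarith
      -- The division is exact: after multiplication by `gd v t`, the numerator is the rank-one
      -- update `inner_pr_succ` cleared of denominators, and Cramer's rule has already shown the
      -- quotient `z` to be an integer. For `t = 0` the divisor is the cell `(-1, -1)`, which holds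
      -- `1`.
      apply Int.ediv_eq_of_eq_mul_right hne
      have hs0 := hind t (by omega)
      have hs : ‖gs v t‖ ^ 2 ≠ 0 := by simpa using hs0
      have : (s.arr 3 t t * s'.var 13 - s.arr 3 i t * s.arr 3 j t : ℝ) =
          s.arr 3 ((t : ℤ) - 1) ((t : ℤ) - 1) * z := by
        rw [hd, ← hz', h4, hg.2 t t le_rfl (Or.inl (by omega)),
          hg.2 i t (by omega) (Or.inr ⟨rfl, ht⟩), hg.2 j t (by omega) (by omega), gd_succ,
          inner_pr_succ, inner_pr_self, ← inner_pr_pr (v i) (v t), ← inner_pr_pr (v j) (v t),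
          ← gs, inner_pr_gs, inner_pr_gs]
        field_simp
      exact_mod_cast this
    refine Tr.assign ?_ ⟨by simp [h3], ⟨fun y hy => ?_, by simp [h2]⟩, by simp, ?_⟩
    · rw [h5]
      refine abs_lt_of_cast ?_ hX
      rw [← hz']
      exact abs_gd_mul_inner_le h1X hvX (by omega) hin (by omega)
    · simp [show y ≠ 12 by omega, show y ≠ 13 by omega, h1 y hy]
    · rw [h5]
      simp [hz']
  · rintro s' ⟨h1, h3, h4⟩
    exact ⟨h1, h4⟩

/-- The registers below `10` and all arrays except array `3` are the same in both memories. -/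
def GsoFrame (s s' : State) : Prop :=
  (∀ y < 10, s'.var y = s.var y) ∧ ∀ a, a ≠ 3 → s'.arr a = s.arr a

theorem tr_gsoProg {X : ℝ} (hind : Indep (vec n (s.arr 2)) n) (hl : n ≤ l)
    (hb : (n : ℤ) < 2 ^ b) (hn : s.var 2 = n) (h1X : 1 ≤ X) (hX : X ^ (n + 1) < 2 ^ b)
    (hvX : ∀ i < n, ‖vec n (s.arr 2) i‖ ^ 2 ≤ X) :
    Tr b l gsoProg s fun s' => GsoFrame s s' ∧ IsGso (vec n (s.arr 2)) n (s'.arr 3) := by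
  have hb1 : (1 : ℝ) < 2 ^ b := (one_le_pow₀ h1X).trans_lt hX
  have hb1' : (1 : ℤ) < 2 ^ b := by exact_mod_cast hb1
  have hX1 : X < 2 ^ b := (le_self_pow₀ h1X (by omega)).trans_lt hX
  refine Tr.seq (Tr.store (by simpa [Expr.eval] using hb1') ?_)
  simp only [Expr.eval]
  refine Tr.forLoop n (fun i s' => GsoFrame s s' ∧ s'.var 10 = i ∧
    IsGsoUpTo (vec n (s.arr 2)) i 0 (s'.arr 3)) hl hb ?_ ?_ ?_ ?_
  · refine ⟨⟨fun y hy => ?_, fun a ha => ?_⟩, by simp, ?_, by simp⟩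
    · simp [show y ≠ 10 by omega]
    · simp [State.arr_setArr_of_ne _ ha]
    · simp [State.arr_setArr]
  · rintro i hi s' ⟨⟨h1, h2⟩, h3, h4⟩
    exact ⟨h3, by simp [Expr.eval, h1, hn]⟩
  · rintro i hi s' ⟨⟨h1, h2⟩, h3, h4⟩
    refine Tr.forLoop (i + 1) (fun j s' => GsoFrame s s' ∧ s'.var 10 = i ∧ s'.var 11 = j ∧
      IsGsoUpTo (vec n (s.arr 2)) i j (s'.arr 3)) (by omega) (by push_cast; omega) ?_ ?_ ?_ ?_
    · refine ⟨⟨fun y hy => ?_, fun a ha => ?_⟩, by simp [h3], by simp, by simpa using h4⟩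
      · simp [show y ≠ 11 by omega, h1 y hy]
      · simp [h2 a ha]
    · rintro j hj s' ⟨⟨h1, h2⟩, h3, h4, h5⟩
      exact ⟨h4, by simp [Expr.eval, Op.eval, h3]⟩
    · rintro j hj s1 ⟨⟨h1, h2⟩, h3, h4, h5⟩
      have harr : s1.arr 2 = s.arr 2 := h2 2 (by omega)
      refine Tr.seq ((tr_dotProg (i := i) (j := j) hl hb ((h1 2 (by omega)).trans hn) h3 h4 hX1
        (by rw [harr]; exact hvX i hi) (by rw [harr]; exact hvX j (by omega))).mono ?_)
      rintro s2 ⟨⟨k1, k2⟩, k3⟩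
      rw [harr] at k3
      refine Tr.seq ((tr_elimProg (integral_vec n _) hind hl hb ((k1 10 (by omega)).trans h3)
        ((k1 11 (by omega)).trans h4) (by omega) hi h1X hX hvX (by rwa [k2]) k3).mono ?_)
      rintro s3 ⟨⟨m1, m2⟩, m3⟩
      have e10 : s3.var 10 = i := by rw [m1 10 (by omega), k1 10 (by omega), h3]
      have e11 : s3.var 11 = j := by rw [m1 11 (by omega), k1 11 (by omega), h4]
      refine Tr.store ?_ ⟨by simp [e11], ⟨fun y hy => ?_, fun a ha => ?_⟩, by simp [e10], by simp, ?_⟩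
      · refine abs_lt_of_cast ?_ hX
        simp only [Expr.eval]
        rw [m3]
        exact abs_gd_mul_inner_le h1X hvX (by omega) hi (by omega)
      · simp [show y ≠ 11 by omega, m1 y (by omega), k1 y (by omega), h1 y hy]
      · simp [State.arr_setArr_of_ne _ ha, m2, k2, h2 a ha]
      · simp only [State.arr_setVar, Expr.eval, e10, e11]
        refine ⟨?_, fun i' j' hij h => ?_⟩
        · rw [State.arr_setArr, if_neg (by omega), m2, k2, h5.1]
        · rw [State.arr_setArr]
          split_ifs with hc
          · obtain ⟨-, hc1, hc2⟩ := hc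
            rw [m3, show i' = i by omega, show j' = j by omega]
          · rw [m2, k2]
            exact h5.2 i' j' hij (by omega)
    · rintro s' ⟨h1, h3, h4, h5⟩
      refine ⟨h3, ⟨fun y hy => ?_, h1.2⟩, by simp, h5.1, fun i' j' hij h => ?_⟩
      · simp [show y ≠ 10 by omega, h1.1 y hy]
      · exact h5.2 i' j' hij (by omega)
  · rintro s' ⟨h1, h3, h4⟩
    exact ⟨h1, h4.1, fun i hi j hj => h4.2 i j hj (Or.inl hi)⟩

end RAM

/-! ### Size reduction as a program -/

namespace RAM

open LLL

local infixl:65 " +ₑ " => Expr.bin Op.add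
local infixl:65 " -ₑ " => Expr.bin Op.sub
local infixl:70 " *ₑ " => Expr.bin Op.mul
local infixl:70 " /ₑ " => Expr.bin Op.div

/-- The quotient `(2 * a + D) / (2 * D)` is the integer nearest to `a / D`. -/
theorem abs_sub_round_le {a D : ℤ} (hD : 0 < D) :
    |2 * a - 2 * D * ((2 * a + D) / (2 * D))| ≤ D := by
  have h1 := Int.emod_add_mul_ediv (2 * a + D) (2 * D)
  have h2 := Int.emod_nonneg (2 * a + D) (show 2 * D ≠ 0 by omega)
  have h3 := Int.emod_lt_of_pos (2 * a + D) (show 0 < 2 * D by omega)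
  rw [abs_le]
  constructor <;> linarith

/-- The nearest integer is zero when `|a / D| < 1 / 2`; otherwise the rounding error `1 / 2` is at
most `|a / D|`. -/
theorem abs_round_mul_le {a D : ℤ} (hD : 0 < D) :
    |(2 * a + D) / (2 * D)| * D ≤ 2 * |a| := by
  have h1 := abs_le.1 (abs_sub_round_le (a := a) hD)
  set q := (2 * a + D) / (2 * D) with hq
  by_cases h : 2 * |a| < D
  · have h2 := abs_lt.1 (show |2 * a| < D by rwa [abs_mul, abs_two])
    have : q = 0 := Int.ediv_eq_zero_of_lt (by linarith) (by linarith)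
    simp [this]
  · have h2 : |q| * D = |q * D| := by rw [abs_mul, abs_of_pos hD]
    have h3 : |2 * (q * D)| ≤ |2 * a| + D := by
      rw [show 2 * (q * D) = 2 * a - (2 * a - 2 * D * q) by ring]
      exact (abs_sub _ _).trans (by linarith [abs_le.2 h1])
    rw [abs_mul 2 (q * D), abs_mul 2 a, abs_two] at h3
    rw [h2]
    linarith

/-- A bound for the squared norms of all vectors that occur during size reduction. -/
noncomputable def normBound (n : ℕ) (R : ℝ) : ℝ := (n * R * (3 * n * R ^ (n + 1)) ^ n) ^ 2

/-- The bounds `b` and `l` for bit lengths and loops are large enough. -/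
structure Room (b l n : ℕ) (R : ℝ) : Prop where
  one_le_n : 1 ≤ n
  one_le_R : 1 ≤ R
  le_l : n ≤ l
  lt_b : (n : ℤ) < 2 ^ b
  bound_lt : 3 * normBound n R ^ (n + 1) < 2 ^ b

variable {b l n : ℕ} {R : ℝ} {s : State}

theorem Room.one_le_factor (h : Room b l n R) : 1 ≤ 3 * n * R ^ (n + 1) := by
  have h1 : (1 : ℝ) ≤ n := by exact_mod_cast h.one_le_n
  have h2 : 1 ≤ R ^ (n + 1) := one_le_pow₀ h.one_le_R
  nlinarith

theorem Room.one_le_nR (h : Room b l n R) : 1 ≤ n * R := by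
  have h1 : (1 : ℝ) ≤ n := by exact_mod_cast h.one_le_n
  nlinarith [h.one_le_R]

theorem Room.nR_mul_le (h : Room b l n R) {k : ℕ} (hk : k ≤ n) :
    n * R * (3 * n * R ^ (n + 1)) ^ k ≤ n * R * (3 * n * R ^ (n + 1)) ^ n :=
  mul_le_mul_of_nonneg_left (pow_le_pow_right₀ h.one_le_factor hk) (by linarith [h.one_le_nR])

theorem Room.one_le_base (h : Room b l n R) : 1 ≤ n * R * (3 * n * R ^ (n + 1)) ^ n :=
  one_le_mul_of_one_le_of_one_le h.one_le_nR (one_le_pow₀ h.one_le_factor)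

theorem Room.one_le_normBound (h : Room b l n R) : 1 ≤ normBound n R :=
  one_le_pow₀ h.one_le_base

theorem Room.base_lt (h : Room b l n R) : n * R * (3 * n * R ^ (n + 1)) ^ n < 2 ^ b := by
  have h1 := h.one_le_normBound
  calc n * R * (3 * n * R ^ (n + 1)) ^ n ≤ normBound n R := le_self_pow₀ h.one_le_base (by norm_num)
    _ ≤ normBound n R ^ (n + 1) := le_self_pow₀ h1 (by omega)
    _ ≤ 3 * normBound n R ^ (n + 1) := by linarith [one_le_pow₀ h1 (n := n + 1)]
    _ < 2 ^ b := h.bound_lt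

theorem Room.nR_le (h : Room b l n R) : n * R ≤ normBound n R := by
  have h1 := h.nR_mul_le (Nat.zero_le n)
  rw [pow_zero, mul_one] at h1
  exact h1.trans (le_self_pow₀ h.one_le_base (by norm_num))

theorem Room.pow_lt (h : Room b l n R) : normBound n R ^ (n + 1) < 2 ^ b := by
  have := one_le_pow₀ h.one_le_normBound (n := n + 1)
  linarith [h.bound_lt]

/-- The row `6` of array `2` minus the multiple by register `9` of the row `8`. -/
def rowProg : Prog :=
  .forLoop 14 (.var 2) (.store 2 (.var 6) (.var 14)
    (.cell 2 (.var 6) (.var 14) -ₑ .var 9 *ₑ .cell 2 (.var 8) (.var 14)))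

/-- One step of size reduction. -/
def reduceProg : Prog :=
  .seq (.assign 8 (.var 6 -ₑ .const 1 -ₑ .var 7)) (.seq gsoProg (.seq
    (.assign 9 ((.const 2 *ₑ .cell 3 (.var 6) (.var 8) +ₑ .cell 3 (.var 8) (.var 8)) /ₑ
      (.const 2 *ₑ .cell 3 (.var 8) (.var 8)))) rowProg))

/-- Size reduction of all rows of array `2`. -/
def sizeRedProg : Prog := .forLoop 6 (.var 2) (.forLoop 7 (.var 6) reduceProg)

theorem tr_rowProg {i j : ℕ} {q : ℤ} (hl : n ≤ l) (hb : (n : ℤ) < 2 ^ b) (hn : s.var 2 = n)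
    (hi : s.var 6 = i) (hj : s.var 8 = j) (hij : j ≠ i) (hq : s.var 9 = q) {X : ℝ} (hX0 : 0 ≤ X)
    (hXb : X < 2 ^ b) (hX : ‖vec n (s.arr 2) i + (-q) • vec n (s.arr 2) j‖ ≤ X) :
    Tr b l rowProg s fun s' => (∀ y < 14, s'.var y = s.var y) ∧
      (∀ a, a ≠ 2 → s'.arr a = s.arr a) ∧ vec n (s'.arr 2) =
        Function.update (vec n (s.arr 2)) i (vec n (s.arr 2) i + (-q) • vec n (s.arr 2) j) := by
  have key (f : ℤ → ℤ → ℤ) (hf : ∀ (i' c : ℕ), f i' c = if i' = i ∧ c < n then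
      s.arr 2 i c - q * s.arr 2 j c else s.arr 2 i' c) : vec n f =
        Function.update (vec n (s.arr 2)) i (vec n (s.arr 2) i + (-q) • vec n (s.arr 2) j) := by
    funext i'
    ext c
    by_cases h : i' = i
    · subst h
      rw [Function.update_self]
      simp only [vec, hf, c.2, and_self, if_true, PiLp.add_apply, PiLp.smul_apply]
      push_cast
      simp
      ring
    · rw [Function.update_of_ne h]
      simp [vec, hf, h]
  refine Tr.forLoop n (fun t s' => (∀ y < 14, s'.var y = s.var y) ∧
      (∀ a, a ≠ 2 → s'.arr a = s.arr a) ∧ s'.var 14 = t ∧ ∀ (i' c : ℕ), s'.arr 2 i' c =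
        if i' = i ∧ c < t then s.arr 2 i c - q * s.arr 2 j c else s.arr 2 i' c) hl hb ?_ ?_ ?_ ?_
  · refine ⟨fun y hy => ?_, fun a ha => rfl, by simp, by simp⟩
    simp [show y ≠ 14 by omega]
  · rintro t ht s' ⟨h1, h2, h3, h4⟩
    exact ⟨h3, by simp [Expr.eval, h1, hn]⟩
  · rintro t ht s' ⟨h1, h2, h3, h4⟩
    have h5 : Expr.eval s' (.cell 2 (.var 6) (.var 14) -ₑ .var 9 *ₑ .cell 2 (.var 8) (.var 14)) =
        s.arr 2 i t - q * s.arr 2 j t := by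
      simp [Expr.eval, Op.eval, h1, h3, h4, hi, hj, hq, hij]
    refine Tr.store ?_ ⟨by simp [h3], fun y hy => ?_, fun a ha => ?_, by simp, fun i' c => ?_⟩
    · rw [h5]
      refine abs_lt_of_cast ?_ hXb
      have h7 : ‖vec n (fun _ c => s.arr 2 i c - q * s.arr 2 j c) 0‖ ≤ X := by
        refine le_of_eq_of_le ?_ hX
        congr 1
        ext c
        simp [vec]
        ring
      simpa using abs_entry_le ht (fun _ c => s.arr 2 i c - q * s.arr 2 j c) 0 hX0 h7
    · simp [show y ≠ 14 by omega, h1 y hy]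
    · simp [State.arr_setArr_of_ne _ ha, h2 a ha]
    · simp only [h5]
      simp only [State.arr_setVar, State.arr_setArr, Expr.eval, h1 6 (by omega), h3, hi, h4]
      by_cases h6 : i' = i
      · subst h6
        by_cases h7 : c = t
        · subst h7; simp
        · by_cases h8 : c < t
          · simp [h7, h8, show c < t + 1 by omega]
          · simp [h7, h8, show ¬ c < t + 1 by omega]
      · simp [h6]
  · rintro s' ⟨h1, h2, h3, h4⟩
    exact ⟨h1, h2, key _ h4⟩

/-- The registers below `k` and all arrays except arrays `2` and `3` are the same. -/
def LLLFrame (k : ℕ) (s s' : State) : Prop :=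
  (∀ y < k, s'.var y = s.var y) ∧ ∀ a, a ≠ 2 → a ≠ 3 → s'.arr a = s.arr a

/-- A bound for the growth in one step of size reduction. -/
theorem norm_reduce_le {v : ℕ → EuclideanSpace ℝ (Fin n)} (hz : Integral v n) (hr : Room b l n R)
    (hind : Indep v n) (hR : ∀ i < n, ‖gs v i‖ ^ 2 ≤ R) {i j : ℕ} (hj : j < n)
    (hvj : ‖v j‖ ^ 2 ≤ n * R) {q : ℤ} (hq : |(q : ℝ)| * ‖gs v j‖ ^ 2 ≤ 2 * |inner ℝ (v i) (gs v j)|) :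
    ‖v i + (-q) • v j‖ ≤ ‖v i‖ * (3 * n * R ^ (n + 1)) := by
  have hpos : 0 < ‖gs v j‖ := norm_pos_iff.2 (hind j hj)
  have h1 : |(q : ℝ)| * ‖gs v j‖ ≤ 2 * ‖v i‖ := by
    have := abs_real_inner_le_norm (v i) (gs v j)
    refine le_of_mul_le_mul_right ?_ hpos
    nlinarith
  -- Integrality prevents `gs v j` from being tiny: `gd v (j + 1) ≥ 1` while `gd v j ≤ R ^ n`.
  -- Without this lower bound the rounded coefficient `q` could be uncontrolled.
  have h2 : 1 ≤ R ^ n * ‖gs v j‖ ^ 2 := by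
    have h3 := hz.one_le_gd hind (k := j + 1) (by omega)
    rw [gd_succ] at h3
    have h4 : gd v j ≤ R ^ n := (gd_le hR hj.le).trans (pow_le_pow_right₀ hr.one_le_R hj.le)
    exact h3.trans (mul_le_mul_of_nonneg_right h4 (by positivity))
  have hn : (1 : ℝ) ≤ n := by exact_mod_cast hr.one_le_n
  have hR1 := hr.one_le_R
  have hF : 1 ≤ n * R ^ (n + 1) := one_le_mul_of_one_le_of_one_le hn (one_le_pow₀ hR1)
  have h5 : ‖v j‖ ≤ n * R ^ (n + 1) * ‖gs v j‖ := by
    refine le_of_sq_le_sq ?_ (by positivity)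
    calc ‖v j‖ ^ 2 ≤ n * R := hvj
      _ ≤ n * R * (R ^ n * ‖gs v j‖ ^ 2) := le_mul_of_one_le_right (by positivity) h2
      _ = (n * R ^ (n + 1)) * ‖gs v j‖ ^ 2 := by ring
      _ ≤ (n * R ^ (n + 1)) ^ 2 * ‖gs v j‖ ^ 2 :=
        mul_le_mul_of_nonneg_right (le_self_pow₀ hF (by norm_num)) (by positivity)
      _ = _ := by ring
  have h6 : ‖(-q) • v j‖ ≤ 2 * ‖v i‖ * (n * R ^ (n + 1)) := by
    rw [← Int.cast_smul_eq_zsmul ℝ, norm_smul, Real.norm_eq_abs]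
    push_cast
    rw [abs_neg]
    calc |(q : ℝ)| * ‖v j‖ ≤ |(q : ℝ)| * (n * R ^ (n + 1) * ‖gs v j‖) := by gcongr
      _ = |(q : ℝ)| * ‖gs v j‖ * (n * R ^ (n + 1)) := by ring
      _ ≤ _ := by gcongr
  calc ‖v i + (-q) • v j‖ ≤ ‖v i‖ + ‖(-q) • v j‖ := norm_add_le _ _
    _ ≤ ‖v i‖ * (n * R ^ (n + 1)) + 2 * ‖v i‖ * (n * R ^ (n + 1)) :=
      add_le_add (le_mul_of_one_le_right (norm_nonneg _) hF) h6
    _ = _ := by ring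

/-- Since `v j` is orthogonal to `gs v l` for `l > j`, subtracting multiples of it keeps the
coefficients already treated. Hence `j` runs downwards from `i - 1`. -/
theorem SizeRed.reduce {v : ℕ → EuclideanSpace ℝ (Fin n)} {i j : ℕ} (hij : j < i)
    (h : SizeRed v i (j + 1)) {q : ℤ}
    (hq : |inner ℝ (v i) (gs v j) - q * ‖gs v j‖ ^ 2| ≤ 1 / 2 * ‖gs v j‖ ^ 2) :
    SizeRed (Function.update v i (v i + (-q) • v j)) i j := by
  intro l hl hli
  rw [← Int.cast_smul_eq_zsmul ℝ, gs_update hij, Function.update_self, inner_add_left,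
    real_inner_smul_left]
  rcases hl.eq_or_lt with rfl | hl
  · rw [show inner ℝ (v j) (gs v j) = ‖gs v j‖ ^ 2 by rw [← inner_pr_gs, ← gs,
      real_inner_self_eq_norm_sq]]
    push_cast
    rwa [neg_mul, ← sub_eq_add_neg]
  · rw [real_inner_comm _ (v j), show inner ℝ (gs v l) (v j) = 0 from
      inner_pr_eq_zero (mem_flag hl), mul_zero, add_zero]
    exact h l hl hli

theorem SizeRed.update_of_ne {v : ℕ → EuclideanSpace ℝ (Fin n)} {i i' j k : ℕ} (hij : j < i)
    (hi : i' ≠ i) (c : ℝ) (h : SizeRed v i' k) :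
    SizeRed (Function.update v i (v i + c • v j)) i' k := by
  intro l hl hli
  rw [gs_update hij, Function.update_of_ne hi]
  exact h l hl hli

/-- In each of fewer than `n` steps the norm of row `i` may grow by the factor `3 * n * R ^ (n +
1)`, starting from at most `n * R`; this explains the form of `normBound`. The stored entries `(i,
j)` and `(j, j)` have the Gram–Schmidt coefficient as their quotient, so `q` is that coefficient
rounded. -/
theorem tr_reduceProg {i r : ℕ} (hr : Room b l n R) (hn : s.var 2 = n) (hi : s.var 6 = i)
    (h7 : s.var 7 = r) (hri : r < i) (hin : i < n) (hind : Indep (vec n (s.arr 2)) n)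
    (hR : ∀ i < n, ‖gs (vec n (s.arr 2)) i‖ ^ 2 ≤ R)
    (hv : ∀ i' < n, i' ≠ i → ‖vec n (s.arr 2) i'‖ ^ 2 ≤ n * R)
    (hvi : ‖vec n (s.arr 2) i‖ ≤ n * R * (3 * n * R ^ (n + 1)) ^ r)
    (hsr : SizeRed (vec n (s.arr 2)) i (i - r)) :
    Tr b l reduceProg s fun s' => LLLFrame 8 s s' ∧
      ∃ q : ℤ, vec n (s'.arr 2) = Function.update (vec n (s.arr 2)) i
        (vec n (s.arr 2) i + (-q) • vec n (s.arr 2) (i - 1 - r)) ∧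
      ‖vec n (s'.arr 2) i‖ ≤ n * R * (3 * n * R ^ (n + 1)) ^ (r + 1) ∧
      SizeRed (vec n (s'.arr 2)) i (i - (r + 1)) := by
  obtain ⟨j, hj⟩ : ∃ j, j = i - 1 - r := ⟨_, rfl⟩
  rw [← hj, show i - (r + 1) = j by omega]
  rw [show i - r = j + 1 by omega] at hsr
  have h8 : Expr.eval s (.var 6 -ₑ .const 1 -ₑ .var 7) = j := by
    simp only [Expr.eval, Op.eval, hi, h7]
    omega
  have hlt := hr.lt_b
  refine Tr.seq (Tr.assign ?_ ?_)
  · rw [h8, abs_of_nonneg (by omega)]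
    omega
  rw [h8]
  set v := vec n (s.arr 2) with hvdef
  have hX : ∀ i < n, ‖v i‖ ^ 2 ≤ normBound n R := by
    intro i' hi'
    by_cases h : i' = i
    · subst h
      have := hvi.trans (hr.nR_mul_le (by omega))
      rw [normBound]
      gcongr
    · exact (hv i' hi' h).trans hr.nR_le
  refine Tr.seq ((tr_gsoProg (X := normBound n R) (n := n) (by simpa using hind) hr.le_l hr.lt_b
    (by simpa using hn) hr.one_le_normBound hr.pow_lt (by simpa using hX)).mono ?_)
  rintro s1 ⟨⟨h1, h2⟩, h3⟩
  simp only [State.arr_setVar, ← hvdef, State.var_setVar] at h1 h2 h3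
  have e6 : s1.var 6 = i := by rw [h1 6 (by omega), ← hi]; simp
  have e8 : s1.var 8 = j := by rw [h1 8 (by omega)]; simp
  have hq : Expr.eval s1 ((.const 2 *ₑ .cell 3 (.var 6) (.var 8) +ₑ .cell 3 (.var 8) (.var 8)) /ₑ
      (.const 2 *ₑ .cell 3 (.var 8) (.var 8))) =
        (2 * s1.arr 3 i j + s1.arr 3 j j) / (2 * s1.arr 3 j j) := by
    simp [Expr.eval, Op.eval, e6, e8]
  have hjn : j < n := by omega
  have hji : j < i := by omega
  have ha := h3.2 i hin j (by omega)
  have hD := h3.diag hjn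
  rw [inner_pr_left, ← gs] at ha
  have hDpos : 0 < s1.arr 3 j j := by
    have := hind.gd_pos (k := j + 1) (by omega)
    rw [← hD] at this
    exact_mod_cast this
  have hgj := hind.gd_pos (k := j) (by omega)
  rw [gd_succ] at hD
  obtain ⟨q, hqq⟩ : ∃ q, q = (2 * s1.arr 3 i j + s1.arr 3 j j) / (2 * s1.arr 3 j j) := ⟨_, rfl⟩
  have hq1 : |(2 * s1.arr 3 i j - 2 * s1.arr 3 j j * q : ℝ)| ≤ s1.arr 3 j j := by
    rw [hqq]; exact_mod_cast abs_sub_round_le (a := s1.arr 3 i j) hDpos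
  have hq2 : |(q : ℝ)| * s1.arr 3 j j ≤ 2 * |(s1.arr 3 i j : ℝ)| := by
    rw [hqq]; exact_mod_cast abs_round_mul_le (a := s1.arr 3 i j) hDpos
  rw [ha, hD] at hq1 hq2
  have hq1' : |inner ℝ (v i) (gs v j) - q * ‖gs v j‖ ^ 2| ≤ 1 / 2 * ‖gs v j‖ ^ 2 := by
    rw [show 2 * (gd v j * inner ℝ (v i) (gs v j)) - 2 * (gd v j * ‖gs v j‖ ^ 2) * q =
      2 * gd v j * (inner ℝ (v i) (gs v j) - q * ‖gs v j‖ ^ 2) by ring, abs_mul,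
      abs_of_pos (by positivity)] at hq1
    refine le_of_mul_le_mul_left ?_ (show 0 < 2 * gd v j by positivity)
    linarith
  have hq2' : |(q : ℝ)| * ‖gs v j‖ ^ 2 ≤ 2 * |inner ℝ (v i) (gs v j)| := by
    rw [abs_mul, abs_of_pos hgj] at hq2
    refine le_of_mul_le_mul_left ?_ hgj
    linarith
  have hnorm := norm_reduce_le (integral_vec n (s.arr 2)) hr hind hR (i := i) hjn
    (hv j hjn (by omega)) hq2'
  have hnorm' : ‖v i + (-q) • v j‖ ≤ n * R * (3 * n * R ^ (n + 1)) ^ (r + 1) := by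
    exact hnorm.trans ((mul_le_mul_of_nonneg_right hvi (zero_le_one.trans hr.one_le_factor)).trans_eq
      (by ring))
  refine Tr.seq (Tr.assign ?_ ?_)
  · rw [hq]
    have h4 : |2 * s1.arr 3 i j + s1.arr 3 j j| < 2 ^ b := by
      have hi' := abs_gd_mul_inner_le (b := v) (k := j) hr.one_le_normBound hX hjn.le hin hjn
      have hj' := abs_gd_mul_inner_le (b := v) (k := j) hr.one_le_normBound hX hjn.le hjn hjn
      rw [← h3.2 i hin j (by omega)] at hi'
      rw [← h3.2 j hjn j le_rfl] at hj'
      -- The numerator `2 a + D` of the rounded quotient accounts for the factor 3 in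
      -- `Room.bound_lt`.
      refine abs_lt_of_cast ?_ hr.bound_lt
      push_cast
      refine (abs_add_le _ _).trans ?_
      rw [abs_mul, abs_two]
      linarith
    rw [← bitLen_le] at h4 ⊢
    exact (bitLen_div_le _ _).trans h4
  rw [hq, ← hqq]
  have harr : s1.arr 2 = s.arr 2 := h2 2 (by omega)
  refine (tr_rowProg (i := i) (j := j) (q := q) hr.le_l hr.lt_b ?_ (by simp [e6]) (by simp [e8])
    (by omega) (by simp) (X := n * R * (3 * n * R ^ (n + 1)) ^ n) (by linarith [hr.one_le_base])
    hr.base_lt ?_).mono ?_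
  · simp [h1, hn]
  · simp only [State.arr_setVar, harr]
    exact hnorm'.trans (hr.nR_mul_le (by omega))
  · rintro s2 ⟨k1, k2, k3⟩
    simp only [State.arr_setVar, harr, State.var_setVar, ← hvdef] at k1 k2 k3
    refine ⟨⟨fun y hy => ?_, fun a ha2 ha3 => ?_⟩, q, k3, ?_, ?_⟩
    · rw [k1 y (by omega), if_neg (by omega), h1 y (by omega), if_neg (by omega)]
    · rw [k2 a ha2, h2 a ha3]
    · rw [k3, Function.update_self]
      exact hnorm'
    · rw [k3]
      exact SizeRed.reduce hji hsr hq1'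

/-- The rows of array `2` have the same Gram–Schmidt vectors and generate the same lattice. -/
def SameGs (n : ℕ) (s s' : State) : Prop :=
  lat (vec n (s'.arr 2)) n = lat (vec n (s.arr 2)) n ∧
    ∀ i, gs (vec n (s'.arr 2)) i = gs (vec n (s.arr 2)) i

/-- The growth of a row during its reduction is temporary. Its Gram–Schmidt vectors do not change,
so once the row is fully reduced `SizeRed.norm_sq_le` restores the bound `n * R`. -/
theorem tr_sizeRedProg (hr : Room b l n R) (hn : s.var 2 = n) (hind : Indep (vec n (s.arr 2)) n)
    (hR : ∀ i < n, ‖gs (vec n (s.arr 2)) i‖ ^ 2 ≤ R)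
    (hv : ∀ i < n, ‖vec n (s.arr 2) i‖ ^ 2 ≤ n * R) :
    Tr b l sizeRedProg s fun s' => LLLFrame 6 s s' ∧ SameGs n s s' ∧
      ∀ i < n, SizeRed (vec n (s'.arr 2)) i 0 ∧ ‖vec n (s'.arr 2) i‖ ^ 2 ≤ n * R := by
  refine Tr.forLoop n (fun i s' => LLLFrame 6 s s' ∧ s'.var 6 = i ∧ SameGs n s s' ∧
    (∀ i' < n, ‖vec n (s'.arr 2) i'‖ ^ 2 ≤ n * R) ∧ ∀ i' < i, SizeRed (vec n (s'.arr 2)) i' 0)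
    hr.le_l hr.lt_b ?_ ?_ ?_ ?_
  · refine ⟨⟨fun y hy => ?_, fun a _ _ => rfl⟩, by simp, ⟨rfl, fun i => rfl⟩, hv, by simp⟩
    simp [show y ≠ 6 by omega]
  · rintro i hi s' ⟨⟨h1, h2⟩, h3, -⟩
    exact ⟨h3, by simp [Expr.eval, h1, hn]⟩
  · rintro i hi s1 ⟨⟨h1, h2⟩, h3, h4, h5, h6⟩
    refine Tr.forLoop i (fun r s' => LLLFrame 6 s s' ∧ s'.var 6 = i ∧ s'.var 7 = r ∧
      SameGs n s s' ∧ (∀ i' < n, i' ≠ i → ‖vec n (s'.arr 2) i'‖ ^ 2 ≤ n * R) ∧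
      ‖vec n (s'.arr 2) i‖ ≤ n * R * (3 * n * R ^ (n + 1)) ^ r ∧
      SizeRed (vec n (s'.arr 2)) i (i - r) ∧ ∀ i' < i, SizeRed (vec n (s'.arr 2)) i' 0)
      (hi.le.trans hr.le_l) (by have := hr.lt_b; omega) ?_ ?_ ?_ ?_
    · refine ⟨⟨fun y hy => ?_, h2⟩, by simp [h3], by simp, h4, fun i' hi' _ => h5 i' hi', ?_, ?_, h6⟩
      · simp [show y ≠ 7 by omega, h1 y hy]
      · simp only [State.arr_setVar, pow_zero, mul_one]
        refine le_of_sq_le_sq ((h5 i hi).trans ?_) (by linarith [hr.one_le_nR])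
        exact le_self_pow₀ hr.one_le_nR (by norm_num)
      · intro k hk1 hk2
        omega
    · rintro r hr' s' ⟨-, h3, h4, -⟩
      exact ⟨h4, by simp [Expr.eval, h3]⟩
    · rintro r hri s2 ⟨⟨k1, k2⟩, k3, k4, k5, k6, k7, k8, k9⟩
      refine (tr_reduceProg (i := i) (r := r) hr ((k1 2 (by omega)).trans hn) k3 k4 hri hi
        (fun i hi => by rw [k5.2 i]; exact hind i hi) (fun i hi => by rw [k5.2 i]; exact hR i hi)
        k6 k7 k8).mono ?_
      rintro s3 ⟨⟨m1, m2⟩, q, m3, m4, m5⟩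
      have hji : i - 1 - r < i := by omega
      refine ⟨by rw [m1 7 (by omega), k4], ⟨fun y hy => ?_, fun a ha ha' => ?_⟩,
        by simp [m1, k3], by simp, ⟨?_, fun i' => ?_⟩, fun i' hi' hne => ?_, m4, m5,
        fun i' hi' => ?_⟩
      · simp [show y ≠ 7 by omega, m1 y (by omega), k1 y hy]
      · simp [m2 a ha ha', k2 a ha ha']
      · simp only [State.arr_setVar]
        rw [m3, lat_update hji hi, k5.1]
      · simp only [State.arr_setVar]
        rw [m3, ← Int.cast_smul_eq_zsmul ℝ, gs_update hji, k5.2]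
      · simp only [State.arr_setVar]
        rw [m3, Function.update_of_ne hne]
        exact k6 i' hi' hne
      · simp only [State.arr_setVar]
        rw [m3, ← Int.cast_smul_eq_zsmul ℝ]
        exact SizeRed.update_of_ne hji (by omega) _ (k9 i' hi')
    · rintro s2 ⟨⟨k1, k2⟩, k3, k4, k5, k6, k7, k8, k9⟩
      rw [Nat.sub_self] at k8
      refine ⟨k3, ⟨fun y hy => ?_, k2⟩, by simp, k5, fun i' hi' => ?_, fun i' hi' => ?_⟩
      · simp [show y ≠ 6 by omega, k1 y hy]
      · by_cases h : i' = i
        · subst h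
          refine (k8.norm_sq_le (R := R) fun k hk => ?_).trans ?_
          · rw [k5.2]
            exact hR k (by omega)
          · have : ((i' : ℝ) + 1) ≤ n := by exact_mod_cast hi
            exact mul_le_mul_of_nonneg_right this (by linarith [hr.one_le_R])
        · exact k6 i' hi' h
      · rcases Nat.lt_succ_iff_lt_or_eq.1 hi' with h | rfl
        · exact k9 i' h
        · exact k8
  · rintro s' ⟨h1, h3, h4, h5, h6⟩
    exact ⟨h1, h4, fun i hi => ⟨h6 i hi, h5 i hi⟩⟩

end RAM

/-! ### Lattice reduction as a program -/

namespace RAM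

open LLL

local infixl:65 " +ₑ " => Expr.bin Op.add
local infixl:65 " -ₑ " => Expr.bin Op.sub
local infixl:70 " *ₑ " => Expr.bin Op.mul
local infixl:70 " /ₑ " => Expr.bin Op.div

/-- Register `8` is set to an index at which the Siegel condition fails, or to `-1`. -/
def findProg : Prog :=
  .seq (.assign 8 (.const (-1))) (.forLoop 14 (.var 2 -ₑ .const 1)
    (.branch (.bin .lt (.const 2 *ₑ .cell 3 (.var 14 -ₑ .const 1) (.var 14 -ₑ .const 1) *ₑ
      .cell 3 (.var 14 +ₑ .const 1) (.var 14 +ₑ .const 1))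
        (.cell 3 (.var 14) (.var 14) *ₑ .cell 3 (.var 14) (.var 14)))
      (.assign 8 (.var 14)) .skip))

/-- The row `8` of array `2` and the following row are swapped. -/
def swapProg : Prog :=
  .forLoop 14 (.var 2) (.seq (.assign 15 (.cell 2 (.var 8) (.var 14))) (.seq
    (.store 2 (.var 8) (.var 14) (.cell 2 (.var 8 +ₑ .const 1) (.var 14)))
    (.store 2 (.var 8 +ₑ .const 1) (.var 14) (.var 15))))

/-- One round of lattice reduction. -/
def roundProg : Prog :=
  .seq sizeRedProg (.seq gsoProg (.seq findProg
    (.branch (.bin .lt (.var 8) (.const 0)) .skip swapProg)))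

variable {b l n : ℕ} {R : ℝ} {s : State}

theorem tr_findProg {v : ℕ → EuclideanSpace ℝ (Fin n)} (hr : Room b l n R) (hn : s.var 2 = n)
    (hind : Indep v n) (hg : IsGso v n (s.arr 3)) :
    Tr b l findProg s fun s' => (∀ y < 8, s'.var y = s.var y) ∧ s'.arr = s.arr ∧
      (s'.var 8 = -1 ∧ Siegel v n ∨ ∃ p : ℕ, s'.var 8 = p ∧ p + 1 < n ∧
        2 * ‖gs v (p + 1)‖ ^ 2 < ‖gs v p‖ ^ 2) := by
  have h1n := hr.one_le_n
  have hlt := hr.lt_b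
  refine Tr.seq (Tr.assign ?_ ?_)
  · simp only [Expr.eval]
    rw [abs_neg, abs_one]
    omega
  simp only [Expr.eval]
  refine Tr.forLoop (n - 1) (fun t s' => (∀ y < 8, s'.var y = s.var y) ∧ s'.arr = s.arr ∧
      s'.var 14 = t ∧ (s'.var 8 = -1 ∧ (∀ i < t, ‖gs v i‖ ^ 2 ≤ 2 * ‖gs v (i + 1)‖ ^ 2) ∨
        ∃ p : ℕ, s'.var 8 = p ∧ p + 1 < n ∧ 2 * ‖gs v (p + 1)‖ ^ 2 < ‖gs v p‖ ^ 2))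
      (by have := hr.le_l; omega) (by omega) ?_ ?_ ?_ ?_
  · refine ⟨fun y hy => ?_, rfl, by simp, Or.inl ⟨by simp, by simp⟩⟩
    simp [show y ≠ 14 by omega, show y ≠ 8 by omega]
  · rintro t ht s' ⟨h1, h2, h3, -⟩
    refine ⟨h3, ?_⟩
    simp only [Expr.eval, Op.eval, h1 2 (by omega), hn]
    omega
  · rintro t ht s' ⟨h1, h2, h3, h4⟩
    have htn : t + 1 < n := by clear h4; omega
    have htb : (t : ℤ) < 2 ^ b := by clear h4; omega
    -- Each `‖gs v t‖ ^ 2` is a quotient of consecutive Gram determinants, so clearing denominators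
    -- turns the Siegel condition into an inequality between integers.
    have hcond : s.arr 3 t t * s.arr 3 t t ≤ 2 * s.arr 3 ((t : ℤ) - 1) ((t : ℤ) - 1) *
        s.arr 3 ((t : ℤ) + 1) ((t : ℤ) + 1) ↔ ‖gs v t‖ ^ 2 ≤ 2 * ‖gs v (t + 1)‖ ^ 2 := by
      have e1 := hg.diag (k := t) (by omega)
      have e2 := hg.diag (k := t + 1) (by omega)
      have e3 := hg.diag_pred (k := t) (by omega)
      have p1 := hind.gd_pos (k := t) (by omega)
      have p2 := hind.gd_pos (k := t + 1) (by omega)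
      push_cast at e2
      rw [← Int.cast_le (R := ℝ)]
      push_cast
      rw [e1, e2, e3, gd_succ (k := t + 1)]
      rw [show 2 * gd v t * (gd v (t + 1) * ‖gs v (t + 1)‖ ^ 2) =
        (gd v t * gd v (t + 1)) * (2 * ‖gs v (t + 1)‖ ^ 2) by ring]
      nth_rewrite 1 [gd_succ]
      rw [show gd v t * ‖gs v t‖ ^ 2 * gd v (t + 1) = (gd v t * gd v (t + 1)) * ‖gs v t‖ ^ 2 by ring]
      exact mul_le_mul_iff_right₀ (by positivity)
    refine Tr.branch (fun he => Tr.assign ?_ ?_) (fun he => Tr.skip ?_)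
    · simp only [Expr.eval, h3]
      rwa [abs_of_nonneg (by positivity)]
    · simp only [Expr.eval, Op.eval, h2, h3, ne_eq, ite_eq_right_iff, one_ne_zero, imp_false,
        not_not] at he
      rw [← not_le, hcond, not_le] at he
      refine ⟨by simp [h3], fun y hy => ?_, by simp [h2], by simp, Or.inr ⟨t, ?_, htn, he⟩⟩
      · simp [show y ≠ 14 by omega, show y ≠ 8 by omega, h1 y hy]
      · simp [Expr.eval, h3]
    · simp only [Expr.eval, Op.eval, h2, h3, ite_eq_right_iff, one_ne_zero, imp_false,
        not_lt] at he
      rw [hcond] at he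
      refine ⟨h3, fun y hy => ?_, by simp [h2], by simp, ?_⟩
      · simp [show y ≠ 14 by omega, h1 y hy]
      · rcases h4 with ⟨h4, h5⟩ | ⟨p, h4⟩
        · refine Or.inl ⟨by simpa using h4, fun i hi => ?_⟩
          rcases Nat.lt_succ_iff_lt_or_eq.1 hi with h | rfl
          · exact h5 i h
          · exact he
        · exact Or.inr ⟨p, by simpa using h4⟩
  · rintro s' ⟨h1, h2, h3, h4⟩
    refine ⟨h1, h2, h4.imp (fun h => ⟨h.1, fun i hi => h.2 i (by omega)⟩) id⟩

theorem tr_swapProg {p : ℕ} (hr : Room b l n R) (hn : s.var 2 = n) (hp : s.var 8 = p) :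
    Tr b l swapProg s fun s' => (∀ y < 14, s'.var y = s.var y) ∧
      (∀ a, a ≠ 2 → s'.arr a = s.arr a) ∧
      vec n (s'.arr 2) = vec n (s.arr 2) ∘ Equiv.swap p (p + 1) := by
  refine Tr.forLoop n (fun t s' => (∀ y < 14, s'.var y = s.var y) ∧
      (∀ a, a ≠ 2 → s'.arr a = s.arr a) ∧ s'.var 14 = t ∧ ∀ (i c : ℕ), s'.arr 2 i c =
        if c < t then s.arr 2 (Equiv.swap p (p + 1) i : ℕ) c else s.arr 2 i c)
      hr.le_l hr.lt_b ?_ ?_ ?_ ?_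
  · refine ⟨fun y hy => ?_, fun a ha => rfl, by simp, by simp⟩
    simp [show y ≠ 14 by omega]
  · rintro t ht s' ⟨h1, h2, h3, -⟩
    exact ⟨h3, by simp [Expr.eval, h1, hn]⟩
  · rintro t ht s' ⟨h1, h2, h3, h4⟩
    have e8 : s'.var 8 = p := by rw [h1 8 (by omega), hp]
    refine Tr.of_bdd fun hb => Tr.seq (Tr.assign (hb.2 _ _ _) (Tr.of_bdd fun hb' =>
      Tr.seq (Tr.store (hb'.2 _ _ _) (Tr.of_bdd fun hb'' => Tr.store (hb''.1 _) ?_))))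
    refine ⟨by simp [h3], fun y hy => ?_, fun a ha => ?_, by simp, fun i c => ?_⟩
    · simp [show y ≠ 14 by omega, show y ≠ 15 by omega, h1 y hy]
    · simp [State.arr_setArr_of_ne _ ha, h2 a ha]
    · simp only [Expr.eval, Op.eval, State.arr_setVar, State.arr_setArr, State.var_setVar,
        State.var_setArr, h3, e8, true_and]
      simp only [Nat.reduceEqDiff, if_false, if_true]
      have hp1 : ((p : ℤ) + 1) = ((p + 1 : ℕ) : ℤ) := by push_cast; rfl
      rw [hp1, h4, h4, h4]
      simp only [Nat.cast_inj, lt_irrefl, if_false]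
      by_cases hc : c = t
      · subst hc
        simp only [and_true, Nat.lt_succ_self, if_true, lt_irrefl, if_false]
        rw [Equiv.swap_apply_def]
        split_ifs <;> first | rfl | omega
      · by_cases hc' : c < t
        · simp [hc, hc', show c < t + 1 by omega]
        · simp [hc, hc', show ¬ c < t + 1 by omega]
  · rintro s' ⟨h1, h2, h3, h4⟩
    refine ⟨h1, h2, ?_⟩
    funext i
    ext c
    simp [vec, h4]

/-- The invariant of lattice reduction: the rows of array `2` are a basis, with bounded norms, of
the lattice generated by the vectors `v`, and after `t` rounds they are either reduced or have a
small potential. -/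
structure Reducing (v : ℕ → EuclideanSpace ℝ (Fin n)) (R : ℝ) (t : ℕ)
    (w : ℕ → EuclideanSpace ℝ (Fin n)) : Prop where
  indep : Indep w n
  lat_eq : lat w n = lat v n
  norm_le : ∀ i < n, ‖w i‖ ^ 2 ≤ n * R
  gs_le : ∀ i < n, ‖gs w i‖ ^ 2 ≤ R
  pot_le : pot w n ≤ (3 / 4) ^ t * R ^ (n * n) ∨ Siegel w n ∧ ∀ i < n, SizeRed w i 0

theorem Reducing.swap {v w : ℕ → EuclideanSpace ℝ (Fin n)} {t p : ℕ} (h : Reducing v R t w)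
    (hw : ∀ i < n, SizeRed w i 0) (hp : p + 1 < n)
    (hlt : 2 * ‖gs w (p + 1)‖ ^ 2 < ‖gs w p‖ ^ 2) :
    Reducing v R (t + 1) (w ∘ Equiv.swap p (p + 1)) := by
  -- The squared norm of the projection is that of `gs w (p + 1)`, below a half of `‖gs w p‖ ^ 2` as
  -- the Siegel condition fails, plus at most a quarter by size reduction.
  have hpr : ‖pr w p (w (p + 1))‖ ^ 2 ≤ 3 / 4 * ‖gs w p‖ ^ 2 := by
    have h1 := norm_gs_succ_sq w p
    have h2 := hw (p + 1) hp p (Nat.zero_le _) (Nat.lt_succ_self p)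
    rw [← gs, real_inner_comm, inner_pr_gs] at h1
    have h3 : 0 < ‖gs w p‖ ^ 2 := by
      have := norm_pos_iff.2 (h.indep p (by omega))
      positivity
    have h4 : inner ℝ (w (p + 1)) (gs w p) ^ 2 ≤ (1 / 2 * ‖gs w p‖ ^ 2) ^ 2 := by
      rw [← sq_abs]
      gcongr
    refine le_of_mul_le_mul_left ?_ h3
    nlinarith
  have hps : ∀ i < n, Equiv.swap p (p + 1) i < n := by
    intro i hi
    rw [Equiv.swap_apply_def]
    split_ifs <;> omega
  refine ⟨h.indep.swap hp, by rw [lat_swap hp, h.lat_eq], fun i hi => h.norm_le _ (hps i hi),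
    fun i hi => ?_, Or.inl ?_⟩
  · by_cases h1 : i = p
    · subst h1
      rw [gs_swap_self]
      refine hpr.trans (le_trans ?_ (h.gs_le i hi))
      linarith [sq_nonneg ‖gs w i‖]
    by_cases h2 : i = p + 1
    · subst h2
      refine le_trans ?_ (h.gs_le p (by omega))
      gcongr
      exact norm_gs_swap_succ_le w p
    · rw [gs_swap_of_ne h1 h2]
      exact h.gs_le i hi
  · rcases h.pot_le with h1 | ⟨h1, -⟩
    · refine (pot_swap_le h.indep hp hpr).trans ?_
      rw [pow_succ]
      linarith
    · exact absurd (h1 p hp) (not_le.2 hlt)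

theorem pot_congr {v w : ℕ → EuclideanSpace ℝ (Fin n)} (h : ∀ i, gs v i = gs w i) :
    pot v n = pot w n :=
  Finset.prod_congr rfl fun _ _ => gd_congr fun l _ => h l

/-- Every round is harmless to a basis that is already reduced: size reduction does not change the
Gram–Schmidt vectors, so the Siegel condition persists and no swap takes place. This permits a
number of rounds fixed in advance. -/
theorem tr_roundProg {v : ℕ → EuclideanSpace ℝ (Fin n)} {t : ℕ} (hr : Room b l n R)
    (hn : s.var 2 = n) (h : Reducing v R t (vec n (s.arr 2))) :
    Tr b l roundProg s fun s' => LLLFrame 6 s s' ∧ Reducing v R (t + 1) (vec n (s'.arr 2)) := by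
  refine Tr.seq ((tr_sizeRedProg hr hn h.indep h.gs_le h.norm_le).mono ?_)
  rintro s1 ⟨⟨h1, h2⟩, ⟨h3, h4⟩, h5⟩
  have hred : Reducing v R t (vec n (s1.arr 2)) := by
    refine ⟨fun i hi => by rw [h4]; exact h.indep i hi, h3.trans h.lat_eq, fun i hi => (h5 i hi).2,
      fun i hi => by rw [h4]; exact h.gs_le i hi, ?_⟩
    rcases h.pot_le with h6 | ⟨h6, -⟩
    · left; rwa [pot_congr h4]
    · refine Or.inr ⟨fun i hi => ?_, fun i hi => (h5 i hi).1⟩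
      rw [h4, h4]
      exact h6 i hi
  have hn1 : s1.var 2 = n := (h1 2 (by omega)).trans hn
  refine Tr.seq ((tr_gsoProg hred.indep hr.le_l hr.lt_b hn1 hr.one_le_normBound hr.pow_lt
    fun i hi => (hred.norm_le i hi).trans hr.nR_le).mono ?_)
  rintro s2 ⟨⟨k1, k2⟩, k3⟩
  have harr : s2.arr 2 = s1.arr 2 := k2 2 (by omega)
  refine Tr.seq ((tr_findProg hr ((k1 2 (by omega)).trans hn1) hred.indep k3).mono ?_)
  rintro s3 ⟨m1, m2, m3⟩
  have e2 : s3.var 2 = n := by rw [m1 2 (by omega), k1 2 (by omega), hn1]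
  refine Tr.branch (fun he => Tr.skip ?_) (fun he => ?_)
  · have h8 : s3.var 8 < 0 := by
      by_contra hc
      exact he (by simp [Expr.eval, Op.eval, hc])
    obtain ⟨-, hS⟩ := m3.resolve_right (by rintro ⟨p, hp, -⟩; omega)
    refine ⟨⟨fun y hy => ?_, fun a ha ha' => ?_⟩, ?_⟩
    · rw [m1 y (by omega), k1 y (by omega), h1 y hy]
    · rw [m2, k2 a ha', h2 a ha ha']
    · rw [m2, harr]
      exact ⟨hred.indep, hred.lat_eq, hred.norm_le, hred.gs_le, Or.inr ⟨hS, fun i hi => (h5 i hi).1⟩⟩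
  · have h8 : 0 ≤ s3.var 8 := by
      by_contra hc
      simp [Expr.eval, Op.eval, not_le.1 hc] at he
    obtain ⟨p, hp, hpn, hlt⟩ := m3.resolve_left (by rintro ⟨hp, -⟩; omega)
    refine (tr_swapProg hr e2 hp).mono ?_
    rintro s4 ⟨q1, q2, q3⟩
    refine ⟨⟨fun y hy => ?_, fun a ha ha' => ?_⟩, ?_⟩
    · rw [q1 y (by omega), m1 y (by omega), k1 y (by omega), h1 y hy]
    · rw [q2 a ha, m2, k2 a ha', h2 a ha ha']
    · rw [q3, m2, harr]
      exact hred.swap (fun i hi => (h5 i hi).1) hpn hlt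

/-- Lattice reduction of the rows of array `2` in `e` rounds. -/
def lllProg (e : Expr) : Prog := .forLoop 5 e roundProg

theorem tr_lllProg {e : Expr} {N : ℕ} (hr : Room b l n R) (hn : s.var 2 = n)
    (h : Reducing (vec n (s.arr 2)) R 0 (vec n (s.arr 2))) (hl : N ≤ l) (hb : (N : ℤ) < 2 ^ b)
    (he : ∀ s' : State, (∀ y < 5, s'.var y = s.var y) → e.eval s' = N)
    (hN : (3 / 4) ^ N * R ^ (n * n) < 1) :
    Tr b l (lllProg e) s fun s' => LLLFrame 5 s s' ∧ Indep (vec n (s'.arr 2)) n ∧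
      lat (vec n (s'.arr 2)) n = lat (vec n (s.arr 2)) n ∧
      (∀ i < n, ‖vec n (s'.arr 2) i‖ ^ 2 ≤ n * R) ∧
      Siegel (vec n (s'.arr 2)) n ∧ ∀ i < n, SizeRed (vec n (s'.arr 2)) i 0 := by
  refine Tr.forLoop N (fun t s' => LLLFrame 5 s s' ∧ s'.var 5 = t ∧
    Reducing (vec n (s.arr 2)) R t (vec n (s'.arr 2))) hl hb ?_ ?_ ?_ ?_
  · refine ⟨⟨fun y hy => ?_, fun a _ _ => rfl⟩, by simp, h⟩
    simp [show y ≠ 5 by omega]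
  · rintro t ht s' ⟨⟨h1, h2⟩, h3, -⟩
    exact ⟨h3, he s' h1⟩
  · rintro t ht s1 ⟨⟨h1, h2⟩, h3, h4⟩
    refine (tr_roundProg hr ((h1 2 (by omega)).trans hn) h4).mono ?_
    rintro s2 ⟨⟨k1, k2⟩, k3⟩
    refine ⟨(k1 5 (by omega)).trans h3, ⟨fun y hy => ?_, fun a ha ha' => ?_⟩, by simp, k3⟩
    · simp [show y ≠ 5 by omega, k1 y (by omega), h1 y hy]
    · simp [k2 a ha ha', h2 a ha ha']
  · rintro s' ⟨h1, h3, h4⟩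
    -- If the basis were still not known to be reduced after `N` rounds, its potential would be
    -- below 1, which is impossible for an integral basis.
    refine ⟨h1, h4.indep, h4.lat_eq, h4.norm_le, h4.pot_le.resolve_left fun h5 => ?_⟩
    have := (integral_vec n (s'.arr 2)).one_le_pot h4.indep
    linarith

end RAM

/-! ### The whole program -/

namespace RAM

open LLL

local infixl:65 " +ₑ " => Expr.bin Op.add
local infixl:65 " -ₑ " => Expr.bin Op.sub
local infixl:70 " *ₑ " => Expr.bin Op.mul
local infixl:70 " /ₑ " => Expr.bin Op.div

/-- Register `x` is set to the power of `c` with the exponent in register `0`. -/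
def powProg (x : ℕ) (c : ℤ) : Prog :=
  .seq (.assign x (.const 1)) (.forLoop 14 (.var 0) (.assign x (.var x *ₑ .const c)))

/-- The entry `w (11 - d) 10`, multiplied by `N` and rounded. -/
def roundExpr : Expr :=
  (.var 3 *ₑ .cell 0 (.var 11 -ₑ .var 0) (.var 10)) /ₑ .cell 1 (.var 11 -ₑ .var 0) (.var 10)

/-- The entry in row `10` and column `11` of the initial basis. -/
def entryExpr : Expr :=
  .bin .eq (.var 10) (.var 11) *ₑ (.bin .lt (.var 10) (.var 0) +ₑ
      (.const 1 -ₑ .bin .lt (.var 10) (.var 0)) *ₑ .var 3) +ₑ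
    .bin .lt (.var 10) (.var 0) *ₑ (.const 1 -ₑ .bin .lt (.var 11) (.var 0)) *ₑ
      (roundExpr -ₑ .var 3 *ₑ (roundExpr /ₑ .var 3))

/-- Array `2` is filled with the initial basis. -/
def fillProg : Prog :=
  .forLoop 10 (.var 2) (.forLoop 11 (.var 2) (.store 2 (.var 10) (.var 11) entryExpr))

/-- Register `9` is set to the number of basis vectors that can be needed for vectors whose squared
norm is at most register `4`. -/
def rankProg : Prog :=
  .seq (.assign 9 (.const 0)) (.forLoop 14 (.var 2)
    (.branch (.bin .lt (.var 4 *ₑ .cell 3 (.var 14 -ₑ .const 1) (.var 14 -ₑ .const 1))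
      (.cell 3 (.var 14) (.var 14))) .skip (.assign 9 (.var 14 +ₑ .const 1))))

/-- The first `d` coordinates of the basis vectors are copied to the output. -/
def outProg : Prog :=
  .seq (.forLoop 10 (.var 9) (.forLoop 11 (.var 0)
    (.store 0 (.var 10) (.var 11) (.cell 2 (.var 10) (.var 11))))) (.assign 0 (.var 9))

/-- The program for non-empty input. -/
def coreProg (K K' : ℕ) : Prog :=
  .seq (.assign 2 (.var 0 +ₑ .var 1)) (.seq (powProg 3 (2 ^ K)) (.seq (powProg 4 (2 ^ K'))
    (.seq fillProg (.seq (lllProg (.const (3 * (2 * K + 1)) *ₑ .var 2 *ₑ .var 2 *ₑ .var 2))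
      (.seq gsoProg (.seq rankProg outProg))))))

/-- The program. -/
def mainProg (K K' : ℕ) : Prog := .branch (.var 0 *ₑ .var 1) (coreProg K K') .skip

/-- The initial basis. -/
def entry (d : ℕ) (N : ℤ) (W : ℕ → ℕ → ℤ) (i c : ℕ) : ℤ :=
  (if i = c then if i < d then 1 else N else 0) + if i < d ∧ d ≤ c then W (c - d) i else 0

theorem abs_entry_le_of_abs_le {d : ℕ} {N : ℤ} {W : ℕ → ℕ → ℤ} (hN : 1 ≤ N)
    (hW : ∀ r j, |W r j| ≤ N) (i c : ℕ) : |entry d N W i c| ≤ N := by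
  rw [entry]
  by_cases h1 : i < d ∧ d ≤ c
  · rw [if_neg (by omega), if_pos h1, zero_add]
    exact hW _ _
  · rw [if_neg h1, add_zero]
    split_ifs
    · rwa [abs_one]
    · rw [abs_of_nonneg (by omega)]
    · rw [abs_zero]; omega

/-- A matrix of natural size as an array. -/
def ofEntries (f : ℕ → ℕ → ℤ) (i j : ℤ) : ℤ := f i.toNat j.toNat

theorem indep_entry {d n : ℕ} {N : ℤ} (hN : 1 ≤ N) (W : ℕ → ℕ → ℤ) :
    Indep (vec n (ofEntries (entry d N W))) n := by
  apply indep_of_linearIndependent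
  let A : Matrix (Fin n) (Fin n) ℝ := Matrix.of fun i c => (entry d N W i c : ℝ)
  have hA : A.det ≠ 0 := by
    rw [Matrix.det_of_isUpperTriangular]
    · refine Finset.prod_ne_zero_iff.2 fun i _ => ?_
      simp only [A, Matrix.of_apply, entry, if_true]
      rw [if_neg (show ¬((i : ℕ) < d ∧ d ≤ i) by omega), add_zero]
      split_ifs
      · norm_num
      · norm_cast
        omega
    · intro i j hij
      have hij' : (j : ℕ) < i := by simpa using hij
      simp only [A, Matrix.of_apply, entry]
      rw [if_neg (by omega), if_neg (by omega)]
      simp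
  have h := (Matrix.linearIndependent_rows_of_det_ne_zero hA).map'
    (WithLp.linearEquiv 2 ℝ (Fin n → ℝ)).symm.toLinearMap (LinearEquiv.ker _)
  exact h

variable {b l n d : ℕ} {R : ℝ} {s : State}

theorem tr_powProg {x k : ℕ} (hx : x ≠ 0) (hx' : x < 14) (hd : s.var 0 = d) (hl : d ≤ l)
    (hb : (d : ℤ) < 2 ^ b) (hk : k * d < b) :
    Tr b l (powProg x (2 ^ k)) s fun s' => (∀ y < 14, y ≠ x → s'.var y = s.var y) ∧
      s'.arr = s.arr ∧ s'.var x = 2 ^ (k * d) := by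
  refine Tr.seq (Tr.assign ?_ ?_)
  · simp only [Expr.eval, abs_one]
    exact one_lt_pow₀ (by norm_num) (by omega)
  refine Tr.forLoop d (fun t s' => (∀ y < 14, y ≠ x → s'.var y = s.var y) ∧
      s'.arr = s.arr ∧ s'.var 14 = t ∧ s'.var x = 2 ^ (k * t)) hl hb ?_ ?_ ?_ ?_
  · refine ⟨fun y hy hyx => ?_, rfl, by simp, ?_⟩
    · simp [show y ≠ 14 by omega, hyx]
    · simp [Expr.eval, show x ≠ 14 by omega]
  · rintro t ht s' ⟨h1, h2, h3, h4⟩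
    exact ⟨h3, by simp [Expr.eval, h1 0 (by omega) hx.symm, hd]⟩
  · rintro t ht s' ⟨h1, h2, h3, h4⟩
    have h5 : Expr.eval s' (.var x *ₑ .const (2 ^ k)) = 2 ^ (k * (t + 1)) := by
      simp only [Expr.eval, Op.eval, h4]
      ring
    refine Tr.assign ?_ ⟨?_, fun y hy hyx => ?_, by simp [h2], by simp, ?_⟩
    · rw [h5, abs_of_nonneg (by positivity)]
      refine pow_lt_pow_right₀ (by norm_num) (lt_of_le_of_lt ?_ hk)
      exact Nat.mul_le_mul_left _ (by omega)
    · simp [show (14 : ℕ) ≠ x by omega, h3]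
    · simp [show y ≠ 14 by omega, hyx, h1 y hy hyx]
    · simp only [State.var_setVar, if_neg (show x ≠ 14 by omega), if_true, h5]
  · rintro s' ⟨h1, h2, h3, h4⟩
    exact ⟨h1, h2, h4⟩

theorem tr_fillProg {N : ℤ} (hn : s.var 2 = n) (hd : s.var 0 = d) (hN : s.var 3 = N) (h1N : 1 ≤ N)
    (hl : n ≤ l) (hb : (n : ℤ) < 2 ^ b) (hNb : N < 2 ^ b) :
    Tr b l fillProg s fun s' => (∀ y < 10, s'.var y = s.var y) ∧
      (∀ a, a ≠ 2 → s'.arr a = s.arr a) ∧ ∀ i < n, vec n (s'.arr 2) i = vec n (ofEntries (entry d N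
        fun r j => (N * s.arr 0 r j / s.arr 1 r j) % N)) i := by
  set W : ℕ → ℕ → ℤ := fun r j => (N * s.arr 0 r j / s.arr 1 r j) % N with hW
  have hWb : ∀ r j, |W r j| ≤ N := fun r j => by
    simp only [hW]
    rw [abs_of_nonneg (Int.emod_nonneg _ (by omega))]
    exact (Int.emod_lt_of_pos _ (by omega)).le
  refine Tr.forLoop n (fun i s' => (∀ y < 10, s'.var y = s.var y) ∧
      (∀ a, a ≠ 2 → s'.arr a = s.arr a) ∧ s'.var 10 = i ∧
      ∀ i' < i, ∀ c < n, s'.arr 2 (i' : ℕ) (c : ℕ) = entry d N W i' c) hl hb ?_ ?_ ?_ ?_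
  · refine ⟨fun y hy => ?_, fun a ha => rfl, by simp, by simp⟩
    simp [show y ≠ 10 by omega]
  · rintro i hi s' ⟨h1, h2, h3, -⟩
    exact ⟨h3, by simp [Expr.eval, h1, hn]⟩
  · rintro i hi s1 ⟨h1, h2, h3, h4⟩
    refine Tr.forLoop n (fun c s' => (∀ y < 10, s'.var y = s.var y) ∧
      (∀ a, a ≠ 2 → s'.arr a = s.arr a) ∧ s'.var 10 = i ∧ s'.var 11 = c ∧
      ∀ i' c', i' < i ∧ c' < n ∨ i' = i ∧ c' < c → s'.arr 2 (i' : ℕ) (c' : ℕ) = entry d N W i' c')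
      hl hb ?_ ?_ ?_ ?_
    · refine ⟨fun y hy => ?_, h2, by simp [h3], by simp, fun i' c' h => ?_⟩
      · simp [show y ≠ 11 by omega, h1 y hy]
      · exact h4 i' (by omega) c' (by omega)
    · rintro c hc s' ⟨h1, -, -, h4, -⟩
      exact ⟨h4, by simp [Expr.eval, h1, hn]⟩
    · rintro c hc s' ⟨h1, h2, h3, h4, h5⟩
      -- Comparisons take the values 0 and 1, so the case distinction is made by arithmetic; `x - N
      -- * (x / N)` is the remainder modulo `N`.
      have h6 : entryExpr.eval s' = entry d N W i c := by
        simp only [entryExpr, roundExpr, Expr.eval, Op.eval, h1 0 (by omega), h1 3 (by omega),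
          h2 0 (by omega), h2 1 (by omega), h3, h4, hd, hN, entry, Nat.cast_inj, Nat.cast_lt]
        by_cases hid : i < d
        · by_cases hcd : c < d
          · by_cases hic : i = c <;> simp [hid, hcd, hic]
          · simp only [hid, hcd, show i ≠ c by omega, not_lt.1 hcd, if_true, if_false, true_and]
            rw [show ((c : ℤ) - d) = ((c - d : ℕ) : ℤ) by omega]
            simp only [hW, Int.emod_def]
            ring
        · by_cases hic : i = c
          · subst hic
            simp [hid]
          · simp [hid, hic]
      refine Tr.store ?_ ⟨by simp [h4], fun y hy => ?_, fun a ha => ?_, by simp [h3], by simp,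
        fun i' c' h => ?_⟩
      · rw [h6]
        exact (abs_entry_le_of_abs_le h1N hWb i c).trans_lt hNb
      · simp [show y ≠ 11 by omega, h1 y hy]
      · simp [State.arr_setArr_of_ne _ ha, h2 a ha]
      · simp only [h6]
        simp only [State.arr_setVar, State.arr_setArr, Expr.eval, h3, h4, true_and, Nat.cast_inj]
        split_ifs with h7
        · rw [h7.1, h7.2]
        · exact h5 i' c' (by omega)
    · rintro s' ⟨h1, h2, h3, h4, h5⟩
      refine ⟨h3, fun y hy => ?_, h2, by simp, fun i' hi' c hc => ?_⟩
      · simp [show y ≠ 10 by omega, h1 y hy]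
      · exact h5 i' c (by omega)
  · rintro s' ⟨h1, h2, h3, h4⟩
    refine ⟨h1, h2, fun i hi => ?_⟩
    ext c
    simp [vec, ofEntries, h4 i hi c c.2]

/-- Register `9` is overwritten at each index whose Gram–Schmidt vector is short, so it ends as one
more than the last such index, or as 0 if there is none. -/
theorem tr_rankProg {v : ℕ → EuclideanSpace ℝ (Fin n)} {T : ℕ} (hn : s.var 2 = n)
    (hl : n ≤ l) (hb : (n : ℤ) < 2 ^ b)
    (hT : s.var 4 = T) (hind : Indep v n) (hg : IsGso v n (s.arr 3)) :
    Tr b l rankProg s fun s' => (∀ y < 9, s'.var y = s.var y) ∧ s'.arr = s.arr ∧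
      ∃ k ≤ n, s'.var 9 = k ∧ (∀ j, j + 1 = k → ‖gs v j‖ ^ 2 ≤ T) ∧
        ∀ j, k ≤ j → j < n → T < ‖gs v j‖ ^ 2 := by
  refine Tr.seq (Tr.assign (by simp [Expr.eval]) ?_)
  simp only [Expr.eval]
  refine Tr.forLoop n (fun t s' => (∀ y < 9, s'.var y = s.var y) ∧ s'.arr = s.arr ∧
      s'.var 14 = t ∧ ∃ k ≤ n, s'.var 9 = k ∧ (∀ j, j + 1 = k → ‖gs v j‖ ^ 2 ≤ T) ∧
        ∀ j, k ≤ j → j < t → T < ‖gs v j‖ ^ 2) hl hb ?_ ?_ ?_ ?_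
  · refine ⟨fun y hy => ?_, rfl, by simp, 0, by omega, by simp, by simp, by simp⟩
    simp [show y ≠ 14 by omega, show y ≠ 9 by omega]
  · rintro t ht s' ⟨h1, h2, h3, -⟩
    exact ⟨h3, by simp [Expr.eval, h1, hn]⟩
  · rintro t ht s' ⟨h1, h2, h3, k, hkn, hk, h4, h5⟩
    have hcond : T * s.arr 3 ((t : ℤ) - 1) ((t : ℤ) - 1) < s.arr 3 t t ↔ (T : ℝ) < ‖gs v t‖ ^ 2 := by
      rw [← Int.cast_lt (R := ℝ)]
      push_cast
      rw [hg.diag ht, hg.diag_pred ht.le, gd_succ, mul_comm]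
      exact mul_lt_mul_iff_right₀ (hind.gd_pos ht.le)
    refine Tr.branch (fun he => Tr.skip ?_) (fun he => Tr.assign ?_ ?_)
    · simp only [Expr.eval, Op.eval, h1 4 (by omega), h2, h3, hT, ne_eq, ite_eq_right_iff,
        one_ne_zero, imp_false, not_not] at he
      rw [hcond] at he
      refine ⟨h3, fun y hy => ?_, by simp [h2], by simp, k, hkn, by simp [hk], h4, fun j h6 h7 => ?_⟩
      · simp [show y ≠ 14 by omega, h1 y hy]
      · rcases Nat.lt_succ_iff_lt_or_eq.1 h7 with h | rfl
        · exact h5 j h6 h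
        · exact he
    · simp only [Expr.eval, Op.eval, h3]
      rw [abs_of_nonneg (by omega)]
      omega
    · simp only [Expr.eval, Op.eval, h1 4 (by omega), h2, h3, hT, ite_eq_right_iff,
        one_ne_zero, imp_false] at he
      rw [hcond, not_lt] at he
      refine ⟨by simp [h3], fun y hy => ?_, by simp [h2], by simp, t + 1, ht, ?_, fun j hj => ?_,
        fun j h6 h7 => by omega⟩
      · simp [show y ≠ 14 by omega, show y ≠ 9 by omega, h1 y (by omega)]
      · simp [Expr.eval, Op.eval, h3]
      · rwa [show j = t by omega]
  · rintro s' ⟨h1, h2, h3, h4⟩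
    exact ⟨h1, h2, h4⟩

theorem tr_outProg {k : ℕ} (hd : s.var 0 = d) (hk : s.var 9 = k) (hdl : d ≤ l) (hkl : k ≤ l)
    (hdb : (d : ℤ) < 2 ^ b) (hkb : (k : ℤ) < 2 ^ b) :
    Tr b l outProg s fun s' => s'.var 0 = k ∧
      ∀ i < k, ∀ j < d, s'.arr 0 (i : ℕ) (j : ℕ) = s.arr 2 i j := by
  refine Tr.seq (Tr.forLoop k (fun i s' => (∀ y < 10, s'.var y = s.var y) ∧
      s'.arr 2 = s.arr 2 ∧ s'.var 10 = i ∧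
      ∀ i' < i, ∀ j < d, s'.arr 0 (i' : ℕ) (j : ℕ) = s.arr 2 i' j) hkl hkb ?_ ?_ ?_ ?_)
  · refine ⟨fun y hy => ?_, rfl, by simp, by simp⟩
    simp [show y ≠ 10 by omega]
  · rintro i hi s' ⟨h1, h2, h3, -⟩
    exact ⟨h3, by simp [Expr.eval, h1, hk]⟩
  · rintro i hi s1 ⟨h1, h2, h3, h4⟩
    refine Tr.forLoop d (fun j s' => (∀ y < 10, s'.var y = s.var y) ∧
      s'.arr 2 = s.arr 2 ∧ s'.var 10 = i ∧ s'.var 11 = j ∧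
      ∀ i' j', i' < i ∧ j' < d ∨ i' = i ∧ j' < j → s'.arr 0 (i' : ℕ) (j' : ℕ) = s.arr 2 i' j')
      hdl hdb ?_ ?_ ?_ ?_
    · refine ⟨fun y hy => ?_, h2, by simp [h3], by simp, fun i' j' h => ?_⟩
      · simp [show y ≠ 11 by omega, h1 y hy]
      · exact h4 i' (by omega) j' (by omega)
    · rintro c hc s' ⟨h1, -, -, h4, -⟩
      exact ⟨h4, by simp [Expr.eval, h1, hd]⟩
    · rintro j hj s' ⟨h1, h2, h3, h4, h5⟩
      refine Tr.of_bdd fun hb => Tr.store (hb.2 _ _ _) ⟨by simp [h4], fun y hy => ?_, ?_,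
        by simp [h3], by simp, fun i' j' h => ?_⟩
      · simp [show y ≠ 11 by omega, h1 y hy]
      · simp [State.arr_setArr_of_ne, h2]
      · simp only [State.arr_setVar, State.arr_setArr, Expr.eval, h3, h4, true_and, Nat.cast_inj]
        split_ifs with h7
        · rw [h7.1, h7.2, h2]
        · exact h5 i' j' (by omega)
    · rintro s' ⟨h1, h2, h3, h4, h5⟩
      refine ⟨h3, fun y hy => ?_, h2, by simp, fun i' hi' j hj => ?_⟩
      · simp [show y ≠ 10 by omega, h1 y hy]
      · exact h5 i' j (by omega)
  · rintro s' ⟨h1, h2, h3, h4⟩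
    refine Tr.of_bdd fun hb => Tr.assign (hb.1 _) ⟨?_, h4⟩
    simp [Expr.eval, h1, hk]

end RAM

namespace LLL

set_option linter.unusedSectionVars false

variable {V : Type*} [NormedAddCommGroup V] [InnerProductSpace ℝ V] [FiniteDimensional ℝ V]
  {v w : ℕ → V} {n : ℕ}

theorem gs_eq_of_eqOn (h : ∀ i < n, v i = w i) {i : ℕ} (hi : i < n) : gs v i = gs w i := by
  have h1 : flag v i = flag w i := by
    rw [flag, flag, Set.image_congr (s := Set.Iio i) fun j hj => h j (lt_trans hj hi)]
  rw [gs, gs, pr_congr h1, h i hi]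

theorem lat_eq_of_eqOn (h : ∀ i < n, v i = w i) : lat v n = lat w n := by
  rw [lat, lat, Set.image_congr (s := Set.Iio n) fun j hj => h j hj]

end LLL

/-! ### Correctness of the assembled program -/

namespace RAM

open LLL

variable {b l n d : ℕ} {s : State}

theorem norm_entry_sq_le {K : ℕ} {W : ℕ → ℕ → ℤ} (hd : d ≤ n)
    (hW : ∀ r j, |W r j| ≤ 2 ^ (K * d)) (i : ℕ) :
    ‖vec n (ofEntries (entry d (2 ^ (K * d)) W)) i‖ ^ 2 ≤ 2 ^ ((2 * K + 1) * n) := by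
  rw [norm_vec_sq]
  have h1 : ∀ c ∈ Finset.range n, ofEntries (entry d (2 ^ (K * d)) W) i c *
      ofEntries (entry d (2 ^ (K * d)) W) i c ≤ 2 ^ (2 * K * n) := by
    intro c _
    have h2 := abs_entry_le_of_abs_le (d := d) (one_le_pow₀ (by norm_num)) hW i c
    simp only [ofEntries, Int.toNat_natCast]
    rw [← abs_mul_abs_self]
    calc _ ≤ (2 : ℤ) ^ (K * d) * 2 ^ (K * d) := mul_le_mul h2 h2 (abs_nonneg _) (by positivity)
      _ = 2 ^ (2 * K * d) := by ring
      _ ≤ 2 ^ (2 * K * n) := pow_le_pow_right₀ (by norm_num) (Nat.mul_le_mul_left _ hd)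
  have h3 := Finset.sum_le_sum h1
  simp only [Finset.sum_const, Finset.card_range, nsmul_eq_mul] at h3
  have h4 : (n : ℤ) ≤ 2 ^ n := by exact_mod_cast Nat.lt_two_pow_self.le
  have h5 : (n : ℤ) * 2 ^ (2 * K * n) ≤ 2 ^ ((2 * K + 1) * n) := by
    calc (n : ℤ) * 2 ^ (2 * K * n) ≤ 2 ^ n * 2 ^ (2 * K * n) := by gcongr
      _ = 2 ^ ((2 * K + 1) * n) := by ring
  exact_mod_cast h3.trans h5

/-- The initial potential is at most `2 ^ (κ * n ^ 3)`, and three rounds per factor 2 suffice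
because `(3 / 4) ^ 3 * 2 = 27 / 32 < 1`. -/
theorem pow_mul_pow_lt_one {κ n : ℕ} (hκ : 0 < κ) (hn : 0 < n) :
    (3 / 4 : ℝ) ^ (3 * κ * n * n * n) * ((2 : ℝ) ^ (κ * n)) ^ (n * n) < 1 := by
  have h : (3 / 4 : ℝ) ^ (3 * κ * n * n * n) * ((2 : ℝ) ^ (κ * n)) ^ (n * n) =
      (27 / 32) ^ (κ * n * n * n) := by
    rw [show 3 * κ * n * n * n = 3 * (κ * n * n * n) by ring, pow_mul, ← pow_mul (2 : ℝ),
      show κ * n * (n * n) = κ * n * n * n by ring, ← mul_pow]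
    norm_num
  rw [h]
  exact pow_lt_one₀ (by norm_num) (by norm_num) (by positivity)

/-- The number of rounds. -/
def rounds (K n : ℕ) : ℕ := 3 * (2 * K + 1) * n * n * n

/-- The rounded input. -/
def rounded (N : ℤ) (s : State) (r j : ℕ) : ℤ := (N * s.arr 0 r j / s.arr 1 r j) % N

/-- Reduction modulo `N` bounds the entries also for rational inputs outside `[0, 1)`, on which the
program must still run in polynomial time. On `[0, 1)` it changes nothing. -/
theorem abs_rounded_le {N : ℤ} (hN : 1 ≤ N) (s : State) (r j : ℕ) : |rounded N s r j| ≤ N := by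
  rw [rounded, abs_of_nonneg (Int.emod_nonneg _ (by omega))]
  exact (Int.emod_lt_of_pos _ (by omega)).le

theorem tr_coreProg {K K' m : ℕ} (hd : s.var 0 = d) (hm : s.var 1 = m) (hn : n = d + m)
    (hr : Room b l n (2 ^ ((2 * K + 1) * n))) (hNl : rounds K n ≤ l)
    (hNb : (rounds K n : ℤ) < 2 ^ b) (hK : K * d < b) (hK' : K' * d < b) :
    Tr b l (coreProg K K') s fun s' => ∃ k ≤ n, ∃ f : ℤ → ℤ → ℤ, s'.var 0 = k ∧
      (∀ i < k, ∀ j < d, s'.arr 0 (i : ℕ) (j : ℕ) = f i j) ∧ Indep (vec n f) n ∧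
      lat (vec n f) n = lat (vec n (ofEntries (entry d (2 ^ (K * d))
        (rounded (2 ^ (K * d)) s)))) n ∧
      (∀ i < k, ‖vec n f i‖ ^ 2 ≤ 4 ^ n * 2 ^ (K' * d)) ∧
      ∀ j, k ≤ j → j < n → 2 ^ (K' * d) < ‖gs (vec n f) j‖ ^ 2 := by
  have hlt := hr.lt_b
  have hdl : d ≤ l := by have := hr.le_l; omega
  have h1N : (1 : ℤ) ≤ 2 ^ (K * d) := one_le_pow₀ (by norm_num)
  have h1n := hr.one_le_n
  have h2 : Expr.eval s (.bin .add (.var 0) (.var 1)) = n := by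
    simp [Expr.eval, Op.eval, hd, hm, hn]
  refine Tr.seq (Tr.assign (by rw [h2, abs_of_nonneg (by omega)]; exact hlt) ?_)
  rw [h2]
  refine Tr.seq ((tr_powProg (d := d) (by norm_num) (by norm_num) (by simp [hd]) hdl (by omega)
    hK).mono ?_)
  rintro s1 ⟨a1, a2, a3⟩
  refine Tr.seq ((tr_powProg (d := d) (by norm_num) (by norm_num) (by simp [a1, hd]) hdl (by omega)
    hK').mono ?_)
  rintro s2 ⟨b1, b2, b3⟩
  have n2 : s2.var 2 = n := by simp [b1, a1]
  have d2 : s2.var 0 = d := by simp [b1, a1, hd]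
  have N2 : s2.var 3 = 2 ^ (K * d) := by rw [b1 3 (by norm_num) (by norm_num), a3]
  have arr2 : s2.arr = s.arr := by rw [b2, a2]; rfl
  refine Tr.seq ((tr_fillProg (n := n) n2 d2 N2 h1N hr.le_l hlt
    (pow_lt_pow_right₀ (by norm_num) hK)).mono ?_)
  rintro s3 ⟨c1, c2, c3⟩
  rw [arr2] at c3
  change ∀ i < n, vec n (s3.arr 2) i =
    vec n (ofEntries (entry d (2 ^ (K * d)) (rounded (2 ^ (K * d)) s))) i at c3
  set v := vec n (ofEntries (entry d (2 ^ (K * d)) (rounded (2 ^ (K * d)) s)))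
  have hv : ∀ i, ‖v i‖ ^ 2 ≤ 2 ^ ((2 * K + 1) * n) :=
    norm_entry_sq_le (by omega) (abs_rounded_le h1N s)
  have hR : (1 : ℝ) ≤ 2 ^ ((2 * K + 1) * n) := one_le_pow₀ (by norm_num)
  have hgs : ∀ i < n, ‖gs (vec n (s3.arr 2)) i‖ ^ 2 ≤ 2 ^ ((2 * K + 1) * n) := by
    intro i hi
    rw [gs_eq_of_eqOn c3 hi]
    refine le_trans ?_ (hv i)
    gcongr
    exact norm_gs_le
  have hred : Reducing (vec n (s3.arr 2)) (2 ^ ((2 * K + 1) * n)) 0 (vec n (s3.arr 2)) := by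
    refine ⟨fun i hi => ?_, rfl, fun i hi => ?_, hgs, Or.inl ?_⟩
    · rw [gs_eq_of_eqOn c3 hi]
      exact indep_entry h1N _ i hi
    · rw [c3 i hi]
      refine (hv i).trans (le_mul_of_one_le_left (by positivity) ?_)
      exact_mod_cast h1n
    · rw [pow_zero, one_mul]
      exact pot_le hR hgs
  refine Tr.seq ((tr_lllProg (N := rounds K n) hr ((c1 2 (by norm_num)).trans n2) hred hNl hNb
    (fun s' hs' => ?_) (pow_mul_pow_lt_one (by omega) (by omega))).mono ?_)
  · simp only [Expr.eval, Op.eval, hs' 2 (by norm_num), c1 2 (by norm_num), n2, rounds]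
    push_cast
    ring
  rintro s4 ⟨⟨e1, e2⟩, e3, e4, e5, e6, e7⟩
  have n4 : s4.var 2 = n := by rw [e1 2 (by norm_num), c1 2 (by norm_num), n2]
  refine Tr.seq ((tr_gsoProg e3 hr.le_l hlt n4 hr.one_le_normBound hr.pow_lt
    fun i hi => (e5 i hi).trans hr.nR_le).mono ?_)
  rintro s5 ⟨⟨g1, g2⟩, g3⟩
  have n5 : s5.var 2 = n := by rw [g1 2 (by norm_num), n4]
  have T5 : s5.var 4 = (2 ^ (K' * d) : ℕ) := by
    rw [g1 4 (by norm_num), e1 4 (by norm_num), c1 4 (by norm_num), b3]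
    push_cast
    rfl
  refine Tr.seq ((tr_rankProg n5 hr.le_l hlt T5 e3 g3).mono ?_)
  rintro s6 ⟨r1, r2, k, hkn, hk, r3, r4⟩
  have d6 : s6.var 0 = d := by
    rw [r1 0 (by norm_num), g1 0 (by norm_num), e1 0 (by norm_num), c1 0 (by norm_num), d2]
  refine (tr_outProg d6 hk hdl (hkn.trans hr.le_l) (by omega) (by omega)).mono ?_
  rintro s7 ⟨q1, q2⟩
  push_cast at r3 r4
  refine ⟨k, hkn, s4.arr 2, q1, fun i hi j hj => ?_, e3, e4.trans (lat_eq_of_eqOn c3),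
    fun i hi => ?_, r4⟩
  · rw [q2 i hi j hj, r2, g2 2 (by norm_num)]
  -- Here `i < k`, so `k - 1` is a genuine index, and its Gram–Schmidt vector is the last short one.
  · exact e6.norm_sq_le e7 (by omega) (r3 (k - 1) (by omega)) (by omega)

end RAM

/-! ### Polynomial time -/

namespace RAM

open LLL

/-- An exponent for the bound on the numbers that occur in lattice reduction. -/
def roomBits (κ n : ℕ) : ℕ :=
  2 + 2 * (n + κ * n + (2 + n + κ * n * (n + 1)) * n) * (n + 1)

theorem roomBits_mono (κ : ℕ) {n q : ℕ} (h : n ≤ q) : roomBits κ n ≤ roomBits κ q := by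
  unfold roomBits
  gcongr

theorem rounds_mono (K : ℕ) {n q : ℕ} (h : n ≤ q) : rounds K n ≤ rounds K q := by
  unfold rounds
  gcongr

/-- With `R = 2 ^ (κ * n)`, and with `n` and `3` replaced by `2 ^ n` and `2 ^ 2`, the required bound
becomes exactly `2 ^ roomBits κ n`. -/
theorem room_of_le {b l κ n : ℕ} (hn : 1 ≤ n) (hl : n ≤ l) (hnb : n < b)
    (hb : roomBits κ n < b) : Room b l n (2 ^ (κ * n)) := by
  refine ⟨hn, one_le_pow₀ (by norm_num), hl, ?_, ?_⟩
  · calc (n : ℤ) < 2 ^ n := by exact_mod_cast Nat.lt_two_pow_self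
      _ ≤ 2 ^ b := pow_le_pow_right₀ (by norm_num) hnb.le
  · have h1 : (n : ℝ) ≤ 2 ^ n := by exact_mod_cast Nat.lt_two_pow_self.le
    have h2 : (3 : ℝ) ≤ 2 ^ 2 := by norm_num
    calc 3 * normBound n (2 ^ (κ * n)) ^ (n + 1)
        ≤ 2 ^ 2 * ((2 ^ n * 2 ^ (κ * n) * (2 ^ 2 * 2 ^ n * (2 ^ (κ * n)) ^ (n + 1)) ^ n) ^ 2) ^ (n + 1) := by
          unfold normBound
          gcongr
      _ = 2 ^ roomBits κ n := by
          unfold roomBits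
          simp only [← pow_mul, ← pow_add]
          congr 1
          ring
      _ < 2 ^ b := pow_lt_pow_right₀ (by norm_num) hb

theorem bitLen_num_add_den_le {m d : ℕ} (w : Fin m → Fin d → ℚ) (i : Fin m) (j : Fin d) :
    bitLen (w i j).num + bitLen (w i j).den ≤ inputSize w := by
  have h1 : bitLen (w i j).num + bitLen (w i j).den ≤
      ∑ j, (bitLen (w i j).num + bitLen (w i j).den) :=
    Finset.single_le_sum (f := fun j => bitLen (w i j).num + bitLen (w i j).den)
      (fun _ _ => Nat.zero_le _) (Finset.mem_univ j)
  have h2 : ∑ j, (bitLen (w i j).num + bitLen (w i j).den) ≤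
      ∑ i, ∑ j, (bitLen (w i j).num + bitLen (w i j).den) :=
    Finset.single_le_sum (f := fun i => ∑ j, (bitLen (w i j).num + bitLen (w i j).den))
      (fun _ _ => Nat.zero_le _) (Finset.mem_univ i)
  unfold inputSize
  omega

/-- Every denominator takes at least one bit. For `d, m > 0` this makes both at most the input size.
If one of them is 0 the other may be exponential in the input size, which is why `mainProg` stops at
once in that case. -/
theorem mul_le_inputSize {m d : ℕ} (w : Fin m → Fin d → ℚ) : m * d ≤ inputSize w := by
  have h1 : ∀ i j, 1 ≤ bitLen (w i j).num + bitLen (w i j).den := by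
    intro i j
    have h2 : 0 < bitLen ((w i j).den : ℤ) := by
      rw [bitLen, Int.natAbs_natCast, Nat.size_pos]
      exact (w i j).pos
    omega
  have h3 : ∑ _i : Fin m, ∑ _j : Fin d, 1 ≤ ∑ i, ∑ j, (bitLen (w i j).num + bitLen (w i j).den) :=
    Finset.sum_le_sum fun i _ => Finset.sum_le_sum fun j _ => h1 i j
  simp only [Finset.sum_const, Finset.card_univ, Fintype.card_fin, smul_eq_mul, mul_one] at h3
  unfold inputSize
  omega

theorem inputState_bdd {m d b : ℕ} (w : Fin m → Fin d → ℚ) (hb : inputSize w ≤ b) :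
    (inputState w).Bdd b := by
  have h0 : |(0 : ℤ)| < 2 ^ b := by simp
  refine ⟨fun x => ?_, fun a i j => ?_⟩
  · simp only [inputState]
    split_ifs
    · rw [← bitLen_le]
      unfold inputSize at hb
      omega
    · rw [← bitLen_le]
      unfold inputSize at hb
      omega
    · exact h0
  · simp only [inputState]
    split_ifs
    · rw [matrixCells]
      split_ifs with h
      · rw [← bitLen_le]
        have := bitLen_num_add_den_le w ⟨i.toNat, h.1.2⟩ ⟨j.toNat, h.2.2⟩
        omega
      · exact h0
    · rw [matrixCells]
      split_ifs with h
      · rw [← bitLen_le]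
        have := bitLen_num_add_den_le w ⟨i.toNat, h.1.2⟩ ⟨j.toNat, h.2.2⟩
        omega
      · exact h0
    · exact h0

/-- A bound for the bit lengths of all numbers that occur on inputs of size `z`. -/
def maxBits (K K' z : ℕ) : ℕ :=
  roomBits (2 * K + 1) (2 * z) + rounds K (2 * z) + K * z + K' * z + 2 * z + 1

/-- A bound for the number of repetitions of all loops on inputs of size `z`. -/
def maxReps (K z : ℕ) : ℕ := rounds K (2 * z) + 2 * z

/-- The basis that the program computes. -/
def IsOutputBasis (K K' d n : ℕ) (W : ℕ → ℕ → ℤ) (k : ℕ) (f : ℤ → ℤ → ℤ) : Prop :=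
  k ≤ n ∧ Indep (vec n f) n ∧
    lat (vec n f) n = lat (vec n (ofEntries (entry d (2 ^ (K * d)) W))) n ∧
    (∀ i < k, ‖vec n f i‖ ^ 2 ≤ 4 ^ n * 2 ^ (K' * d)) ∧
    ∀ j, k ≤ j → j < n → 2 ^ (K' * d) < ‖gs (vec n f) j‖ ^ 2

theorem tr_mainProg (K K' : ℕ) {m d : ℕ} (w : Fin m → Fin d → ℚ) :
    Tr (maxBits K K' (inputSize w)) (maxReps K (inputSize w)) (mainProg K K') (inputState w)
      fun s' => 0 < d → 0 < m → ∃ (k : ℕ) (f : ℤ → ℤ → ℤ),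
        IsOutputBasis K K' d (d + m) (rounded (2 ^ (K * d)) (inputState w)) k f ∧
        s'.var 0 = k ∧ ∀ i < k, ∀ j < d, s'.arr 0 (i : ℕ) (j : ℕ) = f i j := by
  have e : Expr.eval (inputState w) (.bin .mul (.var 0) (.var 1)) = d * m := by
    simp [Expr.eval, Op.eval, inputState]
  refine Tr.branch (fun h => ?_) (fun h => Tr.skip fun hd hm => ?_)
  · rw [e] at h
    have h1 := mul_le_inputSize w
    have hd : 0 < d := Nat.pos_of_ne_zero fun h0 => by simp [h0] at h
    have hm : 0 < m := Nat.pos_of_ne_zero fun h0 => by simp [h0] at h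
    have hdz : d ≤ inputSize w := (Nat.le_mul_of_pos_left d hm).trans h1
    have hmz : m ≤ inputSize w := (Nat.le_mul_of_pos_right m hd).trans h1
    have hr := roomBits_mono (2 * K + 1) (show d + m ≤ 2 * inputSize w by omega)
    have hN := rounds_mono K (show d + m ≤ 2 * inputSize w by omega)
    have hK := Nat.mul_le_mul_left K hdz
    have hK' := Nat.mul_le_mul_left K' hdz
    refine (tr_coreProg (n := d + m) (m := m) (d := d) (by simp [inputState])
      (by simp [inputState]) rfl (room_of_le (by omega) ?_ ?_ ?_) ?_ ?_ ?_ ?_).mono ?_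
    · unfold maxReps; omega
    · unfold maxBits; omega
    · unfold maxBits; omega
    · unfold maxReps; omega
    · calc (rounds K (d + m) : ℤ) < 2 ^ rounds K (d + m) := by exact_mod_cast Nat.lt_two_pow_self
        _ ≤ _ := pow_le_pow_right₀ (by norm_num) (by unfold maxBits; omega)
    · unfold maxBits; omega
    · unfold maxBits; omega
    · rintro s' ⟨k, hk, f, h2, h3, h4⟩ - -
      exact ⟨k, f, ⟨hk, h4⟩, h2, h3⟩
  · rw [e] at h
    exfalso
    have : (d : ℤ) * m ≠ 0 := by positivity
    exact this h

theorem isPolyTime_mainProg (K K' : ℕ) : (mainProg K K').IsPolyTime := by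
  obtain ⟨p, hp⟩ := (mainProg K K').exists_time_eq
  have hb : ∃ pb : Polynomial ℕ, ∀ z, maxBits K K' z = pb.eval z := by
    let κ : Polynomial ℕ := .C (2 * K + 1)
    let n : Polynomial ℕ := .C 2 * .X
    refine ⟨.C 2 + .C 2 * (n + κ * n + (.C 2 + n + κ * n * (n + 1)) * n) * (n + 1) +
      .C 3 * κ * n * n * n + .C K * .X + .C K' * .X + n + 1, fun z => ?_⟩
    simp only [κ, n, maxBits, roomBits, rounds, Polynomial.eval_add, Polynomial.eval_mul,
      Polynomial.eval_C, Polynomial.eval_X, Polynomial.eval_one]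
  have hl : ∃ pl : Polynomial ℕ, ∀ z, maxReps K z = pl.eval z := by
    let κ : Polynomial ℕ := .C (2 * K + 1)
    let n : Polynomial ℕ := .C 2 * .X
    refine ⟨.C 3 * κ * n * n * n + n, fun z => ?_⟩
    simp only [κ, n, maxReps, rounds, Polynomial.eval_add, Polynomial.eval_mul,
      Polynomial.eval_C, Polynomial.eval_X]
  obtain ⟨pb, hpb⟩ := hb
  obtain ⟨pl, hpl⟩ := hl
  -- The bound `time l * (b + 1) ^ 2` of the program logic, with the polynomials for `l` and `b`
  -- substituted.
  refine ⟨p.comp pl * (pb + 1) ^ 2, fun d m w => ?_⟩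
  obtain ⟨s', t, h1, h2, -, -⟩ := tr_mainProg K K' w (inputState_bdd w (by unfold maxBits; omega))
  refine ⟨s', t, h1, h2.trans_eq ?_⟩
  simp only [hp, hpb, hpl, Polynomial.eval_mul, Polynomial.eval_comp, Polynomial.eval_pow,
    Polynomial.eval_add, Polynomial.eval_one]

theorem outputs_mainProg (K K' : ℕ) {m d : ℕ} (hd : 0 < d) (hm : 0 < m) (w : Fin m → Fin d → ℚ) :
    ∃ (k : ℕ) (f : ℤ → ℤ → ℤ),
      IsOutputBasis K K' d (d + m) (rounded (2 ^ (K * d)) (inputState w)) k f ∧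
      (mainProg K K').Outputs w fun (i : Fin k) (j : Fin d) => f i j := by
  obtain ⟨s', t, h1, -, -, h2⟩ := tr_mainProg K K' w (inputState_bdd w (by unfold maxBits; omega))
  obtain ⟨k, f, h3, h4, h5⟩ := h2 hd hm
  exact ⟨k, f, h3, s', t, h1, h4, fun i j => h5 i i.2 j j.2⟩

end RAM

/-! ### Random characters -/

section Characters

/-- Such elements are classes `j / r` with `|j| ≤ ε r`, so there are at most `2 ⌊ε r⌋ + 1` of them:
one if `ε r < 1`, and at most `3 ε r` otherwise. -/
theorem UnitAddCircle.card_le_of_torsion {r : ℕ} (hr : 0 < r) {ε : ℝ} (hε : 0 ≤ ε)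
    (S : Finset UnitAddCircle) (hS : ∀ h ∈ S, r • h = 0 ∧ ‖h‖ ≤ ε) :
    (S.card : ℝ) ≤ max 1 (3 * ε * r) := by
  have hrep : ∀ h ∈ S, ∃ j : ℤ, |(j : ℝ)| ≤ ε * r ∧ h = ((j / r : ℝ) : UnitAddCircle) := by
    intro h hh
    obtain ⟨h0, h1⟩ := hS h hh
    induction h using QuotientAddGroup.induction_on with
    | H y =>
    have h1' : |y - round y| ≤ ε := by rwa [← UnitAddCircle.norm_eq]
    have h0' : ((r * y : ℝ) : UnitAddCircle) = 0 := by
      rw [← h0, ← nsmul_eq_mul]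
      rfl
    rw [AddCircle.coe_eq_zero_iff] at h0'
    obtain ⟨k, hk⟩ := h0'
    have hk' : (k : ℝ) = r * y := by simpa using hk
    have hr' : (r : ℝ) ≠ 0 := by positivity
    refine ⟨k - r * round y, ?_, ?_⟩
    · push_cast
      rw [hk', ← mul_sub, abs_mul, Nat.abs_cast, mul_comm]
      gcongr
    · push_cast
      rw [hk', sub_div, mul_div_cancel_left₀ _ hr', mul_div_cancel_left₀ _ hr', AddCircle.coe_sub]
      have : ((round y : ℝ) : UnitAddCircle) = 0 := by
        rw [AddCircle.coe_eq_zero_iff]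
        exact ⟨round y, by simp⟩
      rw [this, sub_zero]
  choose! j hj1 hj2 using hrep
  have hcard : S.card ≤ (Finset.Icc (-(⌊ε * r⌋₊ : ℤ)) ⌊ε * r⌋₊).card := by
    refine Finset.card_le_card_of_injOn j (fun h hh => ?_) fun h hh h' hh' hjj => ?_
    · have h1 : (j h).natAbs ≤ ⌊ε * r⌋₊ := by
        rw [Nat.le_floor_iff (by positivity), Nat.cast_natAbs]
        simpa using hj1 h hh
      simp only [Finset.coe_Icc, Set.mem_Icc]
      omega
    · rw [hj2 h hh, hj2 h' hh', hjj]
  rw [Int.card_Icc] at hcard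
  have hcard' : S.card ≤ 2 * ⌊ε * r⌋₊ + 1 := by omega
  by_cases h1 : ε * r < 1
  · rw [Nat.floor_eq_zero.2 h1] at hcard'
    exact le_max_of_le_left (by exact_mod_cast hcard')
  · refine le_max_of_le_right ?_
    have h2 := Nat.floor_le (show 0 ≤ ε * r by positivity)
    have h3 : (S.card : ℝ) ≤ 2 * (⌊ε * r⌋₊ : ℝ) + 1 := by exact_mod_cast hcard'
    linarith

/-- The proportion of elements at which a character is small. -/
theorem AddMonoidHom.card_norm_le {G : Type*} [AddCommGroup G] [Fintype G] (φ : G →+ UnitAddCircle)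
    {ε : ℝ} (hε : 0 ≤ ε) :
    (Nat.card {g // ‖φ g‖ ≤ ε} : ℝ) ≤ max (1 / (Nat.card φ.range : ℝ)) (3 * ε) * Nat.card G := by
  classical
  have hr : 0 < Nat.card φ.range := Nat.card_pos
  have hr' : (0 : ℝ) < Nat.card φ.range := by exact_mod_cast hr
  let s : Finset G := Finset.univ.filter fun g => ‖φ g‖ ≤ ε
  have h1 : Nat.card {g // ‖φ g‖ ≤ ε} = s.card := by
    rw [Nat.card_eq_fintype_card, Fintype.card_subtype]
  -- Fibres of `φ` are translates of subsets of the kernel; the values in the image are killed by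
  -- its order, so the torsion count applies to them.
  have h2 : s.card ≤ Nat.card φ.ker * (s.image φ).card := by
    refine Finset.card_le_mul_card_image s _ fun h hh => ?_
    obtain ⟨g₀, -, rfl⟩ := Finset.mem_image.1 hh
    have hk : Nat.card φ.ker = (Finset.univ.filter fun g => φ g = 0).card := by
      rw [← Fintype.card_subtype, ← Nat.card_eq_fintype_card]
      rfl
    rw [hk]
    refine Finset.card_le_card_of_injOn (fun g => g - g₀) (fun g hg => ?_)
      fun _ _ _ _ h => sub_left_inj.1 h
    simp [(Finset.mem_filter.1 hg).2]
  have h3 : ((s.image φ).card : ℝ) ≤ max 1 (3 * ε * Nat.card φ.range) := by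
    refine UnitAddCircle.card_le_of_torsion hr hε _ fun h hh => ?_
    obtain ⟨g, hg, rfl⟩ := Finset.mem_image.1 hh
    refine ⟨?_, (Finset.mem_filter.1 hg).2⟩
    have := card_nsmul_eq_zero' (G := φ.range) (x := ⟨φ g, g, rfl⟩)
    simpa using congrArg Subtype.val this
  have h4 : Nat.card φ.ker * Nat.card φ.range = Nat.card G := by
    rw [← AddSubgroup.index_ker, AddSubgroup.card_mul_index]
  rw [h1, ← h4]
  push_cast
  calc (s.card : ℝ) ≤ Nat.card φ.ker * (s.image φ).card := by exact_mod_cast h2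
    _ ≤ Nat.card φ.ker * max 1 (3 * ε * Nat.card φ.range) := by gcongr
    _ = max (1 / (Nat.card φ.range : ℝ)) (3 * ε) * (Nat.card φ.ker * Nat.card φ.range) := by
      rw [show max 1 (3 * ε * Nat.card φ.range) =
        max (1 / (Nat.card φ.range : ℝ)) (3 * ε) * Nat.card φ.range by
          rw [max_mul_of_nonneg _ _ hr'.le, one_div, inv_mul_cancel₀ hr'.ne']]
      ring

/-- Telescoping, from `1 / r ^ 4 ≤ 1 / 4 * (1 / (r - 1) - 1 / r)` for `r ≥ 2`. -/
theorem sum_inv_pow_four_le (M : ℕ) : ∑ r ∈ Finset.Icc 2 (M + 1), (1 / (r : ℝ) ^ 4) ≤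
    1 / 4 * (1 - 1 / ((M : ℝ) + 1)) := by
  induction M with
  | zero => simp
  | succ M ih =>
    rw [Finset.sum_Icc_succ_top (by omega)]
    have h1 : 1 / (((M + 1 + 1 : ℕ) : ℝ)) ^ 4 ≤ 1 / 4 * (1 / ((M : ℝ) + 1) - 1 / ((M : ℝ) + 1 + 1)) := by
      have h0 : (0 : ℝ) ≤ M := Nat.cast_nonneg M
      push_cast
      rw [div_sub_div _ _ (by positivity) (by positivity), div_mul_div_comm,
        div_le_div_iff₀ (by positivity) (by positivity)]
      nlinarith [mul_nonneg h0 h0, mul_nonneg (mul_nonneg h0 h0) h0,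
        mul_nonneg (mul_nonneg h0 h0) (mul_nonneg h0 h0)]
    push_cast at h1 ⊢
    linarith

/-- A random tuple of elements of `G` is, with probability at least `1 / 2`, not almost in the
kernel of any of the given characters. -/
theorem half_le_uniformProb {G X : Type*} [AddCommGroup G] [Fintype G] [Fintype X]
    (φ : X → G →+ UnitAddCircle) {ε : ℝ} (hε : 0 ≤ ε) {d m : ℕ} (hm : d + 4 ≤ m)
    (h2 : ∀ x, 2 ≤ Nat.card (φ x).range)
    (hcard : ∀ r, 0 < r → Nat.card {x // Nat.card (φ x).range = r} ≤ r ^ d)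
    (hε' : Nat.card X * (3 * ε) ^ m ≤ 1 / 4) :
    1 / 2 ≤ uniformProb (Fin m → G) fun v => ∀ x, ∃ i, ε < ‖φ x (v i)‖ := by
  classical
  have hG : (0 : ℝ) < Nat.card G := by exact_mod_cast Nat.card_pos
  have hGm : (Nat.card (Fin m → G) : ℝ) = (Nat.card G : ℝ) ^ m := by simp
  let r : X → ℕ := fun x => Nat.card (φ x).range
  have h1 (x : X) : (Nat.card {v : Fin m → G // ∀ i, ‖φ x (v i)‖ ≤ ε} : ℝ) ≤
      (1 / (r x : ℝ) ^ m + (3 * ε) ^ m) * Nat.card (Fin m → G) := by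
    have e : Nat.card {v : Fin m → G // ∀ i, ‖φ x (v i)‖ ≤ ε} =
        Nat.card {g // ‖φ x g‖ ≤ ε} ^ m := by
      rw [Nat.card_congr (Equiv.subtypePiEquivPi (p := fun (_ : Fin m) g => ‖φ x g‖ ≤ ε)),
        Nat.card_pi]
      simp
    rw [e, hGm]
    push_cast
    calc (Nat.card {g // ‖φ x g‖ ≤ ε} : ℝ) ^ m
        ≤ (max (1 / (r x : ℝ)) (3 * ε) * Nat.card G) ^ m := by
          gcongr
          exact (φ x).card_norm_le hε
      _ = max (1 / (r x : ℝ)) (3 * ε) ^ m * (Nat.card G : ℝ) ^ m := mul_pow _ _ _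
      _ ≤ _ := by
          gcongr
          rcases max_cases (1 / (r x : ℝ)) (3 * ε) with ⟨h, -⟩ | ⟨h, -⟩
          · rw [h, div_pow, one_pow]
            have : 0 ≤ (3 * ε) ^ m := by positivity
            linarith
          · rw [h]
            have : 0 ≤ 1 / (r x : ℝ) ^ m := by positivity
            linarith
  -- Group the characters by the order `q` of their image: at most `q ^ d` of them share it, and `m
  -- ≥ d + 4` leaves at most `1 / q ^ 4`.
  have h3 : ∑ x, 1 / (r x : ℝ) ^ m ≤ 1 / 4 := by
    let M := Finset.univ.sup r
    have hmaps : ∀ x ∈ (Finset.univ : Finset X), r x ∈ Finset.Icc 2 (M + 1) := fun x hx =>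
      Finset.mem_Icc.2 ⟨h2 x, (Finset.le_sup hx).trans (Nat.le_succ _)⟩
    rw [← Finset.sum_fiberwise_of_maps_to hmaps]
    refine le_trans (Finset.sum_le_sum (g := fun r : ℕ => 1 / (r : ℝ) ^ 4) fun q hq => ?_) ?_
    · have hq2 : 2 ≤ q := (Finset.mem_Icc.1 hq).1
      have hq0 : (1 : ℝ) ≤ q := by exact_mod_cast (by omega : 1 ≤ q)
      rw [Finset.sum_congr rfl (g := fun _ => 1 / (q : ℝ) ^ m) fun x hx => by
        rw [(Finset.mem_filter.1 hx).2]]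
      rw [Finset.sum_const, nsmul_eq_mul]
      have h4 : ((Finset.univ.filter fun x => r x = q).card : ℝ) ≤ (q : ℝ) ^ d := by
        have := hcard q (by omega)
        rw [Nat.card_eq_fintype_card, Fintype.card_subtype] at this
        exact_mod_cast this
      calc _ ≤ (q : ℝ) ^ d * (1 / (q : ℝ) ^ m) := by gcongr
        _ ≤ (q : ℝ) ^ d * (1 / (q : ℝ) ^ (d + 4)) := by
          gcongr
        _ = 1 / (q : ℝ) ^ 4 := by
          rw [pow_add]
          field_simp
    · refine (sum_inv_pow_four_le M).trans ?_
      have : (0 : ℝ) ≤ 1 / (M + 1) := by positivity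
      linarith
  have h5 : (Nat.card {v : Fin m → G // ¬ ∀ x, ∃ i, ε < ‖φ x (v i)‖} : ℝ) ≤
      1 / 2 * Nat.card (Fin m → G) := by
    have e : Nat.card {v : Fin m → G // ¬ ∀ x, ∃ i, ε < ‖φ x (v i)‖} ≤
        ∑ x, Nat.card {v : Fin m → G // ∀ i, ‖φ x (v i)‖ ≤ ε} := by
      simp only [Nat.card_eq_fintype_card, Fintype.card_subtype]
      refine le_trans (Finset.card_le_card fun v hv => ?_) Finset.card_biUnion_le
      simpa using hv
    calc _ ≤ ∑ x, (Nat.card {v : Fin m → G // ∀ i, ‖φ x (v i)‖ ≤ ε} : ℝ) := by exact_mod_cast e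
      _ ≤ ∑ x, (1 / (r x : ℝ) ^ m + (3 * ε) ^ m) * Nat.card (Fin m → G) :=
        Finset.sum_le_sum fun x _ => h1 x
      _ = (∑ x, 1 / (r x : ℝ) ^ m + Nat.card X * (3 * ε) ^ m) * Nat.card (Fin m → G) := by
        rw [← Finset.sum_mul, Finset.sum_add_distrib, Finset.sum_const, nsmul_eq_mul]
        simp
      _ ≤ _ := by gcongr; linarith
  have h6 : Nat.card {v : Fin m → G // ∀ x, ∃ i, ε < ‖φ x (v i)‖} +
      Nat.card {v : Fin m → G // ¬ ∀ x, ∃ i, ε < ‖φ x (v i)‖} = Nat.card (Fin m → G) := by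
    rw [← Nat.card_sum]
    exact Nat.card_congr (Equiv.sumCompl _)
  have h7 : (0 : ℝ) < Nat.card (Fin m → G) := by rw [hGm]; positivity
  rw [uniformProb, le_div_iff₀ h7]
  have h8 : (Nat.card {v : Fin m → G // ∀ x, ∃ i, ε < ‖φ x (v i)‖} : ℝ) +
      Nat.card {v : Fin m → G // ¬ ∀ x, ∃ i, ε < ‖φ x (v i)‖} = Nat.card (Fin m → G) := by
    exact_mod_cast h6
  linarith

end Characters

/-! ### The dual of an integer lattice -/

section DualLattice

variable {d : ℕ}

theorem mem_integerLattice {x : EuclideanSpace ℝ (Fin d)} :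
    x ∈ integerLattice d ↔ ∀ j, ∃ z : ℤ, x j = z := by
  have h := (EuclideanSpace.basisFun (Fin d) ℝ).toBasis.mem_span_iff_repr_mem ℤ x
  simp only [OrthonormalBasis.coe_toBasis] at h
  rw [integerLattice, h]
  simp [eq_comm]

theorem inner_mem_int {x y : EuclideanSpace ℝ (Fin d)} (hx : x ∈ integerLattice d)
    (hy : y ∈ integerLattice d) : ∃ z : ℤ, inner ℝ x y = z := by
  choose a ha using mem_integerLattice.1 hx
  choose c hc using mem_integerLattice.1 hy
  refine ⟨∑ j, c j * a j, ?_⟩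
  rw [PiLp.inner_apply]
  simp [ha, hc]

/-- The character `y ↦ ⟪x, y⟫` of the torus. -/
noncomputable def torusChar (x : integerLattice d) : Torus d →ₗ[ℤ] UnitAddCircle :=
  (integerLattice d).liftQ
    ((QuotientAddGroup.mk' (AddSubgroup.zmultiples (1 : ℝ))).comp
      (innerₗ (EuclideanSpace ℝ (Fin d)) x).toAddMonoidHom).toIntLinearMap (by
    intro y hy
    obtain ⟨z, hz⟩ := inner_mem_int x.2 hy
    change ((inner ℝ (x : EuclideanSpace ℝ (Fin d)) y : ℝ) : UnitAddCircle) = 0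
    rw [AddCircle.coe_eq_zero_iff]
    exact ⟨z, by simp [hz]⟩)

theorem torusChar_mk (x : integerLattice d) (y : EuclideanSpace ℝ (Fin d)) :
    torusChar x ((integerLattice d).mkQ y) =
      ((inner ℝ (x : EuclideanSpace ℝ (Fin d)) y : ℝ) : UnitAddCircle) := rfl

theorem unitAddCircle_coe_eq_zero {t : ℝ} : (t : UnitAddCircle) = 0 ↔ ∃ z : ℤ, t = z := by
  rw [AddCircle.coe_eq_zero_iff]
  simp [eq_comm]

theorem mem_dualLattice {L : Submodule ℤ (EuclideanSpace ℝ (Fin d))}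
    {y : EuclideanSpace ℝ (Fin d)} :
    y ∈ dualLattice L ↔ ∀ x ∈ L, ∃ z : ℤ, inner ℝ x y = z := by
  rw [dualLattice, LinearMap.BilinForm.mem_dualSubmodule]
  refine forall₂_congr fun x _ => ?_
  rw [Submodule.mem_one, innerₗ_apply_apply, real_inner_comm]
  simp [eq_comm]

instance : DiscreteTopology (integerLattice d) := by
  have : integerLattice d =
      Submodule.span ℤ (Set.range (EuclideanSpace.basisFun (Fin d) ℝ).toBasis) := by
    rw [OrthonormalBasis.coe_toBasis, integerLattice]
  rw [this]
  infer_instance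

instance : IsZLattice ℝ (integerLattice d) where
  span_top := by
    rw [integerLattice, Submodule.span_span_of_tower, ← OrthonormalBasis.coe_toBasis]
    exact Module.Basis.span_eq _

theorem covolume_integerLattice : ZLattice.covolume (integerLattice d) = 1 := by
  have h : MeasureTheory.IsAddFundamentalDomain (integerLattice d)
      (ZSpan.fundamentalDomain (EuclideanSpace.basisFun (Fin d) ℝ).toBasis) := by
    have := ZSpan.isAddFundamentalDomain (EuclideanSpace.basisFun (Fin d) ℝ).toBasis
      MeasureTheory.volume
    rwa [OrthonormalBasis.coe_toBasis] at this
  rw [ZLattice.covolume_eq_measure_fundamentalDomain _ _ h, MeasureTheory.measureReal_def,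
    MeasureTheory.measure_congr (ZSpan.fundamentalDomain_ae_parallelepiped _ _),
    OrthonormalBasis.coe_toBasis, OrthonormalBasis.volume_parallelepiped]
  simp

variable {L : Submodule ℤ (EuclideanSpace ℝ (Fin d))}

theorem integerLattice_le_dualLattice (hL : L ≤ integerLattice d) :
    integerLattice d ≤ dualLattice L := fun _ hy =>
  mem_dualLattice.2 fun _ hx => inner_mem_int (hL hx) hy

/-- The restriction of a character to the cosets of the dual lattice. -/
noncomputable def dualChar (L : Submodule ℤ (EuclideanSpace ℝ (Fin d))) (x : integerLattice d) :
    dualCosets L →+ UnitAddCircle :=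
  ((torusChar x).domRestrict (dualCosets L)).toAddMonoidHom

theorem dualChar_apply (x : integerLattice d) (g : dualCosets L) :
    dualChar L x g = torusChar x g := rfl

theorem dualChar_eq_zero {x : integerLattice d} (hx : (x : EuclideanSpace ℝ (Fin d)) ∈ L)
    (g : dualCosets L) : dualChar L x g = 0 := by
  obtain ⟨y, hy, h⟩ := g.2
  rw [dualChar_apply, ← h, torusChar_mk, unitAddCircle_coe_eq_zero]
  exact mem_dualLattice.1 hy _ hx

theorem dualChar_sub (x x' : integerLattice d) (g : dualCosets L) :
    dualChar L (x - x') g = dualChar L x g - dualChar L x' g := by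
  obtain ⟨y, hy, h⟩ := g.2
  simp only [dualChar_apply, ← h, torusChar_mk]
  rw [← AddCircle.coe_sub, ← inner_sub_left]
  rfl

theorem nsmul_dualChar (n : ℕ) (x : integerLattice d) (g : dualCosets L) :
    dualChar L (n • x) g = n • dualChar L x g := by
  obtain ⟨y, hy, h⟩ := g.2
  simp only [dualChar_apply, ← h, torusChar_mk]
  rw [← AddCircle.coe_nsmul]
  congr 1
  rw [nsmul_eq_mul, ← real_inner_smul_left, Nat.cast_smul_eq_nsmul]
  rfl

variable [DiscreteTopology L] [IsZLattice ℝ L]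

/-- A full lattice is its own double dual. -/
theorem mem_of_inner_dualLattice {x : EuclideanSpace ℝ (Fin d)}
    (h : ∀ y ∈ dualLattice L, ∃ z : ℤ, inner ℝ x y = z) : x ∈ L := by
  have : Module.Finite ℤ L := ZLattice.module_finite ℝ L
  have : Module.Free ℤ L := ZLattice.module_free ℝ L
  let b := (Module.Free.chooseBasis ℤ L).ofZLatticeBasis ℝ L
  have hb : Submodule.span ℤ (Set.range b) = L := Module.Basis.ofZLatticeBasis_span ..
  have hsym : LinearMap.BilinForm.IsSymm (innerₗ (EuclideanSpace ℝ (Fin d))) :=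
    ⟨fun x y => real_inner_comm y x⟩
  have hnd : (innerₗ (EuclideanSpace ℝ (Fin d))).Nondegenerate :=
    ⟨fun x hx => inner_self_eq_zero.1 (hx x), fun x hx => inner_self_eq_zero.1 (hx x)⟩
  have h2 : dualLattice (dualLattice L) = L := by
    rw [← hb]
    exact LinearMap.BilinForm.dualSubmodule_dualSubmodule_of_basis _ hnd hsym b
  rw [← h2, mem_dualLattice]
  intro y hy
  rw [real_inner_comm]
  exact h y hy

theorem mem_of_dualChar_eq_zero {x : integerLattice d} (h : ∀ g, dualChar L x g = 0) :
    (x : EuclideanSpace ℝ (Fin d)) ∈ L :=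
  mem_of_inner_dualLattice fun y hy => by
    have := h ⟨(integerLattice d).mkQ y, y, hy, rfl⟩
    rwa [dualChar_apply, torusChar_mk, unitAddCircle_coe_eq_zero] at this

/-- The group `ℤᵈ / L`. -/
abbrev LatticeQuotient (L : Submodule ℤ (EuclideanSpace ℝ (Fin d))) : Type :=
  integerLattice d ⧸ L.toAddSubgroup.addSubgroupOf (integerLattice d).toAddSubgroup

/-- The index of `L` in `ℤ^d` is a ratio of covolumes; through it the determinant bound limits the
number of characters in the union bound. -/
theorem card_latticeQuotient (hL : L ≤ integerLattice d) :
    (Nat.card (LatticeQuotient L) : ℝ) = ZLattice.covolume L := by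
  have h := ZLattice.covolume_div_covolume_eq_relIndex' L (integerLattice d) hL
  rw [covolume_integerLattice, div_one] at h
  exact h.symm

theorem finite_latticeQuotient (hL : L ≤ integerLattice d) : Finite (LatticeQuotient L) := by
  apply Nat.finite_of_card_ne_zero
  have h1 := card_latticeQuotient hL
  have h2 := ZLattice.covolume_pos L MeasureTheory.volume
  intro h0
  rw [h0] at h1
  simp at h1
  linarith

theorem exists_nsmul_mem (hL : L ≤ integerLattice d) :
    ∃ n : ℕ, 0 < n ∧ ∀ x : integerLattice d, ((n • x : integerLattice d) :
      EuclideanSpace ℝ (Fin d)) ∈ L := by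
  have := finite_latticeQuotient hL
  refine ⟨Nat.card (LatticeQuotient L), Nat.card_pos, fun x => ?_⟩
  have h := card_nsmul_eq_zero' (G := LatticeQuotient L) (x := QuotientAddGroup.mk x)
  rw [← QuotientAddGroup.mk_nsmul, QuotientAddGroup.eq_zero_iff] at h
  exact h

/-- If `n` annihilates `ℤ^d / L`, the `d` coordinate characters take `n`-torsion values on `L* /
ℤ^d`, and together they separate its points. -/
theorem finite_dualCosets (hL : L ≤ integerLattice d) : Finite (dualCosets L) := by
  obtain ⟨n, hn, h⟩ := exists_nsmul_mem hL
  have : Finite {u : UnitAddCircle // n • u = 0} := AddCircle.finite_torsion (1 : ℝ) hn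
  let e (j : Fin d) : integerLattice d :=
    ⟨EuclideanSpace.basisFun (Fin d) ℝ j, Submodule.subset_span ⟨j, rfl⟩⟩
  let f : dualCosets L → Fin d → {u : UnitAddCircle // n • u = 0} := fun g j =>
    ⟨dualChar L (e j) g, by rw [← nsmul_dualChar]; exact dualChar_eq_zero (h _) g⟩
  refine Finite.of_injective f fun g g' hgg => ?_
  obtain ⟨y, hy, hyg⟩ := (g - g').2
  have h0 : (g : Torus d) - g' = 0 := by
    rw [show (g : Torus d) - g' = (integerLattice d).mkQ y from hyg.symm, Submodule.mkQ_apply,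
      Submodule.Quotient.mk_eq_zero, mem_integerLattice]
    intro j
    have h1 : dualChar L (e j) (g - g') = 0 := by
      rw [map_sub, sub_eq_zero]
      exact congrArg Subtype.val (congrFun hgg j)
    rw [dualChar_apply, ← hyg, torusChar_mk, unitAddCircle_coe_eq_zero] at h1
    simpa [e, PiLp.inner_apply] using h1
  exact Subtype.ext (sub_eq_zero.1 h0)

/-- Multiplication by `r` embeds the given classes of `ℤ^d / L` into `L / rL`, which has `r ^ d`
elements: if `r x_i - r x_j = r z` with `z ∈ L`, then `x_i - x_j = z`. -/
theorem card_torsion_le {ι : Type*} (x : ι → integerLattice d)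
    (hx : ∀ i j, ((x i - x j : integerLattice d) : EuclideanSpace ℝ (Fin d)) ∈ L → i = j) {r : ℕ}
    (hr : 0 < r) (h : ∀ i, ((r • x i : integerLattice d) : EuclideanSpace ℝ (Fin d)) ∈ L) :
    Nat.card ι ≤ r ^ d := by
  have : Module.Finite ℤ L := ZLattice.module_finite ℝ L
  have : Module.Free ℤ L := ZLattice.module_free ℝ L
  have : NeZero r := ⟨hr.ne'⟩
  have hrank : Module.finrank ℤ L = d := by rw [ZLattice.rank ℝ L, finrank_euclideanSpace_fin]
  let β : Module.Basis (Fin d) ℤ L := Module.finBasisOfFinrankEq ℤ L hrank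
  let f : ι → Fin d → ZMod r := fun i k => (β.repr ⟨_, h i⟩ k : ℤ)
  have hf : Function.Injective f := by
    intro i j hij
    apply hx
    have h1 : ∀ k, ∃ z : ℤ, β.repr ⟨_, h i⟩ k - β.repr ⟨_, h j⟩ k = r * z := by
      intro k
      have h2 : ((β.repr ⟨_, h i⟩ k : ℤ) : ZMod r) = (β.repr ⟨_, h j⟩ k : ℤ) := congrFun hij k
      have h3 := (ZMod.intCast_eq_intCast_iff_dvd_sub _ _ r).1 h2.symm
      exact h3
    choose z hz using h1
    have h4 : (⟨_, h i⟩ - ⟨_, h j⟩ : L) = (r : ℤ) • ∑ k, z k • β k := by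
      rw [← β.sum_repr (⟨_, h i⟩ - ⟨_, h j⟩), Finset.smul_sum]
      refine Finset.sum_congr rfl fun k _ => ?_
      rw [map_sub, Finsupp.sub_apply, hz, mul_smul]
    have h5 : ((x i - x j : integerLattice d) : EuclideanSpace ℝ (Fin d)) =
        ((∑ k, z k • β k : L) : EuclideanSpace ℝ (Fin d)) := by
      have h6 := congrArg (Subtype.val : L → EuclideanSpace ℝ (Fin d)) h4
      have hr' : (r : ℝ) ≠ 0 := by positivity
      apply smul_right_injective (EuclideanSpace ℝ (Fin d)) hr'
      simp only [AddSubgroupClass.coe_sub, Submodule.coe_smul] at h6 ⊢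
      rw [Nat.cast_smul_eq_nsmul, Nat.cast_smul_eq_nsmul, smul_sub]
      rw [natCast_zsmul] at h6
      exact h6
    rw [h5]
    exact Subtype.mem _
  calc Nat.card ι ≤ Nat.card (Fin d → ZMod r) := Nat.card_le_card_of_injective f hf
    _ = r ^ d := by simp

theorem uniformProb_mono {α : Type*} [Finite α] {p q : α → Prop} (h : ∀ a, p a → q a) :
    uniformProb α p ≤ uniformProb α q := by
  unfold uniformProb
  gcongr
  exact Nat.card_le_card_of_injective (Subtype.map id h) (Subtype.map_injective h fun _ _ => id)

/-- Independent uniformly distributed elements of `L* / ℤᵈ` determine the lattice `L` robustly. -/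
theorem half_le_uniformProb_dualCosets (hL : L ≤ integerLattice d)
    (hdet : ZLattice.covolume L < 2 ^ (d ^ 2)) {m : ℕ} (hm : d + 4 ≤ m) :
    1 / 2 ≤ uniformProb (Fin m → dualCosets L) fun v => ∀ x : integerLattice d,
      (∀ i, ‖torusChar x (v i)‖ ≤ 1 / (3 * 2 ^ (d + 2))) → (x : EuclideanSpace ℝ (Fin d)) ∈ L := by
  have := finite_dualCosets hL
  have := finite_latticeQuotient hL
  have := Fintype.ofFinite (dualCosets L)
  have := Fintype.ofFinite {c : LatticeQuotient L // c ≠ 0}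
  -- Characters of vectors in `L` are trivial on `L* / ℤ^d`, so one representative per class covers
  -- all integer vectors.
  let x (c : LatticeQuotient L) : integerLattice d := c.out
  have hxc (c : LatticeQuotient L) : (QuotientAddGroup.mk (x c) : LatticeQuotient L) = c :=
    QuotientAddGroup.out_eq' c
  have hmk (y : integerLattice d) : (QuotientAddGroup.mk y : LatticeQuotient L) = 0 ↔
      (y : EuclideanSpace ℝ (Fin d)) ∈ L := QuotientAddGroup.eq_zero_iff y
  have hmem (c : LatticeQuotient L) : ((Nat.card (dualChar L (x c)).range • x c :
      integerLattice d) : EuclideanSpace ℝ (Fin d)) ∈ L := by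
    apply mem_of_dualChar_eq_zero
    intro g
    rw [nsmul_dualChar]
    have := card_nsmul_eq_zero' (G := (dualChar L (x c)).range) (x := ⟨dualChar L (x c) g, g, rfl⟩)
    simpa using congrArg Subtype.val this
  refine (half_le_uniformProb (X := {c : LatticeQuotient L // c ≠ 0})
    (fun c => dualChar L (x c)) (ε := 1 / (3 * 2 ^ (d + 2))) (by positivity) hm
    (fun c => ?_) (fun r hr => ?_) ?_).trans (uniformProb_mono fun v hv y hy => ?_)
  · by_contra hlt
    have h1 : 0 < Nat.card (dualChar L (x c)).range := Nat.card_pos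
    have h2 := hmem c
    rw [show Nat.card (dualChar L (x c)).range = 1 by omega, one_nsmul, ← hmk, hxc] at h2
    exact c.2 h2
  · refine card_torsion_le (L := L) (fun c => x c.1) (fun i j hij => ?_) hr fun i => ?_
    · rw [← hmk, QuotientAddGroup.mk_sub, hxc, hxc, sub_eq_zero] at hij
      exact Subtype.ext (Subtype.ext hij)
    · have := hmem i.1
      rwa [i.2] at this
  -- The choice of `ε` gives `3ε = 2 ^ (-(d + 2))`, and `(d + 2) * (d + 4) ≥ d ^ 2 + 2` beats the
  -- number of classes with a factor 4 to spare.
  · have h1 : (Nat.card {c : LatticeQuotient L // c ≠ 0} : ℝ) ≤ 2 ^ (d ^ 2) := by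
      refine le_trans ?_ hdet.le
      rw [← card_latticeQuotient hL]
      exact_mod_cast Nat.card_le_card_of_injective _ Subtype.val_injective
    calc _ ≤ (2 : ℝ) ^ (d ^ 2) * (3 * (1 / (3 * 2 ^ (d + 2)))) ^ (d + 4) := by
          refine mul_le_mul h1 ?_ (by positivity) (by positivity)
          refine pow_le_pow_of_le_one (by positivity) ?_ hm
          rw [mul_one_div, div_le_one (by positivity)]
          have : (1 : ℝ) ≤ 2 ^ (d + 2) := one_le_pow₀ (by norm_num)
          linarith
      _ = 2 ^ (d ^ 2) / 2 ^ ((d + 2) * (d + 4)) := by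
          rw [show (3 : ℝ) * (1 / (3 * 2 ^ (d + 2))) = 1 / 2 ^ (d + 2) by field_simp,
            one_div_pow, ← pow_mul, mul_one_div]
      _ ≤ 2 ^ (d ^ 2) / 2 ^ (d ^ 2 + 2) := by
          gcongr
          · norm_num
          · nlinarith
      _ = 1 / 4 := by
          rw [pow_add]
          field_simp
          norm_num
  · by_contra hyL
    have hc : (QuotientAddGroup.mk y : LatticeQuotient L) ≠ 0 := fun h0 => hyL ((hmk y).1 h0)
    obtain ⟨i, hi⟩ := hv ⟨_, hc⟩
    refine absurd (hy i) (not_le.2 (hi.trans_eq ?_))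
    have h1 : dualChar L (x (QuotientAddGroup.mk y) - y) (v i) = 0 := by
      apply dualChar_eq_zero
      rw [← hmk, QuotientAddGroup.mk_sub, hxc, sub_self]
    rw [dualChar_sub, sub_eq_zero] at h1
    rw [h1, dualChar_apply]

end DualLattice

/-! ### Short vectors of the reduced lattice -/

section GraphMap

variable {d m : ℕ}

/-- The linear map `u ↦ (u, ⟪e₁, u⟫, …, ⟪eₘ, u⟫)`. -/
noncomputable def graphMap (e : Fin m → EuclideanSpace ℝ (Fin d)) :
    EuclideanSpace ℝ (Fin d) →ₗ[ℝ] EuclideanSpace ℝ (Fin (d + m)) where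
  toFun u := WithLp.toLp 2 (Fin.append u.ofLp fun i => inner ℝ (e i) u)
  map_add' u u' := by
    ext c
    refine Fin.addCases (fun j => ?_) (fun i => ?_) c <;> simp [inner_add_right]
  map_smul' r u := by
    ext c
    refine Fin.addCases (fun j => ?_) (fun i => ?_) c <;> simp [inner_smul_right]

theorem graphMap_castAdd (e : Fin m → EuclideanSpace ℝ (Fin d)) (u : EuclideanSpace ℝ (Fin d))
    (j : Fin d) : graphMap e u (Fin.castAdd m j) = u j := by
  simp [graphMap]

theorem graphMap_natAdd (e : Fin m → EuclideanSpace ℝ (Fin d)) (u : EuclideanSpace ℝ (Fin d))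
    (i : Fin m) : graphMap e u (Fin.natAdd d i) = inner ℝ (e i) u := by
  simp [graphMap]

theorem graphMap_injective (e : Fin m → EuclideanSpace ℝ (Fin d)) :
    Function.Injective (graphMap e) := fun u u' h => by
  ext j
  rw [← graphMap_castAdd e u, h, graphMap_castAdd]

theorem norm_graphMap_sq (e : Fin m → EuclideanSpace ℝ (Fin d)) (u : EuclideanSpace ℝ (Fin d)) :
    ‖graphMap e u‖ ^ 2 = ‖u‖ ^ 2 + ∑ i, inner ℝ (e i) u ^ 2 := by
  rw [EuclideanSpace.real_norm_sq_eq, EuclideanSpace.real_norm_sq_eq, Fin.sum_univ_add]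
  simp only [graphMap_castAdd, graphMap_natAdd]

theorem norm_graphMap_sq_le {e : Fin m → EuclideanSpace ℝ (Fin d)} {c : ℝ} (he : ∀ i, ‖e i‖ ≤ c)
    (u : EuclideanSpace ℝ (Fin d)) : ‖graphMap e u‖ ^ 2 ≤ (1 + m * c ^ 2) * ‖u‖ ^ 2 := by
  have h : ∀ i ∈ Finset.univ, inner ℝ (e i) u ^ 2 ≤ c ^ 2 * ‖u‖ ^ 2 := fun i _ => by
    rw [← mul_pow]
    exact sq_le_sq' (neg_le_of_abs_le ((abs_real_inner_le_norm _ _).trans (by gcongr; exact he i)))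
      ((real_inner_le_norm _ _).trans (by gcongr; exact he i))
  have := Finset.sum_le_sum h
  rw [Finset.sum_const, Finset.card_univ, Fintype.card_fin, nsmul_eq_mul] at this
  rw [norm_graphMap_sq]
  linarith

theorem norm_castAdd_le {y : EuclideanSpace ℝ (Fin (d + m))} {u : EuclideanSpace ℝ (Fin d)}
    (h : ∀ j, y (Fin.castAdd m j) = u j) : ‖u‖ ≤ ‖y‖ := by
  rw [← sq_le_sq₀ (norm_nonneg _) (norm_nonneg _), EuclideanSpace.real_norm_sq_eq,
    EuclideanSpace.real_norm_sq_eq, Fin.sum_univ_add]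
  simp only [h]
  exact le_add_of_nonneg_right (Finset.sum_nonneg fun i _ => sq_nonneg _)

theorem inner_intPoint (a : Fin d → ℤ) (u : EuclideanSpace ℝ (Fin d)) :
    inner ℝ (intPoint a) u = ∑ j, a j * u j := by
  simp [intPoint, PiLp.inner_apply, mul_comm]

theorem intPoint_mem_integerLattice (a : Fin d → ℤ) : intPoint a ∈ integerLattice d :=
  mem_integerLattice.2 fun j => ⟨a j, rfl⟩

theorem exists_eq_intPoint {u : EuclideanSpace ℝ (Fin d)} (h : u ∈ integerLattice d) :
    ∃ a, u = intPoint a := by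
  choose a ha using mem_integerLattice.1 h
  exact ⟨a, by ext j; exact ha j⟩

open LLL RAM

/-- The lattice spanned by the initial basis. -/
theorem mem_lat_entry {N : ℤ} {W : ℕ → ℕ → ℤ} {y : EuclideanSpace ℝ (Fin (d + m))} :
    y ∈ lat (vec (d + m) (ofEntries (entry d N W))) (d + m) ↔
      ∃ (u : Fin d → ℤ) (z : Fin m → ℤ), (∀ j, y (Fin.castAdd m j) = u j) ∧
        ∀ i : Fin m, y (Fin.natAdd d i) = inner ℝ (intPoint fun j : Fin d => W i j) (intPoint u)
          + N * z i := by
  have h : vec (d + m) (ofEntries (entry d N W)) '' Set.Iio (d + m) =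
      Set.range fun i : Fin (d + m) => vec (d + m) (ofEntries (entry d N W)) i := by
    ext x
    simp [Fin.exists_iff]
  have hc (c : Fin (d + m) → ℤ) (x : Fin (d + m)) :
      (∑ i, c i • vec (d + m) (ofEntries (entry d N W)) i) x =
        ∑ i, (c i : ℝ) * entry d N W i x := by
    simp [vec, ofEntries]
  have h1 (c : Fin (d + m) → ℤ) (j : Fin d) :
      (∑ i, c i • vec (d + m) (ofEntries (entry d N W)) i) (Fin.castAdd m j) =
        c (Fin.castAdd m j) := by
    rw [hc, Fin.sum_univ_add, Finset.sum_eq_single j, Finset.sum_eq_zero]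
    · simp [entry, not_le.2 j.2]
    · intro i _
      have : d + (i : ℕ) ≠ j := by omega
      simp [entry, this]
    · intro i _ hij
      have : (i : ℕ) ≠ j := fun h => hij (Fin.ext h)
      simp [entry, this]
    · simp
  have h2 (c : Fin (d + m) → ℤ) (r : Fin m) :
      (∑ i, c i • vec (d + m) (ofEntries (entry d N W)) i) (Fin.natAdd d r) =
        ∑ j : Fin d, W r j * (c (Fin.castAdd m j) : ℝ) + N * c (Fin.natAdd d r) := by
    rw [hc, Fin.sum_univ_add]
    congr 1
    · refine Finset.sum_congr rfl fun j _ => ?_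
      have : (j : ℕ) ≠ d + r := by omega
      simp [entry, this, mul_comm]
    · rw [Finset.sum_eq_single r]
      · simp [entry, mul_comm]
      · intro i _ hir
        have : (i : ℕ) ≠ r := fun h => hir (Fin.ext h)
        simp [entry, this]
      · simp
  rw [lat, h, Submodule.mem_span_range_iff_exists_fun]
  constructor
  · rintro ⟨c, rfl⟩
    refine ⟨fun j => c (Fin.castAdd m j), fun i => c (Fin.natAdd d i), h1 c, fun i => ?_⟩
    rw [h2, inner_intPoint]
    rfl
  · rintro ⟨u, z, hu, hz⟩
    refine ⟨Fin.append u z, ?_⟩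
    ext x
    refine Fin.addCases (fun j => ?_) (fun i => ?_) x
    · rw [h1, hu, Fin.append_left]
    · rw [h2, hz, inner_intPoint, Fin.append_right]
      simp [intPoint]

variable {L : Submodule ℤ (EuclideanSpace ℝ (Fin d))}

theorem graphMap_mem_lat_entry (hL : L ≤ integerLattice d) {N : ℤ} {W : ℕ → ℕ → ℤ}
    {y : Fin m → EuclideanSpace ℝ (Fin d)} (hy : ∀ i, y i ∈ dualLattice L)
    {u : EuclideanSpace ℝ (Fin d)} (hu : u ∈ L) :
    graphMap (fun i => intPoint (fun j : Fin d => W i j) - (N : ℝ) • y i) u ∈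
      lat (vec (d + m) (ofEntries (entry d N W))) (d + m) := by
  obtain ⟨a, rfl⟩ := exists_eq_intPoint (hL hu)
  choose z hz using fun i => mem_dualLattice.1 (hy i) _ hu
  refine mem_lat_entry.2 ⟨a, fun i => -z i, fun j => graphMap_castAdd .., fun i => ?_⟩
  rw [graphMap_natAdd, inner_sub_left, real_inner_smul_left, real_inner_comm _ (y i), hz]
  push_cast
  ring

theorem norm_coe_le_abs_add (t : ℝ) (z : ℤ) : ‖(t : UnitAddCircle)‖ ≤ |t + z| := by
  rw [UnitAddCircle.norm_eq]
  simpa using round_le t (-z)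

/-- Short vectors of the reduced lattice come from vectors of `L`. -/
theorem eq_graphMap_of_norm_le {N : ℤ} (hN : 0 < N) {W : ℕ → ℕ → ℤ}
    {y : Fin m → EuclideanSpace ℝ (Fin d)} (hy : ∀ i, y i ∈ dualLattice L) {ε c R : ℝ}
    (hε : ε < 1)
    (hgood : ∀ x : integerLattice d, (∀ i, ‖torusChar x ((integerLattice d).mkQ (y i))‖ ≤ ε) →
      (x : EuclideanSpace ℝ (Fin d)) ∈ L)
    (he : ∀ i : Fin m, ‖intPoint (fun j : Fin d => W i j) - (N : ℝ) • y i‖ ≤ c)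
    (hR : (c + 1) * R ≤ N * ε) {x : EuclideanSpace ℝ (Fin (d + m))}
    (hx : x ∈ lat (vec (d + m) (ofEntries (entry d N W))) (d + m)) (hxR : ‖x‖ ≤ R) :
    ∃ a : Fin d → ℤ, intPoint a ∈ L ∧
      x = graphMap (fun i => intPoint (fun j : Fin d => W i j) - (N : ℝ) • y i) (intPoint a) := by
  obtain ⟨a, z, ha, hz⟩ := mem_lat_entry.1 hx
  have hN' : (0 : ℝ) < N := by exact_mod_cast hN
  have hau : ‖intPoint a‖ ≤ R := (norm_castAdd_le ha).trans hxR
  -- Divided by `N`, the coordinate `d + i` of `x` is `⟨a, y_i⟩ + z_i` up to the error term `⟨W_i -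
  -- N y_i, a⟩ / N`; together they are at most `(c + 1) R / N ≤ ε`.
  have h1 (i : Fin m) : |inner ℝ (intPoint a) (y i) + z i| ≤ ε := by
    have h2 : N * (inner ℝ (intPoint a) (y i) + z i) = x (Fin.natAdd d i) -
        inner ℝ (intPoint (fun j : Fin d => W i j) - (N : ℝ) • y i) (intPoint a) := by
      rw [hz, inner_sub_left, real_inner_smul_left, real_inner_comm _ (y i)]
      ring
    have h3 : |x (Fin.natAdd d i)| ≤ R := (PiLp.norm_apply_le x _).trans hxR
    have h4 := (abs_real_inner_le_norm (intPoint (fun j : Fin d => W i j) - (N : ℝ) • y i)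
      (intPoint a)).trans (mul_le_mul (he i) hau (norm_nonneg _) ((norm_nonneg _).trans (he i)))
    have h5 := congrArg abs h2
    rw [abs_mul, abs_of_pos hN'] at h5
    have h6 := abs_sub (x (Fin.natAdd d i))
      (inner ℝ (intPoint (fun j : Fin d => W i j) - (N : ℝ) • y i) (intPoint a))
    refine le_of_mul_le_mul_left ?_ hN'
    linarith
  have haL : intPoint a ∈ L := hgood ⟨_, intPoint_mem_integerLattice a⟩ fun i => by
    rw [torusChar_mk]
    exact (norm_coe_le_abs_add _ (z i)).trans (h1 i)
  refine ⟨a, haL, ?_⟩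
  ext r
  refine Fin.addCases (fun j => ?_) (fun i => ?_) r
  · rw [ha, graphMap_castAdd]
    rfl
  · obtain ⟨t, ht⟩ := mem_dualLattice.1 (hy i) _ haL
    have h2 := (h1 i).trans_lt hε
    rw [ht] at h2
    -- Once `a` is known to be in `L`, the number `⟨a, y_i⟩ + z_i` is an integer of absolute value
    -- below 1, and this pins down `z_i`.
    have h3 : t + z i = 0 := Int.abs_lt_one_iff.1 (by exact_mod_cast h2)
    rw [hz, graphMap_natAdd, inner_sub_left, real_inner_smul_left, real_inner_comm _ (y i), ht,
      show z i = -t by omega]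
    push_cast
    ring

/-- The first vectors of the reduced basis span a sublattice of `L` that contains the short
vectors of `L`. -/
theorem exists_latticeBasis (hL : L ≤ integerLattice d) {K K' k : ℕ} {W : ℕ → ℕ → ℤ}
    {f : ℤ → ℤ → ℤ} (hf : IsOutputBasis K K' d (d + m) W k f)
    {y : Fin m → EuclideanSpace ℝ (Fin d)} (hy : ∀ i, y i ∈ dualLattice L) {ε c T : ℝ}
    (hε : ε < 1)
    (hgood : ∀ x : integerLattice d, (∀ i, ‖torusChar x ((integerLattice d).mkQ (y i))‖ ≤ ε) →
      (x : EuclideanSpace ℝ (Fin d)) ∈ L)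
    (he : ∀ i : Fin m, ‖intPoint (fun j : Fin d => W i j) - (2 ^ (K * d) : ℝ) • y i‖ ≤ c)
    (hR : (c + 1) * (2 ^ (d + m) * 2 ^ (K' * d)) ≤ 2 ^ (K * d) * ε)
    (hT : (1 + m * c ^ 2) * T ^ 2 ≤ 2 ^ (K' * d)) :
    ∃ Λ : Submodule ℤ (EuclideanSpace ℝ (Fin d)),
      IsLatticeBasis (fun i : Fin k => intPoint fun j : Fin d => f i j) Λ ∧
        Λ ≤ L ∧ ∀ u ∈ L, ‖u‖ ≤ T → u ∈ Λ := by
  obtain ⟨hk, hind, hlat, hshort, hlong⟩ := hf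
  let Φ := graphMap fun i : Fin m => intPoint (fun j : Fin d => W i j) - (2 ^ (K * d) : ℝ) • y i
  have hΦ : graphMap (fun i : Fin m => intPoint (fun j : Fin d => W i j) -
      ((2 ^ (K * d) : ℤ) : ℝ) • y i) = Φ := by simp [Φ]
  have h1 (i : Fin k) : intPoint (fun j : Fin d => f i j) ∈ L ∧
      vec (d + m) f i = Φ (intPoint fun j : Fin d => f i j) := by
    have h2 : ‖vec (d + m) f i‖ ≤ 2 ^ (d + m) * 2 ^ (K' * d) := by
      refine le_of_sq_le_sq ((hshort i i.2).trans ?_) (by positivity)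
      rw [mul_pow, ← pow_mul, mul_comm (d + m) 2, pow_mul 2 2, show (2 : ℝ) ^ 2 = 4 by norm_num]
      exact mul_le_mul_of_nonneg_left
        (le_self_pow₀ (one_le_pow₀ (by norm_num)) two_ne_zero) (by positivity)
    obtain ⟨a, ha, h⟩ := eq_graphMap_of_norm_le (N := 2 ^ (K * d)) (by positivity) hy hε hgood
      (by simpa using he) (by simpa using hR) (hlat ▸ mem_lat (i.2.trans_le hk)) h2
    rw [hΦ] at h
    have h3 : (fun j : Fin d => f i j) = a := by
      funext j
      have := congrArg (fun x => x (Fin.castAdd m j)) h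
      simp only [Φ, graphMap_castAdd] at this
      simpa [vec, intPoint] using this
    rw [h3]
    exact ⟨ha, h⟩
  refine ⟨_, ⟨?_, rfl⟩, ?_, fun u hu huT => ?_⟩
  -- The reduced rows are the images under `Φ` of their first `d` coordinates, so truncation cannot
  -- create a linear dependence.
  · apply LinearIndependent.of_comp Φ
    have h2 := hind.linearIndependent hk
    rwa [show (fun i : Fin k => vec (d + m) f i) = Φ ∘ fun i : Fin k =>
      intPoint fun j : Fin d => f i j from funext fun i => (h1 i).2] at h2
  · rw [Submodule.span_le]
    rintro _ ⟨i, rfl⟩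
    exact (h1 i).1
  -- The short vector `Φ u` lies in the span of the first `k` rows, which is the `Φ`-image of the
  -- output lattice; injectivity of `Φ` transfers membership back to `u`.
  · have h2 : Φ u ∈ lat (vec (d + m) f) k := by
      refine mem_lat_of_norm_sq_le hlong ?_ ?_
      · rw [hlat, ← hΦ]
        exact graphMap_mem_lat_entry hL hy hu
      · refine (norm_graphMap_sq_le he u).trans (le_trans ?_ hT)
        gcongr
    have h3 : lat (vec (d + m) f) k = (Submodule.span ℤ
        (Set.range fun i : Fin k => intPoint fun j : Fin d => f i j)).map
          (Φ.restrictScalars ℤ) := by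
      rw [Submodule.map_span, ← Set.range_comp, lat]
      congr 1
      ext x
      constructor
      · rintro ⟨i, hi, rfl⟩
        exact ⟨⟨i, hi⟩, (h1 ⟨i, hi⟩).2.symm⟩
      · rintro ⟨i, rfl⟩
        exact ⟨i, i.2, (h1 i).2⟩
    rw [h3] at h2
    obtain ⟨u', hu', h4⟩ := h2
    rwa [← graphMap_injective _ h4]

end GraphMap

/-! ### Rounding the input -/

section Rounding

variable {d m : ℕ}

open RAM

theorem abs_rounded_sub_le {N : ℤ} (hN : 0 < N) (w : Fin m → Fin d → ℚ)
    (hw : ∀ i j, 0 ≤ w i j ∧ w i j < 1) (i : Fin m) (j : Fin d) :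
    |(rounded N (inputState w) i j : ℝ) - N * (w i j : ℝ)| ≤ 1 := by
  have h0 : (inputState w).arr 0 (i : ℕ) (j : ℕ) = (w i j).num := by
    simp [inputState, matrixCells]
  have h1 : (inputState w).arr 1 (i : ℕ) (j : ℕ) = (w i j).den := by
    simp [inputState, matrixCells]
  have hden : (0 : ℤ) < (w i j).den := by exact_mod_cast (w i j).den_pos
  have hnum : 0 ≤ (w i j).num := Rat.num_nonneg.2 (hw i j).1
  have hlt : (w i j).num < (w i j).den := Rat.num_lt_denom_iff.2 (hw i j).2
  rw [rounded, h0, h1, Int.emod_eq_of_lt (by positivity)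
    (Int.ediv_lt_of_lt_mul hden (by gcongr))]
  have h2 := Int.ediv_mul_le (N * (w i j).num) hden.ne'
  have h3 := Int.lt_ediv_add_one_mul_self (N * (w i j).num) hden
  generalize N * (w i j).num / ((w i j).den : ℤ) = q at *
  have h4 : (w i j : ℝ) = (w i j).num / (w i j).den := Rat.cast_def _
  have hden' : (0 : ℝ) < (w i j).den := by exact_mod_cast hden
  have h2' : (q : ℝ) * (w i j).den ≤ N * (w i j).num := by exact_mod_cast h2
  have h3' : (N : ℝ) * (w i j).num < (q + 1) * (w i j).den := by exact_mod_cast h3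
  rw [h4, ← mul_div_assoc, abs_sub_le_iff]
  constructor
  · have := (le_div_iff₀ hden').2 h2'
    linarith
  · have := (div_lt_iff₀ hden').2 h3'
    linarith

theorem norm_le_of_abs_le_one {x : EuclideanSpace ℝ (Fin d)} (h : ∀ j, |x j| ≤ 1) : ‖x‖ ≤ d := by
  rw [← sq_le_sq₀ (norm_nonneg _) (by positivity), EuclideanSpace.real_norm_sq_eq]
  have h1 : ∀ j ∈ Finset.univ, x j ^ 2 ≤ 1 := fun j _ => (sq_le_one_iff_abs_le_one _).2 (h j)
  have h2 := Finset.sum_le_sum h1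
  simp only [Finset.sum_const, Finset.card_univ, Fintype.card_fin, nsmul_eq_mul, mul_one] at h2
  refine h2.trans ?_
  exact_mod_cast Nat.le_self_pow two_ne_zero d

theorem norm_rounded_sub_le {N : ℤ} (hN : 0 < N) {w : Fin m → Fin d → ℚ}
    (hw : ∀ i j, 0 ≤ w i j ∧ w i j < 1) {i : Fin m} {y : EuclideanSpace ℝ (Fin d)}
    (hy : N * ‖ratPoint (w i) - y‖ ≤ 1) :
    ‖intPoint (fun j : Fin d => rounded N (inputState w) i j) - (N : ℝ) • y‖ ≤ d + 1 := by
  have h1 : ‖intPoint (fun j : Fin d => rounded N (inputState w) i j) -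
      (N : ℝ) • ratPoint (w i)‖ ≤ d :=
    norm_le_of_abs_le_one fun j => by
      simpa [intPoint, ratPoint] using abs_rounded_sub_le hN w hw i j
  have h2 : ‖(N : ℝ) • (ratPoint (w i) - y)‖ ≤ 1 := by
    rwa [norm_smul, Real.norm_of_nonneg (by positivity)]
  refine le_trans (le_of_eq_of_le ?_ (norm_add_le _ _)) (add_le_add h1 h2)
  rw [smul_sub, sub_add_sub_cancel]

/-- Closeness on the torus is realized by some representative, and `L*` contains `ℤ^d`, so every
representative of `v` lies in `L*`. -/
theorem exists_lift {L : Submodule ℤ (EuclideanSpace ℝ (Fin d))} (hL : L ≤ integerLattice d)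
    {p : EuclideanSpace ℝ (Fin d)} {v : dualCosets L} {δ : ℝ}
    (h : dist ((integerLattice d).mkQ p) (v : Torus d) < δ) :
    ∃ y ∈ dualLattice L, (integerLattice d).mkQ y = v ∧ ‖p - y‖ < δ := by
  obtain ⟨y, hy, hyv⟩ := v.2
  rw [← hyv, dist_eq_norm, ← map_sub] at h
  obtain ⟨s, hs, hsδ⟩ := (QuotientAddGroup.norm_lt_iff (S := (integerLattice d).toAddSubgroup)).1 h
  have h1 : (integerLattice d).mkQ s = (integerLattice d).mkQ (p - y) := hs
  have h2 : (integerLattice d).mkQ (p - s) = v := by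
    rw [map_sub, h1, map_sub, sub_sub_cancel, hyv]
  refine ⟨p - s, ?_, h2, by rwa [sub_sub_cancel]⟩
  rw [← hyv, ← sub_eq_zero, ← map_sub, Submodule.mkQ_apply, Submodule.Quotient.mk_eq_zero] at h2
  simpa using add_mem (integerLattice_le_dualLattice hL h2) hy

end Rounding

/-! ### Choice of the exponents -/

section Parameters

theorem exp_natCast_le (n : ℕ) : Real.exp n ≤ 4 ^ n := by
  rw [← mul_one (n : ℝ), Real.exp_nat_mul]
  gcongr
  linarith [Real.exp_one_lt_d9]

theorem two_pow_le_exp (n : ℕ) : 2 ^ n ≤ Real.exp n := by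
  rw [← mul_one (n : ℝ), Real.exp_nat_mul]
  gcongr
  linarith [Real.exp_one_gt_d9]

variable {a c d m : ℕ}

/-- Every factor is bounded by powers of `2 ^ d`: two for `d + 2`, then `1 + a` and `c` from the
norm bound, and five for `3 * 2 ^ (d + 2)`, which add up to `c + a + 8`. -/
theorem succ_mul_le_two_pow (hd : 0 < d) (hm : m ≤ a * d) :
    ((d : ℝ) + 1 + 1) * (2 ^ (d + m) * 2 ^ (c * d)) ≤
      2 ^ ((c + a + 8) * d) * (1 / (3 * 2 ^ (d + 2))) := by
  rw [mul_one_div, le_div_iff₀ (by positivity)]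
  have h1 : (d : ℝ) + 1 ≤ 2 ^ d := by exact_mod_cast Nat.lt_two_pow_self (n := d)
  have h2 : (2 : ℝ) ≤ 2 ^ d := le_self_pow₀ (by norm_num) hd.ne'
  have h3 : (2 : ℝ) ^ m ≤ 2 ^ (a * d) := pow_le_pow_right₀ (by norm_num) hm
  calc _ ≤ ((2 : ℝ) ^ d * 2 ^ d * ((2 ^ d * 2 ^ (a * d)) * 2 ^ (c * d))) *
        ((2 ^ d * 2 ^ d) * (2 ^ d * (2 ^ d * 2 ^ d))) := by
        rw [pow_add (2 : ℝ) d m, pow_add (2 : ℝ) d 2]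
        gcongr
        · nlinarith
        · nlinarith
        · nlinarith
    _ = _ := by ring

/-- The polynomial factor is at most `2 * m * (d + 1) ^ 2`, costing `1 + a + 2` powers of `2 ^ d`;
`T ^ 2 ≤ 4 ^ (2 * c * d)` costs `4 * c` more. -/
theorem mul_sq_le_two_pow (hd : 0 < d) (hm : m ≤ a * d) (hm0 : 0 < m) {T : ℝ} (hT0 : 0 ≤ T)
    (hT : T ≤ Real.exp (c * d)) :
    (1 + m * ((d : ℝ) + 1) ^ 2) * T ^ 2 ≤ 2 ^ ((4 * c + a + 3) * d) := by
  have h1 : (d : ℝ) + 1 ≤ 2 ^ d := by exact_mod_cast Nat.lt_two_pow_self (n := d)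
  have h2 : (2 : ℝ) ≤ 2 ^ d := le_self_pow₀ (by norm_num) hd.ne'
  have h3 : (m : ℝ) ≤ 2 ^ (a * d) := by
    exact_mod_cast (Nat.lt_two_pow_self (n := m)).le.trans (Nat.pow_le_pow_right (by norm_num) hm)
  have h4 : T ≤ 4 ^ (c * d) := hT.trans (by exact_mod_cast exp_natCast_le (c * d))
  have h5 : (1 : ℝ) ≤ m * ((d : ℝ) + 1) ^ 2 := by
    have : (1 : ℝ) ≤ m := by exact_mod_cast hm0
    exact one_le_mul_of_one_le_of_one_le this (one_le_pow₀ (by linarith [d.cast_nonneg (α := ℝ)]))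
  calc _ ≤ (2 * (m * ((d : ℝ) + 1) ^ 2)) * T ^ 2 := by gcongr; linarith
    _ ≤ (2 ^ d * (2 ^ (a * d) * (2 ^ d) ^ 2)) * (4 ^ (c * d)) ^ 2 := by gcongr
    _ = _ := by
      rw [show (4 : ℝ) ^ (c * d) = 2 ^ (2 * (c * d)) by rw [pow_mul 2 2]; norm_num]
      ring

end Parameters

theorem mainTheorem6 (A B : ℝ) :
    ∃ C : ℝ, 0 < C ∧ ∃ P : RAM.Prog, P.IsPolyTime ∧
      ∀ (d m : ℕ), d + 4 ≤ m → (m : ℝ) ≤ A * d →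
      ∀ T : ℝ, T ≤ Real.exp (B * d) →
      ∀ δ : ℝ, 0 < δ → δ ≤ Real.exp (-(C * d)) →
      ∀ (L : Submodule ℤ (EuclideanSpace ℝ (Fin d))) [DiscreteTopology L] [IsZLattice ℝ L],
      L ≤ integerLattice d → ZLattice.covolume L < 2 ^ (d ^ 2) →
        1 / 4 ≤ uniformProb (Fin m → dualCosets L) fun v =>
          ∀ w : Fin m → Fin d → ℚ, (∀ i j, 0 ≤ w i j ∧ w i j < 1) →
            (∀ i, dist ((integerLattice d).mkQ (ratPoint (w i))) (v i : Torus d) < δ) →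
            ∃ (Λ : Submodule ℤ (EuclideanSpace ℝ (Fin d))) (k : ℕ) (b : Fin k → Fin d → ℤ),
              P.Outputs w b ∧ IsLatticeBasis (fun i => intPoint (b i)) Λ ∧
              Λ ≤ L ∧ ∀ u ∈ L, ‖u‖ ≤ T → u ∈ Λ := by
  obtain ⟨a, ha⟩ := exists_nat_ge A
  obtain ⟨c, hc⟩ := exists_nat_ge B
  -- `K'` makes the images of the vectors of norm at most `T` short, and `K` makes the scaling `N =
  -- 2 ^ (K * d)` large compared with the reduced basis. The constant `C` is `K`.
  let K' := 4 * c + a + 3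
  let K := K' + a + 8
  refine ⟨K, by positivity, RAM.mainProg K K', RAM.isPolyTime_mainProg K K', ?_⟩
  intro d m hdm hmA T hT δ hδ0 hδ L _ _ hL hdet
  have hma : m ≤ a * d := by
    have : (m : ℝ) ≤ a * d := hmA.trans (by gcongr)
    exact_mod_cast this
  have hd : 0 < d := Nat.pos_of_ne_zero fun h => by subst h; omega
  -- `T` may be negative, while squaring the norm bound needs a nonnegative one.
  have hTc : max T 0 ≤ Real.exp (c * d) :=
    max_le (hT.trans (by gcongr)) (Real.exp_pos _).le
  have := finite_dualCosets hL
  refine (by norm_num : (1 / 4 : ℝ) ≤ 1 / 2).trans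
    ((half_le_uniformProb_dualCosets hL hdet hdm).trans (uniformProb_mono ?_))
  intro v hv w hw hwv
  choose y hy hyv hwy using fun i => exists_lift hL (hwv i)
  have hε : (1 : ℝ) / (3 * 2 ^ (d + 2)) < 1 := by
    have : (1 : ℝ) ≤ 2 ^ (d + 2) := one_le_pow₀ (by norm_num)
    rw [div_lt_one (by positivity)]
    linarith
  -- After scaling by `N` the error of the samples is at most 1; with rounding, at most 1 per
  -- coordinate and hence `d` in norm, this gives the bound `d + 1`.
  have hN : (2 : ℝ) ^ (K * d) * δ ≤ 1 := by
    have h1 : (2 : ℝ) ^ (K * d) ≤ Real.exp (K * d) := by exact_mod_cast two_pow_le_exp (K * d)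
    calc _ ≤ Real.exp (K * d) * Real.exp (-(K * d)) := by gcongr
      _ = 1 := by rw [← Real.exp_add, add_neg_cancel, Real.exp_zero]
  obtain ⟨k, f, hf, hout⟩ := RAM.outputs_mainProg K K' hd (by omega) w
  have he (i : Fin m) := norm_rounded_sub_le (N := 2 ^ (K * d)) (by positivity) hw (i := i)
    (y := y i) (by
      push_cast
      exact (mul_le_mul_of_nonneg_left (hwy i).le (by positivity)).trans hN)
  obtain ⟨Λ, hΛ, hΛL, hΛT⟩ := exists_latticeBasis hL hf hy hε
    (fun x hx => hv x (by simpa only [hyv] using hx)) (by simpa using he)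
    (succ_mul_le_two_pow hd hma) (mul_sq_le_two_pow hd hma (by omega) (le_max_right T 0) hTc)
  exact ⟨Λ, k, _, hout, hΛ, hΛL, fun u hu huT => hΛT u hu (huT.trans (le_max_left _ _))⟩
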